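/- **Setting.** A graph is a compact Hausdorff space $G$ that is a union of finitely many homeomorphic copies of $[0,1]$, any two of which intersect at most at their endpoints; $\mathrm{Ver}(G)$ is the set of points of $G$ having no open neighbourhood homeomorphic to $]0,1[$. A continuous map $f:G\to G$ is a *PMG map* if there is a finite set $C\subseteq G$ such that $f$ is injective on each connected component of $G\setminus C$. Let $\Omega=[a_1,b_1]\cup\dots\cup[a_m,b_m]\subset\mathbb R$ with $a_1<b_1<\dots<a_m<b_m$ and $\partial\Omega=\{a_1,b_1,\dots,a_m,b_m\}$. A *PM map* is a map $F:\Omega\setminus C_F\to\Omega$, where $C_F\subseteq\Omega$ is finite, $\partial\Omega\subseteq C_F$, and $F$ is continuous and strictly monotone on each connected component of $\Omega\setminus C_F$. The PMG map $f$ is *induced by $F$ via* a continuous map $\pi:\Omega\to G$ if $\mathrm{Ver}(G)\subseteq\pi(\partial\Omega)$, $\pi$ maps $\Omega\setminus\partial\Omega$ homeomorphically onto $G\setminus\pi(\partial\Omega)$, and $\pi(F(x))=f(\pi(x))$ for all $x\in\Omega\setminus C_F$. Let $S_0$ be the real vector space with basis $\Omega$, and $S_1\subseteq S_0$ the subspace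 spanned by the vectors $y-x$ with $x,y$ in the same connected component of $\Omega$. Let $F_{\#0}:S_0\to S_0$ be the linear map with $F_{\#0}(x)=F(x)$ for $x\in\Omega\setminus C_F$ and $F_{\#0}(x)=0$ for $x\in C_F$. Let $F_{\#1}:S_1\to S_1$ be the unique linear map with $F_{\#1}(y-x)=F(y-)-F(x+)$ (one-sided limits) for all $x<y$ in $\Omega$ with $]x,y[\subseteq\Omega\setminus C_F$. Let $V$ be a real vector space, $V_0,V_1\subseteq V$ subspaces of finite codimension and $\varphi_j:V_j\to V_j$ linear ($j=0,1$). The pair $(\varphi_0,\varphi_1)$ has *finite rank* if $\varphi_0,\varphi_1$ have linear extensions $\overline\varphi_0,\overline\varphi_1:V\to V$ with $\overline\varphi_1-\overline\varphi_0$ of finite rank. Its trace is then $\mathrm{tr}(\varphi_0,\varphi_1)=\mathrm{tr}(\overline\varphi_1-\overline\varphi_0)-\mathrm{tr}\,\widetilde\varphi_1+\mathrm{tr}\,\widetilde\varphi_0$, where $\widetilde\varphi_j$ is the endomorphism of $V/V_j$ induced by $\overline\varphi_j$; this does not depend on the extensions. The *homological determinant* of $F$ is $$L(z)=\exp\Big(-\sum_{n\ge1}\mathrm{tr}\big((F_{\#0})^n,(F_{\#1})^n\big)\frac{z^n}{n}\Big),$$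 the traces being those of pairs on $V=S_0$, with $V_0=S_0$ and $V_1=S_1$. The *Lefschetz zeta function* of $f$ is $$\zeta^L(z)=\exp\sum_{n\ge1}\frac{\mathrm{tr}(f_{*0})^n-\mathrm{tr}(f_{*1})^n}{n}z^n,$$ where $f_{*i}$ is the map induced on $H_i(G;\mathbb R)$ and $\mathrm{tr}(f_{*i})^n$ denotes the trace of the $n$-th power of $f_{*i}$. Finally, $P$ is the union of all periodic orbits of $f$ that intersect $\pi(C_F)$, and $\mathrm{Fix}(g)$ is the set of fixed points of $g$. **Theorem.** Let $f:G\to G$ be a PMG map induced by a PM map $F:\Omega\setminus C_F\to\Omega$ via $\pi$. Then $H_0(G;\mathbb R)$ and $H_1(G;\mathbb R)$ are finite-dimensional, the pairs $((F_{\#0})^n,(F_{\#1})^n)$, $n\ge1$, have finite rank, the set $P$ is finite, the formal power series $\zeta^L(z)$, $L(z)$ and $\exp\sum_{n\ge1}\frac{\#(P\cap\mathrm{Fix}(f^n))}{n}z^n$ have integer coefficients, and $$\zeta^L(z)=L(z)\,\exp\sum_{n\ge1}\frac{\#(P\cap\mathrm{Fix}(f^n))}{n}z^n\qquad\text{in }\mathbb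 Z[[z]].$$ -/

import Mathlib

open Set Filter Topology

noncomputable section

/-! ### Finite rank traces and pairs of endomorphisms -/

section Pairs

variable {V : Type*} [AddCommGroup V] [Module ℝ V]

/-- The trace of an endomorphism of finite rank: the trace of its restriction to its image. -/
def finiteRankTrace (φ : Module.End ℝ V) : ℝ :=
  LinearMap.trace ℝ (LinearMap.range φ)
    (φ.restrict (p := LinearMap.range φ) (q := LinearMap.range φ)
      (fun x _ => LinearMap.mem_range_self φ x))

/-- Extensions `ext₀`, `ext₁` to the whole space `V` of a pair of endomorphisms
`φ₀ : V₀ → V₀`, `φ₁ : V₁ → V₁` such that `ext₁ - ext₀` has finite rank. -/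
structure PairExtension {V₀ V₁ : Submodule ℝ V}
    (φ₀ : Module.End ℝ V₀) (φ₁ : Module.End ℝ V₁) where
  ext₀ : Module.End ℝ V
  ext₁ : Module.End ℝ V
  extends₀ : ∀ v : V₀, ext₀ (v : V) = (φ₀ v : V)
  extends₁ : ∀ v : V₁, ext₁ (v : V) = (φ₁ v : V)
  finite_rank : FiniteDimensional ℝ (LinearMap.range (ext₁ - ext₀))

namespace PairExtension

variable {V₀ V₁ : Submodule ℝ V} {φ₀ : Module.End ℝ V₀} {φ₁ : Module.End ℝ V₁}

theorem le_comap₀ (E : PairExtension φ₀ φ₁) : V₀ ≤ V₀.comap E.ext₀ := fun v hv => by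
  have h := E.extends₀ ⟨v, hv⟩
  simp only [Submodule.mem_comap]
  rw [h]
  exact (φ₀ ⟨v, hv⟩).2

theorem le_comap₁ (E : PairExtension φ₀ φ₁) : V₁ ≤ V₁.comap E.ext₁ := fun v hv => by
  have h := E.extends₁ ⟨v, hv⟩
  simp only [Submodule.mem_comap]
  rw [h]
  exact (φ₁ ⟨v, hv⟩).2

/-- `tr (ext₁ - ext₀) - tr (quotient of ext₁) + tr (quotient of ext₀)`. -/
def trace (E : PairExtension φ₀ φ₁) : ℝ :=
  finiteRankTrace (E.ext₁ - E.ext₀)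
    - LinearMap.trace ℝ (V ⧸ V₁) (V₁.mapQ V₁ E.ext₁ E.le_comap₁)
    + LinearMap.trace ℝ (V ⧸ V₀) (V₀.mapQ V₀ E.ext₀ E.le_comap₀)

end PairExtension

/-- The pair `(φ₀, φ₁)` of endomorphisms of finite-codimensional subspaces has finite rank. -/
def PairFiniteRank {V₀ V₁ : Submodule ℝ V}
    (φ₀ : Module.End ℝ V₀) (φ₁ : Module.End ℝ V₁) : Prop :=
  FiniteDimensional ℝ (V ⧸ V₀) ∧ FiniteDimensional ℝ (V ⧸ V₁) ∧
    Nonempty (PairExtension φ₀ φ₁)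

open Classical in
/-- The trace of a pair of finite rank. It does not depend on the chosen extensions, see
`pairTrace_eq`; for a pair which is not of finite rank the value is the dummy `0`. -/
def pairTrace {V₀ V₁ : Submodule ℝ V}
    (φ₀ : Module.End ℝ V₀) (φ₁ : Module.End ℝ V₁) : ℝ :=
  if h : PairFiniteRank φ₀ φ₁ then (Classical.choice h.2.2).trace else 0

theorem finiteRankTrace_eq (φ : Module.End ℝ V) (W : Submodule ℝ V) [FiniteDimensional ℝ W]
    (hW : LinearMap.range φ ≤ W) :
    finiteRankTrace φ = LinearMap.trace ℝ W
      (φ.restrict (p := W) (q := W) (fun x _ => hW (LinearMap.mem_range_self φ x))) := by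
  have : FiniteDimensional ℝ (LinearMap.range φ) := Submodule.finiteDimensional_of_le hW
  let i : LinearMap.range φ →ₗ[ℝ] W := Submodule.inclusion hW
  let r : W →ₗ[ℝ] LinearMap.range φ := φ.rangeRestrict ∘ₗ W.subtype
  have h := LinearMap.trace_comp_comm' (R := ℝ) i r
  exact h.symm ▸ rfl

theorem finiteRankTrace_add (φ ψ : Module.End ℝ V) [FiniteDimensional ℝ (LinearMap.range φ)]
    [FiniteDimensional ℝ (LinearMap.range ψ)] :
    finiteRankTrace (φ + ψ) = finiteRankTrace φ + finiteRankTrace ψ := by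
  have h1 : LinearMap.range φ ≤ LinearMap.range φ ⊔ LinearMap.range ψ := le_sup_left
  have h2 : LinearMap.range ψ ≤ LinearMap.range φ ⊔ LinearMap.range ψ := le_sup_right
  have h3 : LinearMap.range (φ + ψ) ≤ LinearMap.range φ ⊔ LinearMap.range ψ := by
    rintro _ ⟨x, rfl⟩
    exact Submodule.add_mem_sup (LinearMap.mem_range_self φ x) (LinearMap.mem_range_self ψ x)
  rw [finiteRankTrace_eq _ _ h1, finiteRankTrace_eq _ _ h2, finiteRankTrace_eq _ _ h3, ← map_add]
  rfl

/-- An endomorphism vanishing on a finite-codimensional subspace `U` has finite rank, and its trace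
is the trace of the induced endomorphism of the quotient. -/
theorem finiteRankTrace_of_vanish (δ : Module.End ℝ V) (U : Submodule ℝ V)
    [FiniteDimensional ℝ (V ⧸ U)] (h : ∀ v ∈ U, δ v = 0) (hc : U ≤ U.comap δ) :
    FiniteDimensional ℝ (LinearMap.range δ) ∧
      finiteRankTrace δ = LinearMap.trace ℝ (V ⧸ U) (U.mapQ U δ hc) := by
  let g : (V ⧸ U) →ₗ[ℝ] V := U.liftQ δ (fun v hv => h v hv)
  have hr : LinearMap.range δ = LinearMap.range g := (Submodule.range_liftQ U δ _).symm
  have hf : FiniteDimensional ℝ (LinearMap.range δ) := by rw [hr]; infer_instance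
  refine ⟨hf, ?_⟩
  let g' : (V ⧸ U) →ₗ[ℝ] LinearMap.range δ := U.liftQ δ.rangeRestrict
    (fun v hv => by
      rw [LinearMap.mem_ker]; exact Subtype.ext (h v hv))
  let q : LinearMap.range δ →ₗ[ℝ] (V ⧸ U) := U.mkQ ∘ₗ (LinearMap.range δ).subtype
  have key := LinearMap.trace_comp_comm' (R := ℝ) g' q
  have e1 : g' ∘ₗ q = δ.restrict (p := LinearMap.range δ) (q := LinearMap.range δ)
      (fun x _ => LinearMap.mem_range_self δ x) := by
    ext x; rfl
  have e2 : q ∘ₗ g' = U.mapQ U δ hc := by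
    apply Submodule.linearMap_qext
    ext x; rfl
  rw [e1, e2] at key
  exact key.symm

theorem PairExtension.trace_eq {V₀ V₁ : Submodule ℝ V} [FiniteDimensional ℝ (V ⧸ V₀)]
    [FiniteDimensional ℝ (V ⧸ V₁)] {φ₀ : Module.End ℝ V₀} {φ₁ : Module.End ℝ V₁}
    (E E' : PairExtension φ₀ φ₁) : E.trace = E'.trace := by
  have v₀ : ∀ v ∈ V₀, (E.ext₀ - E'.ext₀) v = 0 := fun v hv => by
    have h1 := E.extends₀ ⟨v, hv⟩
    have h2 := E'.extends₀ ⟨v, hv⟩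
    simp only at h1 h2
    rw [LinearMap.sub_apply, h1, h2, sub_self]
  have v₁ : ∀ v ∈ V₁, (E'.ext₁ - E.ext₁) v = 0 := fun v hv => by
    have h1 := E.extends₁ ⟨v, hv⟩
    have h2 := E'.extends₁ ⟨v, hv⟩
    simp only at h1 h2
    rw [LinearMap.sub_apply, h1, h2, sub_self]
  have c₀ : V₀ ≤ V₀.comap (E.ext₀ - E'.ext₀) := fun v hv => by
    rw [Submodule.mem_comap, v₀ v hv]; exact V₀.zero_mem
  have c₁ : V₁ ≤ V₁.comap (E'.ext₁ - E.ext₁) := fun v hv => by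
    rw [Submodule.mem_comap, v₁ v hv]; exact V₁.zero_mem
  obtain ⟨f₀, t₀⟩ := finiteRankTrace_of_vanish _ V₀ v₀ c₀
  obtain ⟨f₁, t₁⟩ := finiteRankTrace_of_vanish _ V₁ v₁ c₁
  have q₀ : V₀.mapQ V₀ (E.ext₀ - E'.ext₀) c₀
      = V₀.mapQ V₀ E.ext₀ E.le_comap₀ - V₀.mapQ V₀ E'.ext₀ E'.le_comap₀ := by
    apply Submodule.linearMap_qext
    ext x; simp
  have q₁ : V₁.mapQ V₁ (E'.ext₁ - E.ext₁) c₁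
      = V₁.mapQ V₁ E'.ext₁ E'.le_comap₁ - V₁.mapQ V₁ E.ext₁ E.le_comap₁ := by
    apply Submodule.linearMap_qext
    ext x; simp
  rw [q₀, map_sub] at t₀
  rw [q₁, map_sub] at t₁
  have := E.finite_rank
  have := E'.finite_rank
  have hs : E'.ext₁ - E'.ext₀
      = (E'.ext₁ - E.ext₁) + (E.ext₁ - E.ext₀) + (E.ext₀ - E'.ext₀) := by abel
  have hfin : FiniteDimensional ℝ
      (LinearMap.range ((E'.ext₁ - E.ext₁) + (E.ext₁ - E.ext₀))) := by
    refine Submodule.finiteDimensional_of_le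
      (S₂ := LinearMap.range (E'.ext₁ - E.ext₁) ⊔ LinearMap.range (E.ext₁ - E.ext₀)) ?_
    rintro _ ⟨x, rfl⟩
    exact Submodule.add_mem_sup (LinearMap.mem_range_self _ x) (LinearMap.mem_range_self _ x)
  have hadd : finiteRankTrace (E'.ext₁ - E'.ext₀) = finiteRankTrace (E'.ext₁ - E.ext₁)
      + finiteRankTrace (E.ext₁ - E.ext₀) + finiteRankTrace (E.ext₀ - E'.ext₀) := by
    conv_lhs => rw [hs]
    rw [finiteRankTrace_add, finiteRankTrace_add]
  unfold PairExtension.trace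
  linarith

theorem pairTrace_eq {V₀ V₁ : Submodule ℝ V} [h₀ : FiniteDimensional ℝ (V ⧸ V₀)]
    [h₁ : FiniteDimensional ℝ (V ⧸ V₁)] {φ₀ : Module.End ℝ V₀} {φ₁ : Module.End ℝ V₁}
    (E : PairExtension φ₀ φ₁) : pairTrace φ₀ φ₁ = E.trace := by
  have h : PairFiniteRank φ₀ φ₁ := ⟨h₀, h₁, ⟨E⟩⟩
  rw [pairTrace, dif_pos h]
  exact PairExtension.trace_eq _ _

end Pairs

/-- The formal power series `exp (∑_{n ≥ 1} (a n / n) z ^ n)`. -/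
def expSeries (a : ℕ → ℝ) : PowerSeries ℝ :=
  (PowerSeries.exp ℝ).subst (PowerSeries.mk fun n => if n = 0 then 0 else a n / n)

/-- The determinant `exp (-∑_{n ≥ 1} tr (φ₀ ^ n, φ₁ ^ n) z ^ n / n)` of a pair. -/
def pairDeterminant {V : Type*} [AddCommGroup V] [Module ℝ V] {V₀ V₁ : Submodule ℝ V}
    (φ₀ : Module.End ℝ V₀) (φ₁ : Module.End ℝ V₁) : PowerSeries ℝ :=
  expSeries fun n => -pairTrace (φ₀ ^ n) (φ₁ ^ n)

/-! ### Piecewise monotone maps on finite unions of intervals -/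

/-- A finite disjoint union `[a₁, b₁] ∪ ⋯ ∪ [aₘ, bₘ]` with `a₁ < b₁ < a₂ < b₂ < ⋯ < aₘ < bₘ`. -/
structure IntervalUnion where
  m : ℕ
  a : Fin m → ℝ
  b : Fin m → ℝ
  a_lt_b : ∀ i, a i < b i
  b_lt_a : ∀ i j, i < j → b i < a j

namespace IntervalUnion

/-- The set `Ω ⊆ ℝ`. -/
def carrier (Ω : IntervalUnion) : Set ℝ := ⋃ i, Icc (Ω.a i) (Ω.b i)

instance : CoeSort IntervalUnion Type := ⟨fun Ω => ↥Ω.carrier⟩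

/-- `∂Ω = {a₁, b₁, …, aₘ, bₘ}`, as a subset of `Ω`. -/
def boundary (Ω : IntervalUnion) : Set Ω := {x | ∃ i, (x : ℝ) = Ω.a i ∨ (x : ℝ) = Ω.b i}

theorem isClosed_carrier (Ω : IntervalUnion) : IsClosed Ω.carrier :=
  isClosed_iUnion_of_finite fun _ => isClosed_Icc

end IntervalUnion

/-- A piecewise monotone map `F : Ω \ C → Ω`. -/
structure PMMap (Ω : IntervalUnion) where
  C : Set Ω
  finite_C : C.Finite
  boundary_subset : Ω.boundary ⊆ C
  toFun : ↥(Cᶜ) → Ω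
  continuousOn : ∀ x : ↥(Cᶜ), ContinuousOn toFun (connectedComponent x)
  strictMono_or_strictAnti : ∀ x : ↥(Cᶜ),
    StrictMonoOn toFun (connectedComponent x) ∨ StrictAntiOn toFun (connectedComponent x)

/-- `S₁(X; ℝ)`: the subspace of `S₀(X; ℝ) = X →₀ ℝ` generated by the vectors `y - x` with
`x`, `y` in the same connected component of `X`. -/
def S1 (X : Type*) [TopologicalSpace X] : Submodule ℝ (X →₀ ℝ) :=
  Submodule.span ℝ {v | ∃ x y : X, y ∈ connectedComponent x ∧
    v = Finsupp.single y 1 - Finsupp.single x 1}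

namespace PMMap

variable {Ω : IntervalUnion} (F : PMMap Ω)

/-- The one-sided limit `F(y-)`. -/
def leftLim (y : Ω) : Ω :=
  haveI : Nonempty Ω := ⟨y⟩
  limUnder (comap (fun t : ↥(F.Cᶜ) => ((t : Ω) : ℝ)) (𝓝[<] (y : ℝ))) F.toFun

/-- The one-sided limit `F(x+)`. -/
def rightLim (x : Ω) : Ω :=
  haveI : Nonempty Ω := ⟨x⟩
  limUnder (comap (fun t : ↥(F.Cᶜ) => ((t : Ω) : ℝ)) (𝓝[>] (x : ℝ))) F.toFun

/-- `F` is monotone on `[x, y]`: `x < y` and `]x, y[ ⊆ Ω \ C`. -/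
def MonotoneOnIcc (x y : Ω) : Prop :=
  (x : ℝ) < y ∧ ∀ t ∈ Ioo (x : ℝ) y, ∃ h : t ∈ Ω.carrier, (⟨t, h⟩ : Ω) ∉ F.C

open Classical in
/-- `F_{#0} : S₀(Ω; ℝ) → S₀(Ω; ℝ)`, with `x ↦ F(x)` off `C` and `x ↦ 0` on `C`. -/
def sharp0 : Module.End ℝ (Ω →₀ ℝ) :=
  Finsupp.lift (Ω →₀ ℝ) ℝ Ω fun x =>
    if h : x ∈ F.Cᶜ then Finsupp.single (F.toFun ⟨x, h⟩) 1 else 0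

/-- The property defining `F_{#1}`: `F_{#1}(y - x) = F(y-) - F(x+)` if `F` is monotone on
`[x, y]`. -/
def IsSharp1 (φ : Module.End ℝ (S1 Ω)) : Prop :=
  ∀ x y : Ω, F.MonotoneOnIcc x y → ∀ v : S1 Ω,
    (v : Ω →₀ ℝ) = Finsupp.single y 1 - Finsupp.single x 1 →
    (φ v : Ω →₀ ℝ) = Finsupp.single (F.leftLim y) 1 - Finsupp.single (F.rightLim x) 1

/-! The next facts show that `F_{#1}` exists and is unique. -/

/-- Points of a preconnected set of reals inside `Ω \ C` lie in one component of `Ω \ C`. -/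
theorem mem_component {s : Set ℝ} (hs : IsPreconnected s)
    (hg : ∀ t ∈ s, ∃ h : t ∈ Ω.carrier, (⟨t, h⟩ : Ω) ∉ F.C) (p q : ↥(F.Cᶜ))
    (hp : ((p : Ω) : ℝ) ∈ s) (hq : ((q : Ω) : ℝ) ∈ s) : q ∈ connectedComponent p := by
  let j : s → ↥(F.Cᶜ) := fun t => ⟨⟨t, (hg t t.2).1⟩, (hg t t.2).2⟩
  have hj : Continuous j := (continuous_subtype_val.subtype_mk _).subtype_mk _
  have : PreconnectedSpace s := Subtype.preconnectedSpace hs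
  have hr : IsPreconnected (range j) := isPreconnected_range hj
  exact hr.subset_connectedComponent ⟨⟨_, hp⟩, rfl⟩ ⟨⟨_, hq⟩, rfl⟩

theorem MonotoneOnIcc.exists_point {x y : Ω} (h : F.MonotoneOnIcc x y) {t : ℝ}
    (ht : t ∈ Ioo (x : ℝ) y) : ∃ p : ↥(F.Cᶜ), ((p : Ω) : ℝ) = t :=
  ⟨⟨⟨t, (h.2 t ht).1⟩, (h.2 t ht).2⟩, rfl⟩

theorem exists_limits {x y : Ω} (h : F.MonotoneOnIcc x y) :
    (∃ l, Tendsto F.toFun (comap (fun t : ↥(F.Cᶜ) => ((t : Ω) : ℝ)) (𝓝[<] (y : ℝ))) (𝓝 l)) ∧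
    (∃ l, Tendsto F.toFun (comap (fun t : ↥(F.Cᶜ) => ((t : Ω) : ℝ)) (𝓝[>] (x : ℝ))) (𝓝 l)) := by
  classical
  let c : ↥(F.Cᶜ) → ℝ := fun t => ((t : Ω) : ℝ)
  let g : ℝ → ℝ := fun t => if h : ∃ p : ↥(F.Cᶜ), c p = t then (F.toFun h.choose : ℝ) else 0
  have hc : Function.Injective c := Subtype.val_injective.comp Subtype.val_injective
  have hg : ∀ p, g (c p) = F.toFun p := by
    intro p
    have hp : ∃ q : ↥(F.Cᶜ), c q = c p := ⟨p, rfl⟩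
    simp only [g]
    rw [dif_pos hp, hc hp.choose_spec]
  have hne : (Ioo (x : ℝ) y).Nonempty := nonempty_Ioo.2 h.1
  obtain ⟨t₀, ht₀⟩ := hne
  obtain ⟨p₀, hp₀⟩ := h.exists_point F ht₀
  have hcomp : ∀ p : ↥(F.Cᶜ), c p ∈ Ioo (x : ℝ) y → p ∈ connectedComponent p₀ := fun p hp =>
    F.mem_component isPreconnected_Ioo h.2 p₀ p (by rw [hp₀]; exact ht₀) hp
  have hbdd : Bornology.IsBounded (g '' Ioo (x : ℝ) y) := by
    have hb : Bornology.IsBounded Ω.carrier :=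
      (Bornology.isBounded_iUnion).2 fun i => Metric.isBounded_Icc _ _
    refine hb.subset ?_
    rintro _ ⟨t, ht, rfl⟩
    obtain ⟨p, rfl⟩ := h.exists_point F ht
    have := hg p
    simp only [c] at this
    rw [this]
    exact (F.toFun p).2
  have hmono : MonotoneOn g (Ioo (x : ℝ) y) ∨ AntitoneOn g (Ioo (x : ℝ) y) := by
    refine (F.strictMono_or_strictAnti p₀).imp (fun H => ?_) (fun H => ?_)
    all_goals
      intro s hs t ht hst
      obtain ⟨p, rfl⟩ := h.exists_point F hs
      obtain ⟨q, rfl⟩ := h.exists_point F ht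
      have e1 := hg p
      have e2 := hg q
      simp only [c] at e1 e2
      rw [e1, e2]
      first
        | exact H.monotoneOn (hcomp p hs) (hcomp q ht) hst
        | exact H.antitoneOn (hcomp p hs) (hcomp q ht) hst
  have hlim : (∃ l, Tendsto g (𝓝[<] (y : ℝ)) (𝓝 l)) ∧ (∃ l, Tendsto g (𝓝[>] (x : ℝ)) (𝓝 l)) := by
    rcases hmono with H | H
    · exact ⟨⟨_, H.tendsto_nhdsWithin_Ioo_left ⟨t₀, ht₀⟩ hbdd.bddAbove⟩,
        ⟨_, H.tendsto_nhdsWithin_Ioo_right ⟨t₀, ht₀⟩ hbdd.bddBelow⟩⟩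
    · exact ⟨⟨_, H.tendsto_nhdsWithin_Ioo_left ⟨t₀, ht₀⟩ hbdd.bddBelow⟩,
        ⟨_, H.tendsto_nhdsWithin_Ioo_right ⟨t₀, ht₀⟩ hbdd.bddAbove⟩⟩
  have key : ∀ (l : Filter ℝ), l.NeBot → Ioo (x : ℝ) y ∈ l → (∃ a, Tendsto g l (𝓝 a)) →
      ∃ a, Tendsto F.toFun (comap c l) (𝓝 a) := by
    rintro l hl hmem ⟨a, ha⟩
    have : (comap c l).NeBot := by
      refine comap_neBot fun s hs => ?_
      obtain ⟨t, ht⟩ := hl.nonempty_of_mem (inter_mem hs hmem)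
      obtain ⟨p, hp⟩ := h.exists_point F ht.2
      exact ⟨p, by simp only [c]; rw [hp]; exact ht.1⟩
    have h1 : Tendsto (fun p => (F.toFun p : ℝ)) (comap c l) (𝓝 a) := by
      have h2 : Tendsto (g ∘ c) (comap c l) (𝓝 a) := ha.comp tendsto_comap
      exact h2.congr hg
    have ha' : a ∈ Ω.carrier :=
      Ω.isClosed_carrier.mem_of_tendsto h1 (Eventually.of_forall fun p => (F.toFun p).2)
    exact ⟨⟨a, ha'⟩, tendsto_subtype_rng.2 h1⟩
  exact ⟨key _ inferInstance (Ioo_mem_nhdsLT h.1) hlim.1,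
    key _ inferInstance (Ioo_mem_nhdsGT h.1) hlim.2⟩

theorem tendsto_leftLim {x y : Ω} (h : F.MonotoneOnIcc x y) :
    Tendsto F.toFun (comap (fun t : ↥(F.Cᶜ) => ((t : Ω) : ℝ)) (𝓝[<] (y : ℝ)))
      (𝓝 (F.leftLim y)) :=
  have : Nonempty Ω := ⟨y⟩
  tendsto_nhds_limUnder (F.exists_limits h).1

theorem tendsto_rightLim {x y : Ω} (h : F.MonotoneOnIcc x y) :
    Tendsto F.toFun (comap (fun t : ↥(F.Cᶜ) => ((t : Ω) : ℝ)) (𝓝[>] (x : ℝ)))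
      (𝓝 (F.rightLim x)) :=
  have : Nonempty Ω := ⟨x⟩
  tendsto_nhds_limUnder (F.exists_limits h).2

theorem neBot_left {x y : Ω} (h : F.MonotoneOnIcc x y) :
    (comap (fun t : ↥(F.Cᶜ) => ((t : Ω) : ℝ)) (𝓝[<] (y : ℝ))).NeBot := by
  refine comap_neBot fun s hs => ?_
  obtain ⟨t, ht⟩ := NeBot.nonempty_of_mem inferInstance (inter_mem hs (Ioo_mem_nhdsLT h.1))
  obtain ⟨p, hp⟩ := h.exists_point F ht.2
  exact ⟨p, by rw [hp]; exact ht.1⟩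

theorem neBot_right {x y : Ω} (h : F.MonotoneOnIcc x y) :
    (comap (fun t : ↥(F.Cᶜ) => ((t : Ω) : ℝ)) (𝓝[>] (x : ℝ))).NeBot := by
  refine comap_neBot fun s hs => ?_
  obtain ⟨t, ht⟩ := NeBot.nonempty_of_mem inferInstance (inter_mem hs (Ioo_mem_nhdsGT h.1))
  obtain ⟨p, hp⟩ := h.exists_point F ht.2
  exact ⟨p, by rw [hp]; exact ht.1⟩

theorem leftLim_mem_component {x y : Ω} (h : F.MonotoneOnIcc x y) :
    F.leftLim y ∈ connectedComponent (F.rightLim x) := by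
  obtain ⟨t₀, ht₀⟩ : (Ioo (x : ℝ) y).Nonempty := nonempty_Ioo.2 h.1
  obtain ⟨p₀, hp₀⟩ := h.exists_point F ht₀
  let K : Set Ω := F.toFun '' connectedComponent p₀
  have hK : IsPreconnected K :=
    isPreconnected_connectedComponent.image _ (F.continuousOn p₀)
  have hcomp : ∀ p : ↥(F.Cᶜ), ((p : Ω) : ℝ) ∈ Ioo (x : ℝ) y → F.toFun p ∈ K := fun p hp =>
    mem_image_of_mem _ (F.mem_component isPreconnected_Ioo h.2 p₀ p (by rw [hp₀]; exact ht₀) hp)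
  have := F.neBot_left h
  have := F.neBot_right h
  have h1 : F.leftLim y ∈ closure K := mem_closure_of_tendsto (F.tendsto_leftLim h)
    (mem_of_superset (preimage_mem_comap (Ioo_mem_nhdsLT h.1)) fun p hp => hcomp p hp)
  have h2 : F.rightLim x ∈ closure K := mem_closure_of_tendsto (F.tendsto_rightLim h)
    (mem_of_superset (preimage_mem_comap (Ioo_mem_nhdsGT h.1)) fun p hp => hcomp p hp)
  exact hK.closure.subset_connectedComponent h2 h1

theorem leftLim_eq {x y : Ω} (h : F.MonotoneOnIcc x y) (hy : y ∈ F.Cᶜ) :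
    F.leftLim y = F.toFun ⟨y, hy⟩ := by
  have := F.neBot_left h
  refine tendsto_nhds_unique (F.tendsto_leftLim h) ?_
  have hgood : ∀ t ∈ Ioc (x : ℝ) y, ∃ h : t ∈ Ω.carrier, (⟨t, h⟩ : Ω) ∉ F.C := by
    intro t ht
    rcases eq_or_lt_of_le ht.2 with e | e
    · subst e; exact ⟨y.2, hy⟩
    · exact h.2 t ⟨ht.1, e⟩
  have hc := F.continuousOn ⟨y, hy⟩ ⟨y, hy⟩ mem_connectedComponent
  refine hc.mono_left (le_inf ?_ (le_principal_iff.2 ?_))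
  · rw [nhds_subtype_eq_comap, nhds_subtype_eq_comap, comap_comap]
    exact comap_mono nhdsWithin_le_nhds
  · exact mem_of_superset (preimage_mem_comap (Ioo_mem_nhdsLT h.1)) fun p hp =>
      F.mem_component isPreconnected_Ioc hgood _ p ⟨h.1, le_rfl⟩ (Ioo_subset_Ioc_self hp)

theorem rightLim_eq {x y : Ω} (h : F.MonotoneOnIcc x y) (hx : x ∈ F.Cᶜ) :
    F.rightLim x = F.toFun ⟨x, hx⟩ := by
  have := F.neBot_right h
  refine tendsto_nhds_unique (F.tendsto_rightLim h) ?_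
  have hgood : ∀ t ∈ Ico (x : ℝ) y, ∃ h : t ∈ Ω.carrier, (⟨t, h⟩ : Ω) ∉ F.C := by
    intro t ht
    rcases eq_or_lt_of_le ht.1 with e | e
    · subst e; exact ⟨x.2, hx⟩
    · exact h.2 t ⟨e, ht.2⟩
  have hc := F.continuousOn ⟨x, hx⟩ ⟨x, hx⟩ mem_connectedComponent
  refine hc.mono_left (le_inf ?_ (le_principal_iff.2 ?_))
  · rw [nhds_subtype_eq_comap, nhds_subtype_eq_comap, comap_comap]
    exact comap_mono nhdsWithin_le_nhds
  · exact mem_of_superset (preimage_mem_comap (Ioo_mem_nhdsGT h.1)) fun p hp =>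
      F.mem_component isPreconnected_Ico hgood _ p ⟨le_rfl, h.1⟩ (Ioo_subset_Ico_self hp)

theorem _root_.IntervalUnion.mem_component {Ω : IntervalUnion} {x y : Ω} (hxy : (x : ℝ) ≤ y)
    (h : Icc (x : ℝ) y ⊆ Ω.carrier) : y ∈ connectedComponent x := by
  have : PreconnectedSpace (Icc (x : ℝ) y) := Subtype.preconnectedSpace isPreconnected_Icc
  have hr : IsPreconnected (range (inclusion h)) :=
    isPreconnected_range (continuous_inclusion h)
  exact hr.subset_connectedComponent ⟨⟨x, le_rfl, hxy⟩, rfl⟩ ⟨⟨y, hxy, le_rfl⟩, rfl⟩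

theorem _root_.IntervalUnion.Icc_subset {Ω : IntervalUnion} {x y : Ω}
    (h : y ∈ connectedComponent x) : Icc (x : ℝ) y ⊆ Ω.carrier := by
  have hp : IsPreconnected (Subtype.val '' connectedComponent x : Set ℝ) :=
    isPreconnected_connectedComponent.image _ continuous_subtype_val.continuousOn
  intro t ht
  obtain ⟨s, -, rfl⟩ := hp.ordConnected.out (mem_image_of_mem _ mem_connectedComponent)
    (mem_image_of_mem _ h) ht
  exact s.2

theorem MonotoneOnIcc.mem_component {x y : Ω} (h : F.MonotoneOnIcc x y) :
    y ∈ connectedComponent x := by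
  refine IntervalUnion.mem_component h.1.le fun t ht => ?_
  rcases eq_or_lt_of_le ht.1 with e | e
  · subst e; exact x.2
  rcases eq_or_lt_of_le ht.2 with e' | e'
  · subst e'; exact y.2
  exact (h.2 t ⟨e, e'⟩).1

/-- The differences `y - x` with `F` monotone on `[x, y]` span `S₁(Ω; ℝ)`. -/
theorem S1_eq_span : S1 Ω = Submodule.span ℝ {v | ∃ x y : Ω, F.MonotoneOnIcc x y ∧
    v = Finsupp.single y 1 - Finsupp.single x 1} := by
  apply le_antisymm
  · set T := Submodule.span ℝ {v : Ω →₀ ℝ | ∃ x y : Ω, F.MonotoneOnIcc x y ∧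
      v = Finsupp.single y 1 - Finsupp.single x 1} with hT
    have key : ∀ n : ℕ, ∀ x y : Ω, (x : ℝ) < y → Icc (x : ℝ) y ⊆ Ω.carrier →
        (F.C ∩ {c | (c : ℝ) ∈ Ioo (x : ℝ) y}).ncard = n →
        (Finsupp.single y 1 - Finsupp.single x 1 : Ω →₀ ℝ) ∈ T := by
      intro n
      induction n using Nat.strong_induction_on with
      | _ n ih =>
        intro x y hxy hsub hn
        by_cases he : (F.C ∩ {c | (c : ℝ) ∈ Ioo (x : ℝ) y}).Nonempty
        · obtain ⟨c, hcC, hc⟩ := he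
          have hfin : (F.C ∩ {c | (c : ℝ) ∈ Ioo (x : ℝ) y}).Finite := F.finite_C.inter_of_left _
          have h1 : (F.C ∩ {d | (d : ℝ) ∈ Ioo (x : ℝ) c}).ncard < n := by
            rw [← hn]
            refine ncard_lt_ncard ⟨fun d hd => ⟨hd.1, hd.2.1, hd.2.2.trans hc.2⟩, fun H => ?_⟩ hfin
            exact lt_irrefl _ (H ⟨hcC, hc⟩).2.2
          have h2 : (F.C ∩ {d | (d : ℝ) ∈ Ioo (c : ℝ) y}).ncard < n := by
            rw [← hn]
            refine ncard_lt_ncard ⟨fun d hd => ⟨hd.1, hc.1.trans hd.2.1, hd.2.2⟩, fun H => ?_⟩ hfin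
            exact lt_irrefl _ (H ⟨hcC, hc⟩).2.1
          have i1 := ih _ h1 x c hc.1
            ((Icc_subset_Icc_right hc.2.le).trans hsub) rfl
          have i2 := ih _ h2 c y hc.2
            ((Icc_subset_Icc_left hc.1.le).trans hsub) rfl
          have := T.add_mem i2 i1
          rwa [sub_add_sub_cancel] at this
        · refine Submodule.subset_span ⟨x, y, ⟨hxy, fun t ht => ?_⟩, rfl⟩
          exact ⟨hsub (Ioo_subset_Icc_self ht), fun hC => he ⟨_, hC, ht⟩⟩
    refine Submodule.span_le.2 ?_
    rintro _ ⟨x, y, hxy, rfl⟩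
    rcases lt_trichotomy (x : ℝ) y with h | h | h
    · exact key _ x y h (IntervalUnion.Icc_subset hxy) rfl
    · have : x = y := Subtype.ext h
      subst this
      simp
    · have hyx : x ∈ connectedComponent y := by
        rw [← connectedComponent_eq hxy]
        exact mem_connectedComponent
      have := T.neg_mem (key _ y x h (IntervalUnion.Icc_subset hyx) rfl)
      rwa [neg_sub] at this
  · refine Submodule.span_mono ?_
    rintro _ ⟨x, y, hxy, rfl⟩
    exact ⟨x, y, hxy.mem_component F, rfl⟩

theorem exists_isSharp1 : ∃ φ : Module.End ℝ (S1 Ω), F.IsSharp1 φ := by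
  classical
  let A : Ω → Ω → ℝ := fun c x => if c ∈ connectedComponent x ∧ (c : ℝ) ≤ x then 1 else 0
  let B : Ω → Ω → ℝ := fun c x => if c ∈ connectedComponent x ∧ (c : ℝ) < x then 1 else 0
  let K : Finset Ω := F.finite_C.toFinset
  let P : Ω → (Ω →₀ ℝ) := fun x =>
    (if h : x ∈ F.Cᶜ then Finsupp.single (F.toFun ⟨x, h⟩) 1 else 0)
      + (∑ c ∈ K, A c x • Finsupp.single (F.leftLim c) 1
        - ∑ c ∈ K, B c x • Finsupp.single (F.rightLim c) 1)
  let φ : Module.End ℝ (Ω →₀ ℝ) := Finsupp.lift (Ω →₀ ℝ) ℝ Ω P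
  have hφ : ∀ x, φ (Finsupp.single x 1) = P x := fun x => by simp [φ]
  have hdiff : ∀ x y : Ω, F.MonotoneOnIcc x y →
      φ (Finsupp.single y 1 - Finsupp.single x 1)
        = Finsupp.single (F.leftLim y) 1 - Finsupp.single (F.rightLim x) 1 := by
    intro x y h
    have hcc : connectedComponent x = connectedComponent y :=
      connectedComponent_eq (h.mem_component F)
    have hno : ∀ c ∈ K, (x : ℝ) < c → (c : ℝ) < y → False := fun c hc h1 h2 =>
      (h.2 c ⟨h1, h2⟩).2 (F.finite_C.mem_toFinset.1 hc)
    have hA : ∀ c ∈ K, A c y = A c x + if c = y then 1 else 0 := by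
      intro c hc
      have hxy := h.1
      have hn := hno c hc
      by_cases hm : c ∈ connectedComponent y
      · by_cases hcy : c = y
        · subst hcy
          simpa [A, hcc, mem_connectedComponent] using hxy
        · have hne : (c : ℝ) ≠ y := fun e => hcy (Subtype.ext e)
          have : (c : ℝ) ≤ y ↔ (c : ℝ) ≤ x := by
            constructor
            · intro hle
              by_contra hlt
              exact hn (not_le.1 hlt) (lt_of_le_of_ne hle hne)
            · intro hle; linarith
          simp only [A, hcc, this, hcy, if_false, add_zero]
      · have hcy : c ≠ y := fun e => hm (e ▸ mem_connectedComponent)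
        simp [A, hcc, hm, hcy]
    have hB : ∀ c ∈ K, B c y = B c x + if c = x then 1 else 0 := by
      intro c hc
      have hxy := h.1
      have hn := hno c hc
      by_cases hm : c ∈ connectedComponent x
      · by_cases hcx : c = x
        · subst hcx
          simpa [B, ← hcc, mem_connectedComponent] using hxy
        · have hne : (c : ℝ) ≠ x := fun e => hcx (Subtype.ext e)
          have : (c : ℝ) < y ↔ (c : ℝ) < x := by
            constructor
            · intro hlt
              by_contra hle
              exact hn (lt_of_le_of_ne (not_lt.1 hle) hne.symm) hlt
            · intro hle; linarith
          simp only [B, hcc, this, hcx, if_false, add_zero]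
      · have hcx : c ≠ x := fun e => hm (e ▸ mem_connectedComponent)
        simp [B, ← hcc, hm, hcx]
    have hSA : ∑ c ∈ K, A c y • (Finsupp.single (F.leftLim c) 1 : Ω →₀ ℝ)
        = ∑ c ∈ K, A c x • Finsupp.single (F.leftLim c) 1
          + if y ∈ F.C then Finsupp.single (F.leftLim y) 1 else 0 := by
      rw [Finset.sum_congr rfl fun c hc => by rw [hA c hc, add_smul], Finset.sum_add_distrib]
      simp [ite_smul, K]
    have hSB : ∑ c ∈ K, B c y • (Finsupp.single (F.rightLim c) 1 : Ω →₀ ℝ)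
        = ∑ c ∈ K, B c x • Finsupp.single (F.rightLim c) 1
          + if x ∈ F.C then Finsupp.single (F.rightLim x) 1 else 0 := by
      rw [Finset.sum_congr rfl fun c hc => by rw [hB c hc, add_smul], Finset.sum_add_distrib]
      simp [ite_smul, K]
    have hy : (if h : y ∈ F.Cᶜ then Finsupp.single (F.toFun ⟨y, h⟩) 1 else 0 : Ω →₀ ℝ)
        + (if y ∈ F.C then Finsupp.single (F.leftLim y) 1 else 0)
        = Finsupp.single (F.leftLim y) 1 := by
      by_cases hyC : y ∈ F.C
      · rw [dif_neg (fun hh => hh hyC), if_pos hyC, zero_add]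
      · rw [dif_pos (show y ∈ F.Cᶜ from hyC), if_neg hyC, add_zero, F.leftLim_eq h hyC]
    have hx : (if h : x ∈ F.Cᶜ then Finsupp.single (F.toFun ⟨x, h⟩) 1 else 0 : Ω →₀ ℝ)
        + (if x ∈ F.C then Finsupp.single (F.rightLim x) 1 else 0)
        = Finsupp.single (F.rightLim x) 1 := by
      by_cases hxC : x ∈ F.C
      · rw [dif_neg (fun hh => hh hxC), if_pos hxC, zero_add]
      · rw [dif_pos (show x ∈ F.Cᶜ from hxC), if_neg hxC, add_zero, F.rightLim_eq h hxC]
    rw [map_sub, hφ, hφ, ← hy, ← hx]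
    simp only [P]
    rw [hSA, hSB]
    abel
  have hmap : ∀ v ∈ S1 Ω, φ v ∈ S1 Ω := by
    intro v hv
    rw [F.S1_eq_span] at hv
    induction hv using Submodule.span_induction with
    | mem v hv =>
      obtain ⟨x, y, hxy, rfl⟩ := hv
      rw [hdiff x y hxy]
      exact Submodule.subset_span ⟨_, _, F.leftLim_mem_component hxy, rfl⟩
    | zero => rw [map_zero]; exact Submodule.zero_mem _
    | add u w _ _ hu hw => rw [map_add]; exact Submodule.add_mem _ hu hw
    | smul r u _ hu => rw [map_smul]; exact Submodule.smul_mem _ _ hu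
  refine ⟨φ.restrict hmap, fun x y hxy v hv => ?_⟩
  rw [LinearMap.coe_restrict_apply, hv, hdiff x y hxy]

theorem isSharp1_unique {φ ψ : Module.End ℝ (S1 Ω)} (hφ : F.IsSharp1 φ) (hψ : F.IsSharp1 ψ) :
    φ = ψ := by
  have key : ∀ v (hv : v ∈ S1 Ω), φ ⟨v, hv⟩ = ψ ⟨v, hv⟩ := by
    have hle := (F.S1_eq_span).le
    have hge := (F.S1_eq_span).ge
    intro v hv
    have hv' := hle hv
    induction hv' using Submodule.span_induction with
    | mem v hm =>
      obtain ⟨x, y, hxy, rfl⟩ := hm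
      exact Subtype.ext ((hφ x y hxy _ rfl).trans (hψ x y hxy _ rfl).symm)
    | zero =>
      have : (⟨0, hv⟩ : S1 Ω) = 0 := rfl
      rw [this, map_zero, map_zero]
    | add u w hu hw ihu ihw =>
      have : (⟨u + w, hv⟩ : S1 Ω) = ⟨u, hge hu⟩ + ⟨w, hge hw⟩ := rfl
      rw [this, map_add, map_add, ihu, ihw]
    | smul r u hu ihu =>
      have : (⟨r • u, hv⟩ : S1 Ω) = r • ⟨u, hge hu⟩ := rfl
      rw [this, map_smul, map_smul, ihu]
  exact LinearMap.ext fun v => key v v.2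

/-- `F_{#1} : S₁(Ω; ℝ) → S₁(Ω; ℝ)`. -/
def sharp1 : Module.End ℝ (S1 Ω) := F.exists_isSharp1.choose

theorem isSharp1_sharp1 : F.IsSharp1 F.sharp1 := F.exists_isSharp1.choose_spec

/-- `F_{#0}`, regarded as an endomorphism of the subspace `⊤` of `S₀(Ω; ℝ)`. -/
def sharp0Top : Module.End ℝ (⊤ : Submodule ℝ (Ω →₀ ℝ)) :=
  F.sharp0.restrict (p := ⊤) (q := ⊤) fun _ _ => Submodule.mem_top

/-- The homological determinant `L(z)` of `F`: the determinant of the pair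
`(F_{#0}, F_{#1})` on `S₀(Ω; ℝ)`. -/
def homologicalDeterminant : PowerSeries ℝ := pairDeterminant F.sharp0Top F.sharp1

end PMMap

/-! ### Graphs and piecewise monotone graph maps -/

/-- A graph: a compact Hausdorff space which is the union of finitely many homeomorphic copies
of `[0, 1]`, any two of which intersect at most at their endpoints. -/
structure IsGraph (G : Type*) [TopologicalSpace G] : Prop where
  compact : CompactSpace G
  t2 : T2Space G
  arcs : ∃ (n : ℕ) (e : Fin n → Icc (0 : ℝ) 1 → G),
    (∀ i, IsEmbedding (e i)) ∧ (⋃ i, range (e i)) = univ ∧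
    ∀ i j, i ≠ j → range (e i) ∩ range (e j) ⊆ {e i 0, e i 1} ∩ {e j 0, e j 1}

/-- `Ver(G)`: the points without an open neighbourhood homeomorphic to `]0, 1[`. -/
def vertices (G : Type*) [TopologicalSpace G] : Set G :=
  {x | ¬ ∃ U : Set G, IsOpen U ∧ x ∈ U ∧ Nonempty (U ≃ₜ Ioo (0 : ℝ) 1)}

/-- A continuous map `f : G → G` is piecewise monotone if it is injective on each connected
component of the complement of some finite set. -/
def IsPMG {G : Type*} [TopologicalSpace G] (f : C(G, G)) : Prop :=
  ∃ C : Set G, C.Finite ∧ ∀ x ∈ Cᶜ, InjOn f (connectedComponentIn Cᶜ x)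

/-- `f : G → G` is induced by `F : Ω \ C → Ω` by means of `π : Ω → G`. -/
structure IsInducedBy {G : Type*} [TopologicalSpace G] (f : C(G, G)) {Ω : IntervalUnion}
    (F : PMMap Ω) (π : Ω → G) : Prop where
  continuous : Continuous π
  vertices_subset : vertices G ⊆ π '' Ω.boundary
  isEmbedding : IsEmbedding ((Ω.boundary)ᶜ.domRestrict π)
  image_interior : π '' (Ω.boundary)ᶜ = (π '' Ω.boundary)ᶜ
  comm : ∀ x : ↥(F.Cᶜ), π (F.toFun x) = f (π x)

/-- The union of all periodic orbits of `f` that meet `S`. -/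
def periodicOrbitsMeeting {X : Type*} (f : X → X) (S : Set X) : Set X :=
  ⋃₀ {o | ∃ x ∈ Function.periodicPts f, o = range (fun n : ℕ => f^[n] x) ∧ (o ∩ S).Nonempty}

/-! ### Singular homology and the Lefschetz zeta function -/

/-- Singular homology `H_i(X; ℝ)`. -/
abbrev realHomology.{u} (X : Type u) [TopologicalSpace X] (i : ℕ) : ModuleCat.{u} ℝ :=
  ((AlgebraicTopology.singularHomologyFunctor (ModuleCat.{u} ℝ) i).obj
    (ModuleCat.of ℝ (ULift.{u} ℝ))).obj (TopCat.of X)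

/-- The map `f_{*i}` induced on `H_i(X; ℝ)`. -/
def realHomologyMap.{u} {X : Type u} [TopologicalSpace X] (f : C(X, X)) (i : ℕ) :
    Module.End ℝ (realHomology X i) :=
  (((AlgebraicTopology.singularHomologyFunctor (ModuleCat.{u} ℝ) i).obj
    (ModuleCat.of ℝ (ULift.{u} ℝ))).map (TopCat.ofHom f)).hom

/-- The Lefschetz zeta function `exp (∑_{n ≥ 1} (tr (f_{*0})ⁿ - tr (f_{*1})ⁿ) zⁿ / n)`. -/
def lefschetzZeta {X : Type*} [TopologicalSpace X] (f : C(X, X)) : PowerSeries ℝ :=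
  expSeries fun n =>
    LinearMap.trace ℝ (realHomology X 0) (realHomologyMap f 0 ^ n) -
    LinearMap.trace ℝ (realHomology X 1) (realHomologyMap f 1 ^ n)

end

/-!
The proof replaces the homology of `G` by the formal combinations `S₀(Ω)`, on which `F` acts.

**Homology of `G`.** The space `G` arises from `Ω` by gluing boundary points. Sending `y - x` to
the class of the image of the segment `[x, y]` is an isomorphism of `S₁(Ω)` with the singular
`1`-chains of `G` modulo boundaries (`IsInducedBy.chainsEquiv`). It is surjective because each
path can be cut into pieces that either lift to `Ω` or can be pushed into the glued points
(`IsBoundaryGluing.map_edgeClass_eq_top`), and injective because winding numbers along the edges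
separate edge classes (`IsBoundaryGluing.edgeClass_injOn`). The boundary map becomes `π_*`, and
the action of `f` becomes `F_{#1}` (`IsInducedBy.chainsEquiv_sharp1`). Hence there is an exact
sequence `0 → H₁(G) → ker π_* → S₀(Ω) / S₁(Ω) → H₀(G) → 0`, where `π_* : S₀(Ω) → S₀(G)`.

**Traces.** Choose a section of `π`, and let `β` (`IsInducedBy.transport`) be the linear map on
`S₀(Ω)` given by the self-map of `Ω` that corresponds to `f` under this section. Let `α`
(`IsInducedBy.extension`) extend `F_{#1}` and agree with `β` on the left endpoints of the
intervals. Both `α` and `β` cover the action of `f` on `S₀(G)`. The exact sequence yields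
`tr H₀(f)ⁿ - tr H₁(f)ⁿ = tr (αⁿ | S₀ / S₁) - tr (αⁿ | ker π_*)` (`IsInducedBy.lefschetz_eq`). On the
other hand `αⁿ` extends `F_{#1}ⁿ`, and in `αⁿ - F_{#0}ⁿ = (αⁿ - βⁿ) + (βⁿ - F_{#0}ⁿ)` the first
summand has trace `tr (αⁿ | ker π_*)`, as `β` vanishes on `ker π_*`. The trace of the second is
the sum of its diagonal entries, which count the points of `P` fixed by `fⁿ`: `β` and `F_{#0}`
differ only along orbits that hit `C`. Comparing, the `n`-th Lefschetz number is
`-tr (F_{#0}ⁿ, F_{#1}ⁿ) + #(P ∩ Fix fⁿ)` (`IsInducedBy.neg_pairTrace_add_ncard`), which is the claim after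
exponentiation.

**Integrality.** For an integer matrix `M` the series `exp ∑ tr(Mⁿ) zⁿ / n` equals
`1 / det (1 - z M)`, a unit of `ℤ⟦z⟧` (`exists_unit_map_eq_expSeries_matrix`). The maps induced by `α` on
`S₀ / S₁` and on `ker π_*`, and the restriction of `f` to the finite set `P`, are given by integer
matrices. So the Lefschetz zeta function and the series of `P` come from units of `ℤ⟦z⟧`, and
`L(z)` is their quotient.
-/

noncomputable section

/-! ### Singular chains in low degrees -/

section SingularChains

open CategoryTheory AlgebraicTopology Simplicial

universe u

/-- The singular chain complex of `X` with real coefficients. -/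
abbrev realChains (X : Type u) [TopologicalSpace X] : ChainComplex (ModuleCat.{u} ℝ) ℕ :=
  (TopCat.toSSet.obj (TopCat.of X)).chainComplex (ModuleCat.of ℝ (ULift.{u} ℝ))

/-- The chain map induced by a continuous map. -/
abbrev realChainsMap {X Y : Type u} [TopologicalSpace X] [TopologicalSpace Y] (f : C(X, Y)) :
    realChains X ⟶ realChains Y :=
  SSet.chainComplexMap (TopCat.toSSet.map (TopCat.ofHom f)) (ModuleCat.of ℝ (ULift.{u} ℝ))

/-- The singular simplex given by a continuous map on the standard simplex. -/
def singularSimplex {X : Type u} [TopologicalSpace X] {n : ℕ}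
    (τ : C(stdSimplex ℝ (Fin (n + 1)), X)) : (TopCat.toSSet.obj (TopCat.of X)) _⦋n⦌ :=
  (TopCat.toSSetObjEquiv (TopCat.of X) (Opposite.op ⦋n⦌)).symm τ

theorem singularSimplex_surjective {X : Type u} [TopologicalSpace X] {n : ℕ}
    (x : (TopCat.toSSet.obj (TopCat.of X)) _⦋n⦌) : ∃ τ, singularSimplex (X := X) τ = x :=
  (TopCat.toSSetObjEquiv (TopCat.of X) (Opposite.op ⦋n⦌)).symm.surjective x

/-- The map of standard simplices induced by a map of vertices. -/
def stdMap {m n : ℕ} (g : Fin m → Fin n) : C(stdSimplex ℝ (Fin m), stdSimplex ℝ (Fin n)) :=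
  ⟨stdSimplex.map g, stdSimplex.continuous_map g⟩

theorem stdMap_apply {m n : ℕ} (g : Fin m → Fin n) (x : stdSimplex ℝ (Fin m)) (j : Fin n) :
    stdMap g x j = ∑ i, if g i = j then x i else 0 :=
  (FunOnFinite.linearMap_apply_apply ℝ ℝ g x j).trans (Finset.sum_filter _ _)

theorem δ_singularSimplex {X : Type u} [TopologicalSpace X] {n : ℕ}
    (τ : C(stdSimplex ℝ (Fin (n + 2)), X)) (i : Fin (n + 2)) :
    (TopCat.toSSet.obj (TopCat.of X)).δ i (singularSimplex τ) =
      singularSimplex (τ.comp (stdMap i.succAbove)) := by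
  rfl

/-- The basis chain given by a singular simplex. -/
def chain {X : Type u} [TopologicalSpace X] {n : ℕ} (τ : C(stdSimplex ℝ (Fin (n + 1)), X)) :
    (realChains X).X n :=
  (SSet.ιChainComplex (R := ModuleCat.of ℝ (ULift.{u} ℝ)) _ (singularSimplex τ)).hom ⟨1⟩

/-- A linear map on singular chains is determined by its values on singular simplices. -/
theorem chains_hom_ext {X : Type u} [TopologicalSpace X] {n : ℕ} {M : Type u} [AddCommGroup M]
    [Module ℝ M] {f g : (realChains X).X n →ₗ[ℝ] M} (h : ∀ τ, f (chain τ) = g (chain τ)) :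
    f = g := by
  have : ModuleCat.ofHom f = ModuleCat.ofHom g := by
    apply SSet.chainComplex_hom_ext
    intro x
    obtain ⟨τ, rfl⟩ := singularSimplex_surjective x
    ext ⟨r⟩
    have e : (⟨r⟩ : ULift.{u} ℝ) = r • ⟨1⟩ := by ext; simp
    simp only [ModuleCat.hom_comp, LinearMap.comp_apply, ModuleCat.hom_ofHom]
    rw [e, map_smul, map_smul, map_smul]
    exact congrArg (r • ·) (h τ)
  simpa using congrArg ModuleCat.Hom.hom this

/-- Singular simplices form a basis of the singular chains: a linear map may be prescribed
on them. -/
theorem exists_chains_hom {X : Type u} [TopologicalSpace X] {n : ℕ} {M : Type u} [AddCommGroup M]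
    [Module ℝ M] (φ : C(stdSimplex ℝ (Fin (n + 1)), X) → M) :
    ∃ f : (realChains X).X n →ₗ[ℝ] M, ∀ τ, f (chain τ) = φ τ := by
  let e := TopCat.toSSetObjEquiv (TopCat.of X) (Opposite.op ⦋n⦌)
  let F : (realChains X).X n ⟶ ModuleCat.of ℝ M :=
    Limits.Sigma.desc fun x => ModuleCat.ofHom
      ((LinearMap.toSpanSingleton ℝ M (φ (e x))) ∘ₗ
        (ULift.moduleEquiv : ULift.{u} ℝ ≃ₗ[ℝ] ℝ).toLinearMap)
  refine ⟨F.hom, fun τ => ?_⟩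
  have h : SSet.ιChainComplex (R := ModuleCat.of ℝ (ULift.{u} ℝ)) _ (singularSimplex τ) ≫ F = _ :=
    Limits.Sigma.ι_desc _ _
  have := congrArg (fun k => k.hom ⟨1⟩) h
  simp only at this
  refine this.trans ?_
  simp [e, singularSimplex]

theorem d_chain {X : Type u} [TopologicalSpace X] {n : ℕ}
    (τ : C(stdSimplex ℝ (Fin (n + 2)), X)) :
    ((realChains X).d (n + 1) n).hom (chain τ) =
      ∑ i : Fin (n + 2), (-1 : ℝ) ^ (i : ℕ) • chain (τ.comp (stdMap i.succAbove)) := by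
  have h := SSet.ιChainComplex_d (R := ModuleCat.of ℝ (ULift.{u} ℝ)) _ (singularSimplex τ)
  have := congrArg (fun k => k.hom ⟨1⟩) h
  refine this.trans ?_
  simp only [δ_singularSimplex, ModuleCat.hom_sum, LinearMap.sum_apply, ModuleCat.hom_zsmul]
  refine Finset.sum_congr rfl fun i _ => ?_
  rcases Nat.even_or_odd (i : ℕ) with hi | hi
  · simp [hi.neg_one_pow, chain]
  · simp [hi.neg_one_pow, chain]

theorem chainsMap_chain {X Y : Type u} [TopologicalSpace X] [TopologicalSpace Y] {n : ℕ}
    (f : C(X, Y)) (τ : C(stdSimplex ℝ (Fin (n + 1)), X)) :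
    ((realChainsMap f).f n).hom (chain τ) = chain (f.comp τ) := by
  have h := SSet.ι_chainComplexMap_f (R := ModuleCat.of ℝ (ULift.{u} ℝ))
    _ _ (TopCat.toSSet.map (TopCat.ofHom f)) (singularSimplex τ)
  exact congrArg (fun k => k.hom ⟨1⟩) h

/-- Singular `1`-chains modulo boundaries of `2`-chains. -/
abbrev OneChains (X : Type u) [TopologicalSpace X] : Type u := (realChains X).opcycles 1

/-- A path as a singular `1`-simplex; it starts at the vertex `0`. -/
def simplexOfPath {X : Type u} [TopologicalSpace X] (σ : C(unitInterval, X)) :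
    C(stdSimplex ℝ (Fin 2), X) :=
  σ.comp ⟨stdSimplexHomeomorphUnitInterval, by fun_prop⟩

/-- The class of a path in `OneChains X`. -/
def pathClass {X : Type u} [TopologicalSpace X] (σ : C(unitInterval, X)) : OneChains X :=
  ((realChains X).pOpcycles 1).hom (chain (simplexOfPath σ))

theorem oneChains_hom_ext {X : Type u} [TopologicalSpace X] {M : Type u} [AddCommGroup M]
    [Module ℝ M] {f g : OneChains X →ₗ[ℝ] M} (h : ∀ σ, f (pathClass σ) = g (pathClass σ)) :
    f = g := by
  have hs : Function.Surjective ((realChains X).pOpcycles 1).hom :=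
    (ModuleCat.epi_iff_surjective _).1 inferInstance
  have : f ∘ₗ ((realChains X).pOpcycles 1).hom = g ∘ₗ ((realChains X).pOpcycles 1).hom := by
    refine chains_hom_ext fun τ => ?_
    have hτ : τ = simplexOfPath
        (τ.comp ⟨stdSimplexHomeomorphUnitInterval.symm, by fun_prop⟩) := by
      ext x; simp [simplexOfPath]
    rw [hτ]
    exact h _
  ext x
  obtain ⟨y, rfl⟩ := hs x
  exact LinearMap.congr_fun this y

theorem span_range_pathClass (X : Type u) [TopologicalSpace X] :
    Submodule.span ℝ (range (pathClass (X := X))) = ⊤ := by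
  rw [← Submodule.ker_mkQ (Submodule.span ℝ (range (pathClass (X := X)))), LinearMap.ker_eq_top]
  refine oneChains_hom_ext fun σ => ?_
  rw [LinearMap.zero_apply, Submodule.mkQ_apply, Submodule.Quotient.mk_eq_zero]
  exact Submodule.subset_span ⟨σ, rfl⟩

/-- The segment from `u` to `v` in a convex set. -/
def segmentPath {E : Type*} [AddCommGroup E] [Module ℝ E] [TopologicalSpace E]
    [ContinuousAdd E] [ContinuousSMul ℝ E] {D : Set E} (hD : Convex ℝ D) (u v : D) :
    C(unitInterval, D) where
  toFun t := ⟨(1 - (t : ℝ)) • (u : E) + (t : ℝ) • (v : E),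
    hD u.2 v.2 (sub_nonneg.2 t.2.2) t.2.1 (by ring)⟩
  continuous_toFun := by fun_prop

/-- The boundary of a singular `2`-simplex vanishes in `OneChains X`. -/
theorem pathClass_faces {X : Type u} [TopologicalSpace X] (τ : C(stdSimplex ℝ (Fin 3), X))
    {σ₀ σ₁ σ₂ : C(unitInterval, X)}
    (h₀ : simplexOfPath σ₀ = τ.comp (stdMap (Fin.succAbove 0)))
    (h₁ : simplexOfPath σ₁ = τ.comp (stdMap (Fin.succAbove 1)))
    (h₂ : simplexOfPath σ₂ = τ.comp (stdMap (Fin.succAbove 2))) :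
    pathClass σ₂ + pathClass σ₀ = pathClass σ₁ := by
  have h : (((realChains X).d 2 1) ≫ (realChains X).pOpcycles 1).hom (chain τ) = 0 := by
    rw [HomologicalComplex.d_pOpcycles]; rfl
  rw [ModuleCat.hom_comp, LinearMap.comp_apply, d_chain] at h
  rw [Fin.sum_univ_three, map_add, map_add, map_smul, map_smul, map_smul] at h
  rw [← h₀, ← h₁, ← h₂] at h
  rw [← sub_eq_zero, ← h, pathClass, pathClass, pathClass]
  have e0 : ((-1 : ℝ) ^ ((0 : Fin 3) : ℕ)) = 1 := by norm_num
  have e1 : ((-1 : ℝ) ^ ((1 : Fin 3) : ℕ)) = -1 := by norm_num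
  have e2 : ((-1 : ℝ) ^ ((2 : Fin 3) : ℕ)) = 1 := by norm_num
  erw [e0, e1, e2]
  rw [one_smul, one_smul, neg_smul, one_smul]
  abel

/-- Classes of segments are additive: the affine triangle with vertices `u`, `v`, `w` is a singular
`2`-simplex with these three segments as faces. -/
theorem pathClass_segmentPath_add {X : Type u} [TopologicalSpace X] {E : Type*} [AddCommGroup E]
    [Module ℝ E] [TopologicalSpace E] [ContinuousAdd E] [ContinuousSMul ℝ E] {D : Set E}
    (hD : Convex ℝ D) (q : C(D, X)) (u v w : D) :
    pathClass (q.comp (segmentPath hD u v)) + pathClass (q.comp (segmentPath hD v w)) =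
      pathClass (q.comp (segmentPath hD u w)) := by
  let p : Fin 3 → E := ![u, v, w]
  have hp : ∀ i, p i ∈ D := by intro i; fin_cases i <;> simp [p]
  let τ : C(stdSimplex ℝ (Fin 3), D) :=
    ⟨fun x => ⟨∑ i, (x : Fin 3 → ℝ) i • p i,
      hD.sum_mem (fun i _ => x.2.1 i) x.2.2 fun i _ => hp i⟩, by
        refine Continuous.subtype_mk (continuous_finsetSum _ fun i _ => ?_) _
        exact ((continuous_apply i).comp continuous_subtype_val).smul continuous_const⟩
  refine pathClass_faces (q.comp τ) ?_ ?_ ?_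
  all_goals
    ext x
    simp only [simplexOfPath, ContinuousMap.comp_apply]
    congr 1
    apply Subtype.ext
    have hx : x 0 = 1 - x 1 := by
      have : ∑ i, x i = 1 := x.2.2
      rw [Fin.sum_univ_two] at this
      linarith
    have h1 : ((stdSimplexHomeomorphUnitInterval x : unitInterval) : ℝ) = x 1 := rfl
    simp only [segmentPath, τ, ContinuousMap.coe_mk, Fin.sum_univ_three, stdMap_apply, h1, ← hx]
    simp [p, Fin.sum_univ_two, Fin.succAbove, Fin.lt_def]

/-- Singular `0`-chains are formal combinations of points. -/
theorem exists_zeroChains_equiv (X : Type u) [TopologicalSpace X] :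
    ∃ e : (realChains X).X 0 ≃ₗ[ℝ] (X →₀ ℝ),
      ∀ τ : C(stdSimplex ℝ (Fin 1), X), e (chain τ) = Finsupp.single (τ default) 1 := by
  obtain ⟨f, hf⟩ := exists_chains_hom (n := 0) (M := X →₀ ℝ)
    fun τ : C(stdSimplex ℝ (Fin 1), X) => Finsupp.single (τ default) 1
  let g : (X →₀ ℝ) →ₗ[ℝ] (realChains X).X 0 :=
    Finsupp.lift _ ℝ X fun x => chain (n := 0) (ContinuousMap.const _ x)
  have hg : ∀ x, g (Finsupp.single x 1) = chain (n := 0) (ContinuousMap.const _ x) := fun x => by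
    simp [g]
  have h1 : g ∘ₗ f = LinearMap.id := by
    refine chains_hom_ext fun τ => ?_
    rw [LinearMap.comp_apply, hf, hg, LinearMap.id_apply]
    congr 1
    ext x
    rw [Subsingleton.elim x default]
    rfl
  have h2 : f ∘ₗ g = LinearMap.id := by
    ext x : 2
    simp only [LinearMap.comp_apply, Finsupp.lsingle_apply, LinearMap.id_apply]
    rw [hg, hf]
    rfl
  exact ⟨LinearEquiv.ofLinearMap f g h2 h1, hf⟩

/-- The identification of singular `0`-chains with formal combinations of points. -/
def zeroChainsEquiv (X : Type u) [TopologicalSpace X] : (realChains X).X 0 ≃ₗ[ℝ] (X →₀ ℝ) :=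
  (exists_zeroChains_equiv X).choose

theorem zeroChainsEquiv_chain {X : Type u} [TopologicalSpace X]
    (τ : C(stdSimplex ℝ (Fin 1), X)) :
    zeroChainsEquiv X (chain τ) = Finsupp.single (τ default) 1 :=
  (exists_zeroChains_equiv X).choose_spec τ

/-- The boundary map from `1`-chains modulo boundaries to `0`-chains. -/
def boundaryMap (X : Type u) [TopologicalSpace X] : OneChains X →ₗ[ℝ] (X →₀ ℝ) :=
  (zeroChainsEquiv X).toLinearMap ∘ₗ ((realChains X).fromOpcycles 1 0).hom

theorem stdMap_default {n : ℕ} (g : Fin 1 → Fin n) (j : Fin n) :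
    stdMap g default j = if g 0 = j then 1 else 0 := by
  rw [stdMap_apply, Fin.sum_univ_one]
  have : ∑ i, (default : stdSimplex ℝ (Fin 1)) i = 1 := (default : stdSimplex ℝ (Fin 1)).2.2
  rw [Fin.sum_univ_one] at this
  rw [this]

theorem boundaryMap_pathClass {X : Type u} [TopologicalSpace X] (σ : C(unitInterval, X)) :
    boundaryMap X (pathClass σ) = Finsupp.single (σ 1) 1 - Finsupp.single (σ 0) 1 := by
  have h : ((realChains X).pOpcycles 1 ≫ (realChains X).fromOpcycles 1 0).hom
      (chain (simplexOfPath σ)) = ((realChains X).d 1 0).hom (chain (simplexOfPath σ)) := by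
    rw [HomologicalComplex.p_fromOpcycles]
  have h' := congrArg (zeroChainsEquiv X) h
  refine Eq.trans h' ?_
  rw [d_chain, Fin.sum_univ_two, map_add, map_smul, map_smul]
  have e0 : ((-1 : ℝ) ^ ((0 : Fin 2) : ℕ)) = 1 := by norm_num
  have e1 : ((-1 : ℝ) ^ ((1 : Fin 2) : ℕ)) = -1 := by norm_num
  erw [e0, e1, zeroChainsEquiv_chain, zeroChainsEquiv_chain]
  rw [one_smul, neg_smul, one_smul, ← sub_eq_add_neg]
  have k0 : stdSimplexHomeomorphUnitInterval (stdMap (Fin.succAbove 0) default) = 1 := by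
    apply Subtype.ext
    exact (stdMap_default _ _).trans (by simp)
  have k1 : stdSimplexHomeomorphUnitInterval (stdMap (Fin.succAbove 1) default) = 0 := by
    apply Subtype.ext
    exact (stdMap_default _ _).trans (by simp)
  congr 2
  · exact congrArg σ k0
  · exact congrArg σ k1

/-- The map on `1`-chains modulo boundaries induced by a continuous map. -/
def oneChainsMap {X Y : Type u} [TopologicalSpace X] [TopologicalSpace Y] (f : C(X, Y)) :
    OneChains X →ₗ[ℝ] OneChains Y :=
  (HomologicalComplex.opcyclesMap (realChainsMap f) 1).hom

theorem oneChainsMap_pathClass {X Y : Type u} [TopologicalSpace X] [TopologicalSpace Y]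
    (f : C(X, Y)) (σ : C(unitInterval, X)) :
    oneChainsMap f (pathClass σ) = pathClass (f.comp σ) := by
  have h : ((realChains X).pOpcycles 1 ≫ HomologicalComplex.opcyclesMap (realChainsMap f) 1).hom
      (chain (simplexOfPath σ)) =
      ((realChainsMap f).f 1 ≫ (realChains Y).pOpcycles 1).hom (chain (simplexOfPath σ)) := by
    rw [HomologicalComplex.p_opcyclesMap]
  refine Eq.trans h ?_
  rw [ModuleCat.hom_comp, LinearMap.comp_apply, chainsMap_chain]
  rfl

theorem boundaryMap_natural {X Y : Type u} [TopologicalSpace X] [TopologicalSpace Y]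
    (f : C(X, Y)) (c : OneChains X) :
    boundaryMap Y (oneChainsMap f c) = Finsupp.lmapDomain ℝ ℝ f (boundaryMap X c) := by
  refine LinearMap.congr_fun (f := boundaryMap Y ∘ₗ oneChainsMap f)
    (g := Finsupp.lmapDomain ℝ ℝ f ∘ₗ boundaryMap X) (oneChains_hom_ext fun σ => ?_) c
  simp only [LinearMap.comp_apply]
  rw [oneChainsMap_pathClass, boundaryMap_pathClass, boundaryMap_pathClass, map_sub]
  simp

/-- A function on paths which is additive on the boundary of each singular `2`-simplex
is induced by a linear form on `1`-chains modulo boundaries. -/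
theorem exists_oneChains_hom {X : Type u} [TopologicalSpace X] (φ : C(unitInterval, X) → ℝ)
    (hφ : ∀ (τ : C(stdSimplex ℝ (Fin 3), X)) (σ₀ σ₁ σ₂ : C(unitInterval, X)),
      simplexOfPath σ₀ = τ.comp (stdMap (Fin.succAbove 0)) →
      simplexOfPath σ₁ = τ.comp (stdMap (Fin.succAbove 1)) →
      simplexOfPath σ₂ = τ.comp (stdMap (Fin.succAbove 2)) → φ σ₂ + φ σ₀ = φ σ₁) :
    ∃ f : OneChains X →ₗ[ℝ] ℝ, ∀ σ, f (pathClass σ) = φ σ := by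
  let back : C(stdSimplex ℝ (Fin 2), X) → C(unitInterval, X) := fun τ =>
    τ.comp ⟨stdSimplexHomeomorphUnitInterval.symm, by fun_prop⟩
  have hb : ∀ τ, simplexOfPath (back τ) = τ := fun τ => by
    ext x; simp [simplexOfPath, back]
  have hb' : ∀ σ, back (simplexOfPath σ) = σ := fun σ => by
    ext x; simp [simplexOfPath, back]
  obtain ⟨F, hF⟩ := exists_chains_hom (n := 1) (M := ULift.{u} ℝ)
    fun τ : C(stdSimplex ℝ (Fin 2), X) => ⟨φ (back τ)⟩
  have h0 : F ∘ₗ ((realChains X).d 2 1).hom = 0 := by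
    refine chains_hom_ext fun τ => ?_
    rw [LinearMap.comp_apply, d_chain, Fin.sum_univ_three, map_add, map_add, map_smul, map_smul,
      map_smul]
    have e0 : ((-1 : ℝ) ^ ((0 : Fin 3) : ℕ)) = 1 := by norm_num
    have e1 : ((-1 : ℝ) ^ ((1 : Fin 3) : ℕ)) = -1 := by norm_num
    have e2 : ((-1 : ℝ) ^ ((2 : Fin 3) : ℕ)) = 1 := by norm_num
    erw [e0, e1, e2, hF, hF, hF]
    have := hφ τ _ _ _ (hb _) (hb _) (hb _)
    rw [one_smul, one_smul, neg_smul, one_smul]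
    ext
    simp only [ULift.add_down, ULift.neg_down, LinearMap.zero_apply, ULift.zero_down]
    linarith
  have h0' : (realChains X).d 2 1 ≫ ModuleCat.ofHom F = 0 := by
    ext x
    exact congrArg ULift.down (LinearMap.congr_fun h0 x)
  let D := (realChains X).descOpcycles (ModuleCat.ofHom F) 2 (by simp) h0'
  refine ⟨(ULift.moduleEquiv : ULift.{u} ℝ ≃ₗ[ℝ] ℝ).toLinearMap ∘ₗ D.hom, fun σ => ?_⟩
  have h : ((realChains X).pOpcycles 1 ≫ D).hom (chain (simplexOfPath σ)) =
      F (chain (simplexOfPath σ)) := by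
    exact congrArg (fun k => k.hom (chain (simplexOfPath σ)))
      ((realChains X).p_descOpcycles (ModuleCat.ofHom F) 2 (by simp) h0')
  have h2 := (congrArg ULift.down h).trans (congrArg ULift.down (hF (simplexOfPath σ)))
  refine Eq.trans h2 ?_
  rw [hb']

/-- `H₁` is the kernel of the boundary map. -/
def homologyOneInclusion (X : Type u) [TopologicalSpace X] :
    realHomology X 1 →ₗ[ℝ] OneChains X :=
  ((realChains X).homologyι 1).hom

theorem homologyOneInclusion_injective (X : Type u) [TopologicalSpace X] :
    Function.Injective (homologyOneInclusion X) :=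
  (ModuleCat.mono_iff_injective ((realChains X).homologyι 1)).1 inferInstance

theorem range_homologyOneInclusion (X : Type u) [TopologicalSpace X] :
    LinearMap.range (homologyOneInclusion X) = LinearMap.ker (boundaryMap X) := by
  have hex := ShortComplex.exact_of_f_is_kernel
    (ShortComplex.mk _ _ ((realChains X).homologyι_comp_fromOpcycles 1 0))
    ((realChains X).homologyIsKernel 1 0 (by simp))
  rw [ShortComplex.moduleCat_exact_iff_range_eq_ker] at hex
  rw [boundaryMap, LinearEquiv.ker_comp]
  exact hex

theorem homologyOneInclusion_natural {X : Type u} [TopologicalSpace X] (f : C(X, X))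
    (x : realHomology X 1) : homologyOneInclusion X (realHomologyMap f 1 x) =
      oneChainsMap f (homologyOneInclusion X x) := by
  have h := HomologicalComplex.homologyι_naturality (realChainsMap f) 1
  exact congrArg (fun k => k.hom x) h

/-- `H₀` is the cokernel of the boundary map. -/
def homologyZeroProjection (X : Type u) [TopologicalSpace X] :
    (X →₀ ℝ) →ₗ[ℝ] realHomology X 0 :=
  ((realChains X).pOpcycles 0 ≫ ((realChains X).isoHomologyι₀).inv).hom ∘ₗ
    (zeroChainsEquiv X).symm.toLinearMap

theorem homologyZeroProjection_zeroChainsEquiv {X : Type u} [TopologicalSpace X]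
    (c : (realChains X).X 0) : homologyZeroProjection X (zeroChainsEquiv X c) =
      ((realChains X).pOpcycles 0 ≫ ((realChains X).isoHomologyι₀).inv).hom c :=
  congrArg ((realChains X).pOpcycles 0 ≫ ((realChains X).isoHomologyι₀).inv).hom
    ((zeroChainsEquiv X).symm_apply_apply c)

theorem homologyZeroProjection_surjective (X : Type u) [TopologicalSpace X] :
    Function.Surjective (homologyZeroProjection X) :=
  ((ModuleCat.epi_iff_surjective
    ((realChains X).pOpcycles 0 ≫ ((realChains X).isoHomologyι₀).inv)).1 inferInstance).comp
    (zeroChainsEquiv X).symm.surjective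

theorem ker_homologyZeroProjection (X : Type u) [TopologicalSpace X] :
    LinearMap.ker (homologyZeroProjection X) = LinearMap.range (boundaryMap X) := by
  have hex := ShortComplex.exact_of_g_is_cokernel
    (ShortComplex.mk _ _ ((realChains X).d_pOpcycles 1 0))
    ((realChains X).opcyclesIsCokernel 1 0 (by simp))
  rw [ShortComplex.moduleCat_exact_iff_range_eq_ker] at hex
  have hs : Function.Surjective ((realChains X).pOpcycles 1).hom :=
    (ModuleCat.epi_iff_surjective _).1 inferInstance
  have hiso : Function.Injective ((realChains X).isoHomologyι₀).inv.hom :=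
    (ModuleCat.mono_iff_injective _).1 inferInstance
  have hd : ((realChains X).d 1 0).hom =
      ((realChains X).fromOpcycles 1 0).hom ∘ₗ ((realChains X).pOpcycles 1).hom := by
    rw [← ModuleCat.hom_comp, HomologicalComplex.p_fromOpcycles]
  have hr : LinearMap.range (((realChains X).fromOpcycles 1 0).hom) =
      LinearMap.ker ((realChains X).pOpcycles 0).hom := by
    rw [← hex]
    change _ = LinearMap.range ((realChains X).d 1 0).hom
    rw [hd, LinearMap.range_comp_of_range_eq_top _ (LinearMap.range_eq_top.2 hs)]
  ext w
  obtain ⟨c, rfl⟩ := (zeroChainsEquiv X).surjective w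
  have h1 : zeroChainsEquiv X c ∈ LinearMap.ker (homologyZeroProjection X) ↔
      c ∈ LinearMap.ker ((realChains X).pOpcycles 0).hom := by
    rw [LinearMap.mem_ker, LinearMap.mem_ker, homologyZeroProjection_zeroChainsEquiv]
    exact map_eq_zero_iff _ hiso
  rw [h1, ← hr]
  simp [boundaryMap, LinearMap.range_comp]

theorem homologyZeroProjection_natural {X : Type u} [TopologicalSpace X] (f : C(X, X))
    (w : X →₀ ℝ) : realHomologyMap f 0 (homologyZeroProjection X w) =
      homologyZeroProjection X (Finsupp.lmapDomain ℝ ℝ f w) := by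
  have h1 : ∀ c, (zeroChainsEquiv X) (((realChainsMap f).f 0).hom c) =
      Finsupp.lmapDomain ℝ ℝ f (zeroChainsEquiv X c) := by
    intro c
    refine LinearMap.congr_fun (f := (zeroChainsEquiv X).toLinearMap ∘ₗ
      ((realChainsMap f).f 0).hom) (g := Finsupp.lmapDomain ℝ ℝ f ∘ₗ
      (zeroChainsEquiv X).toLinearMap) (chains_hom_ext fun τ => ?_) c
    simp only [LinearMap.comp_apply, LinearEquiv.coe_coe]
    rw [chainsMap_chain, zeroChainsEquiv_chain, zeroChainsEquiv_chain]
    simp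
  have h2 : ((realChains X).pOpcycles 0 ≫ ((realChains X).isoHomologyι₀).inv) ≫
      HomologicalComplex.homologyMap (realChainsMap f) 0 =
      (realChainsMap f).f 0 ≫ (realChains X).pOpcycles 0 ≫
        ((realChains X).isoHomologyι₀).inv := by
    rw [Category.assoc, ChainComplex.isoHomologyι₀_inv_naturality,
      HomologicalComplex.p_opcyclesMap_assoc]
  obtain ⟨c, rfl⟩ := (zeroChainsEquiv X).surjective w
  rw [← h1, homologyZeroProjection_zeroChainsEquiv, homologyZeroProjection_zeroChainsEquiv]
  exact congrArg (fun k => k.hom c) h2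

end SingularChains

/-! ### Relations between classes of paths -/

section PathClasses

universe u

variable {X : Type u} [TopologicalSpace X]

theorem pathClass_const (x : X) : pathClass (ContinuousMap.const unitInterval x) = 0 := by
  have h := pathClass_segmentPath_add (convex_univ (𝕜 := ℝ) (E := ℝ))
    (ContinuousMap.const (univ : Set ℝ) x) ⟨0, trivial⟩ ⟨0, trivial⟩ ⟨0, trivial⟩
  rw [ContinuousMap.const_comp] at h
  simpa using h

/-- The two ways around a singular square agree modulo boundaries. -/
theorem pathClass_square (H : C(unitInterval × unitInterval, X)) :
    pathClass (H.comp ⟨fun s => (s, 0), by fun_prop⟩) +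
        pathClass (H.comp ⟨fun t => (1, t), by fun_prop⟩) =
      pathClass (H.comp ⟨fun t => (0, t), by fun_prop⟩) +
        pathClass (H.comp ⟨fun s => (s, 1), by fun_prop⟩) := by
  have hD : Convex ℝ (Icc (0 : ℝ) 1 ×ˢ Icc (0 : ℝ) 1) := (convex_Icc 0 1).prod (convex_Icc 0 1)
  let q : C((Icc (0 : ℝ) 1 ×ˢ Icc (0 : ℝ) 1 : Set (ℝ × ℝ)), X) :=
    H.comp ⟨fun z => (⟨z.1.1, z.2.1⟩, ⟨z.1.2, z.2.2⟩), by fun_prop⟩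
  have m : ∀ x y : unitInterval, ((x : ℝ), (y : ℝ)) ∈ (Icc (0 : ℝ) 1 ×ˢ Icc (0 : ℝ) 1) :=
    fun x y => ⟨x.2, y.2⟩
  have h1 := pathClass_segmentPath_add hD q ⟨_, m 0 0⟩ ⟨_, m 1 0⟩ ⟨_, m 1 1⟩
  have h2 := pathClass_segmentPath_add hD q ⟨_, m 0 0⟩ ⟨_, m 0 1⟩ ⟨_, m 1 1⟩
  have h := h1.trans h2.symm
  convert h using 3 <;>
  · ext t
    simp only [q, ContinuousMap.comp_apply, ContinuousMap.coe_mk, segmentPath]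
    congr 1
    ext <;> simp

/-- The restriction of a path to the segment from `r` to `s`. -/
def subpath (σ : C(unitInterval, X)) (r s : unitInterval) : C(unitInterval, X) :=
  σ.comp (segmentPath (convex_Icc (0 : ℝ) 1) r s)

theorem pathClass_subpath_add (σ : C(unitInterval, X)) (r s t : unitInterval) :
    pathClass (subpath σ r s) + pathClass (subpath σ s t) = pathClass (subpath σ r t) :=
  pathClass_segmentPath_add (convex_Icc (0 : ℝ) 1) σ r s t

theorem subpath_zero_one (σ : C(unitInterval, X)) : subpath σ 0 1 = σ := by
  ext t
  simp only [subpath, ContinuousMap.comp_apply, segmentPath, ContinuousMap.coe_mk]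
  congr 1
  ext
  simp

/-- To show that a path class lies in a submodule it is enough to treat short subpaths. -/
theorem pathClass_mem_of_local (R : Submodule ℝ (OneChains X)) (𝒰 : Set (Set X))
    (hopen : ∀ U ∈ 𝒰, IsOpen U) (hcover : ⋃₀ 𝒰 = univ)
    (h : ∀ U ∈ 𝒰, ∀ σ : C(unitInterval, X), (∀ t, σ t ∈ U) → pathClass σ ∈ R)
    (σ : C(unitInterval, X)) : pathClass σ ∈ R := by
  have key := PreconnectedSpace.induction₂'
    (P := fun r s : unitInterval => pathClass (subpath σ r s) ∈ R) ?_ ⟨?_⟩ 0 1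
  · rwa [subpath_zero_one] at key
  · intro x
    obtain ⟨U, hU, hx⟩ : ∃ U ∈ 𝒰, σ x ∈ U := by
      have : σ x ∈ ⋃₀ 𝒰 := hcover ▸ mem_univ _
      exact this
    have hmem : σ ⁻¹' U ∈ 𝓝 x := ((hopen U hU).preimage σ.continuous).mem_nhds hx
    obtain ⟨ε, hε, hb⟩ := Metric.mem_nhds_iff.1 hmem
    have hseg : ∀ r ∈ Metric.ball x ε, ∀ s ∈ Metric.ball x ε, pathClass (subpath σ r s) ∈ R := by
      intro r hr s hs
      refine h U hU _ fun t => hb ?_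
      rw [Metric.mem_ball, Subtype.dist_eq] at hr hs ⊢
      exact (convex_ball (x : ℝ) ε) hr hs (sub_nonneg.2 t.2.2) t.2.1 (by ring)
    filter_upwards [Metric.ball_mem_nhds x hε] with y hy
    exact ⟨hseg x (Metric.mem_ball_self hε) y hy, hseg y hy x (Metric.mem_ball_self hε)⟩
  · intro r s t hr hs
    rw [← pathClass_subpath_add σ r s t]
    exact R.add_mem hr hs

end PathClasses

/-! ### Winding numbers -/

section Winding

universe u

instance {n : ℕ} : LocallyPathConnectedSpace (stdSimplex ℝ (Fin n)) :=
  .of_bases (p := fun _ (ε : ℝ) => 0 < ε) (s := fun x ε => Metric.ball x ε)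
    (fun _ => Metric.nhds_basis_ball) fun x ε hε => by
      rw [Topology.IsInducing.subtypeVal.isPathConnected_iff]
      have : (Subtype.val '' Metric.ball x ε : Set (Fin n → ℝ)) =
          Metric.ball (x : Fin n → ℝ) ε ∩ stdSimplex ℝ (Fin n) := by
        ext y
        constructor
        · rintro ⟨y, hy, rfl⟩; exact ⟨hy, y.2⟩
        · rintro ⟨hy, hy'⟩; exact ⟨⟨y, hy'⟩, hy, rfl⟩
      rw [this]
      exact ((convex_ball _ _).inter (convex_stdSimplex _ _)).isPathConnected
        ⟨x, Metric.mem_ball_self hε, x.2⟩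

instance {n : ℕ} : ContractibleSpace (stdSimplex ℝ (Fin (n + 1))) :=
  (convex_stdSimplex ℝ (Fin (n + 1))).contractibleSpace ⟨_, single_mem_stdSimplex ℝ 0⟩

/-- Two real lifts of a path in the circle differ by a constant, since their difference takes
integer values; they have the same increment. -/
theorem lift_sub_eq {g g' : C(unitInterval, ℝ)}
    (h : ∀ t, (g t : AddCircle (1 : ℝ)) = g' t) : g 1 - g 0 = g' 1 - g' 0 := by
  have hz : ∀ t, ∃ n : ℤ, g t - g' t = n := fun t => by
    have := h t
    rw [← sub_eq_zero, ← AddCircle.coe_sub, AddCircle.coe_eq_zero_iff] at this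
    obtain ⟨n, hn⟩ := this
    exact ⟨n, by simpa using hn.symm⟩
  have hr : ∀ t, g t - g' t ∈ range ((↑) : ℤ → ℝ) := fun t => (hz t).imp fun n hn => hn.symm
  have hs : (range fun t => g t - g' t).Subsingleton := by
    have hc : IsPreconnected (range fun t => g t - g' t) :=
      isPreconnected_range (g.continuous.sub g'.continuous)
    have ht : IsTotallyDisconnected (range ((↑) : ℤ → ℝ)) := by
      exact (countable_range _).isTotallyDisconnected
    exact ht _ (range_subset_iff.2 hr) hc
  have := hs ⟨1, rfl⟩ ⟨0, rfl⟩
  simp only at this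
  linarith

/-- The winding number of paths with respect to a map to the circle, as a linear form on
`1`-chains modulo boundaries. -/
theorem exists_winding {X : Type u} [TopologicalSpace X] (θ : C(X, AddCircle (1 : ℝ))) :
    ∃ ω : OneChains X →ₗ[ℝ] ℝ, ∀ (σ : C(unitInterval, X)) (g : C(unitInterval, ℝ)),
      (∀ t, (g t : AddCircle (1 : ℝ)) = θ (σ t)) → ω (pathClass σ) = g 1 - g 0 := by
  classical
  let φ : C(unitInterval, X) → ℝ := fun σ =>
    if h : ∃ g : C(unitInterval, ℝ), ∀ t, (g t : AddCircle (1 : ℝ)) = θ (σ t)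
    then h.choose 1 - h.choose 0 else 0
  have hφ : ∀ (σ : C(unitInterval, X)) (g : C(unitInterval, ℝ)),
      (∀ t, (g t : AddCircle (1 : ℝ)) = θ (σ t)) → φ σ = g 1 - g 0 := by
    intro σ g hg
    have h : ∃ g : C(unitInterval, ℝ), ∀ t, (g t : AddCircle (1 : ℝ)) = θ (σ t) := ⟨g, hg⟩
    simp only [φ]
    rw [dif_pos h]
    exact lift_sub_eq fun t => (h.choose_spec t).trans (hg t).symm
  suffices hc : ∀ (τ : C(stdSimplex ℝ (Fin 3), X)) (σ₀ σ₁ σ₂ : C(unitInterval, X)),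
      simplexOfPath σ₀ = τ.comp (stdMap (Fin.succAbove 0)) →
      simplexOfPath σ₁ = τ.comp (stdMap (Fin.succAbove 1)) →
      simplexOfPath σ₂ = τ.comp (stdMap (Fin.succAbove 2)) → φ σ₂ + φ σ₀ = φ σ₁ by
    obtain ⟨ω, hω⟩ := exists_oneChains_hom φ hc
    exact ⟨ω, fun σ g hg => (hω σ).trans (hφ σ g hg)⟩
  intro τ σ₀ σ₁ σ₂ h₀ h₁ h₂
  obtain ⟨e₀, he₀⟩ := QuotientAddGroup.mk_surjective (θ (τ (stdSimplex.vertex 0)))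
  obtain ⟨T, ⟨-, hT⟩, -⟩ := (AddCircle.isCoveringMap_coe (1 : ℝ)).existsUnique_continuousMap_lifts
    (θ.comp τ) (stdSimplex.vertex 0) e₀ he₀
  have lift : ∀ (σ : C(unitInterval, X)) (k : Fin 2 → Fin 3),
      simplexOfPath σ = τ.comp (stdMap k) → φ σ =
        T (stdSimplex.vertex (k 1)) - T (stdSimplex.vertex (k 0)) := by
    intro σ k hk
    let g : C(unitInterval, ℝ) :=
      (T.comp (stdMap k)).comp ⟨stdSimplexHomeomorphUnitInterval.symm, by fun_prop⟩
    have hg : ∀ t, (g t : AddCircle (1 : ℝ)) = θ (σ t) := by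
      intro t
      have e1 : σ t = τ (stdMap k (stdSimplexHomeomorphUnitInterval.symm t)) := by
        have := DFunLike.congr_fun hk (stdSimplexHomeomorphUnitInterval.symm t)
        simpa [simplexOfPath] using this
      rw [e1]
      exact congrFun hT _
    rw [hφ σ g hg]
    have v1 : stdSimplexHomeomorphUnitInterval.symm 1 = stdSimplex.vertex (S := ℝ) (1 : Fin 2) := by
      rw [Homeomorph.symm_apply_eq]; rfl
    have v0 : stdSimplexHomeomorphUnitInterval.symm 0 = stdSimplex.vertex (S := ℝ) (0 : Fin 2) := by
      rw [Homeomorph.symm_apply_eq]; rfl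
    have w : ∀ j, stdMap k (stdSimplex.vertex j) = stdSimplex.vertex (S := ℝ) (k j) :=
      fun j => stdSimplex.map_vertex k j
    simp only [g, ContinuousMap.comp_apply, ContinuousMap.coe_mk]
    rw [v1, v0, w, w]
  rw [lift _ _ h₀, lift _ _ h₁, lift _ _ h₂]
  simp [Fin.succAbove]

end Winding

/-! ### Finite unions of intervals -/

namespace IntervalUnion

variable (Ω : IntervalUnion)

theorem exists_index (x : Ω) : ∃ i, (x : ℝ) ∈ Icc (Ω.a i) (Ω.b i) := mem_iUnion.1 x.2

/-- The index of the component interval containing `x`. -/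
def index (x : Ω) : Fin Ω.m := (Ω.exists_index x).choose

variable {Ω}

theorem mem_Icc_index (x : Ω) : (x : ℝ) ∈ Icc (Ω.a (Ω.index x)) (Ω.b (Ω.index x)) :=
  (Ω.exists_index x).choose_spec

theorem index_eq {x : Ω} {i : Fin Ω.m} (h : (x : ℝ) ∈ Icc (Ω.a i) (Ω.b i)) : Ω.index x = i := by
  have h' := mem_Icc_index x
  rcases lt_trichotomy (Ω.index x) i with hlt | he | hlt
  · have := Ω.b_lt_a _ _ hlt
    linarith [h.1, h'.2]
  · exact he
  · have := Ω.b_lt_a _ _ hlt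
    linarith [h.2, h'.1]

theorem continuous_index : Continuous Ω.index := by
  refine continuous_iff_isClosed.2 fun s _ => ?_
  have : Ω.index ⁻¹' s = ⋃ i ∈ s, {x : Ω | (x : ℝ) ∈ Icc (Ω.a i) (Ω.b i)} := by
    ext x
    simp only [mem_preimage, mem_iUnion, mem_ofPred_eq, exists_prop]
    constructor
    · intro h; exact ⟨_, h, mem_Icc_index x⟩
    · rintro ⟨i, hi, hx⟩; rwa [index_eq hx]
  rw [this]
  exact (toFinite s).isClosed_biUnion fun i _ => isClosed_Icc.preimage continuous_subtype_val

theorem mem_carrier {t : ℝ} {i : Fin Ω.m} (h : t ∈ Icc (Ω.a i) (Ω.b i)) : t ∈ Ω.carrier :=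
  mem_iUnion.2 ⟨i, h⟩

theorem mem_connectedComponent_iff {x y : Ω} :
    y ∈ connectedComponent x ↔ Ω.index x = Ω.index y := by
  constructor
  · intro h
    have hp : IsPreconnected (Ω.index '' connectedComponent x) :=
      isPreconnected_connectedComponent.image _ continuous_index.continuousOn
    exact hp.subsingleton ⟨x, mem_connectedComponent, rfl⟩ ⟨y, h, rfl⟩
  · intro h
    have hx := mem_Icc_index x
    have hy := mem_Icc_index y
    rw [← h] at hy
    rcases le_total (x : ℝ) y with hxy | hxy
    · exact IntervalUnion.mem_component hxy fun t ht =>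
        mem_carrier ⟨hx.1.trans ht.1, ht.2.trans hy.2⟩
    · have : x ∈ connectedComponent y := IntervalUnion.mem_component hxy fun t ht =>
        mem_carrier ⟨hy.1.trans ht.1, ht.2.trans hx.2⟩
      rw [← connectedComponent_eq this]
      exact mem_connectedComponent

/-- The left endpoint of the `i`-th interval. -/
def left (i : Fin Ω.m) : Ω := ⟨Ω.a i, mem_carrier ⟨le_rfl, (Ω.a_lt_b i).le⟩⟩

/-- The right endpoint of the `i`-th interval. -/
def right (i : Fin Ω.m) : Ω := ⟨Ω.b i, mem_carrier ⟨(Ω.a_lt_b i).le, le_rfl⟩⟩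

theorem index_left (i : Fin Ω.m) : Ω.index (left i) = i := index_eq ⟨le_rfl, (Ω.a_lt_b i).le⟩

theorem index_right (i : Fin Ω.m) : Ω.index (right i) = i := index_eq ⟨(Ω.a_lt_b i).le, le_rfl⟩

theorem left_injective : Function.Injective (left (Ω := Ω)) := fun i j h => by
  rw [← index_left i, h, index_left]

theorem right_injective : Function.Injective (right (Ω := Ω)) := fun i j h => by
  rw [← index_right i, h, index_right]

theorem left_ne_right (i j : Fin Ω.m) : left i ≠ right j := fun h => by
  have hij : i = j := by rw [← index_left i, h, index_right]
  subst hij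
  exact (Ω.a_lt_b i).ne (congrArg Subtype.val h)

theorem mem_boundary_iff {x : Ω} :
    x ∈ Ω.boundary ↔ x = left (Ω.index x) ∨ x = right (Ω.index x) := by
  constructor
  · rintro ⟨i, h | h⟩
    · have : x = left i := Subtype.ext h
      subst this
      rw [index_left]; exact Or.inl rfl
    · have : x = right i := Subtype.ext h
      subst this
      rw [index_right]; exact Or.inr rfl
  · rintro (h | h)
    · exact ⟨_, Or.inl (congrArg Subtype.val h)⟩
    · exact ⟨_, Or.inr (congrArg Subtype.val h)⟩

theorem left_mem_boundary (i : Fin Ω.m) : left i ∈ Ω.boundary := ⟨i, Or.inl rfl⟩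

theorem right_mem_boundary (i : Fin Ω.m) : right i ∈ Ω.boundary := ⟨i, Or.inr rfl⟩

theorem finite_boundary : Ω.boundary.Finite := by
  refine ((finite_range (left (Ω := Ω))).union (finite_range (right (Ω := Ω)))).subset ?_
  intro x hx
  exact (mem_boundary_iff.1 hx).imp (fun h => ⟨_, h.symm⟩) (fun h => ⟨_, h.symm⟩)

instance : CompactSpace Ω :=
  isCompact_iff_compactSpace.1 (isCompact_iUnion fun _ => isCompact_Icc)

/-- The convex combination of two continuous families of points, when these lie in a common
interval. -/
def homotopy {Y : Type*} [TopologicalSpace Y] (g h : C(Y, Ω))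
    (hgh : ∀ y, Ω.index (g y) = Ω.index (h y)) : C(Y × unitInterval, Ω) where
  toFun z := ⟨(1 - (z.2 : ℝ)) * (g z.1 : ℝ) + (z.2 : ℝ) * (h z.1 : ℝ), by
    have h1 := mem_Icc_index (g z.1)
    have h2 := mem_Icc_index (h z.1)
    rw [← hgh] at h2
    exact mem_carrier (convex_Icc _ _ h1 h2 (sub_nonneg.2 z.2.2.2) z.2.2.1 (by ring))⟩
  continuous_toFun := by fun_prop

theorem homotopy_zero {Y : Type*} [TopologicalSpace Y] (g h : C(Y, Ω)) (hgh) (y : Y) :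
    homotopy g h hgh (y, 0) = g y := by
  apply Subtype.ext; simp [homotopy]

theorem homotopy_one {Y : Type*} [TopologicalSpace Y] (g h : C(Y, Ω)) (hgh) (y : Y) :
    homotopy g h hgh (y, 1) = h y := by
  apply Subtype.ext; simp [homotopy]

/-- The retraction onto the left endpoints. -/
def base : C(Ω, Ω) where
  toFun x := left (Ω.index x)
  continuous_toFun := (continuous_of_discreteTopology (f := left (Ω := Ω))).comp continuous_index

theorem index_base (x : Ω) : Ω.index (base x) = Ω.index x := index_left _

/-- Each interval is stretched by the factor `2` around its midpoint and clamped to itself; a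
neighbourhood of the boundary is mapped to the boundary. -/
def stretch : C(Ω, Ω) where
  toFun x := ⟨max (Ω.a (Ω.index x)) (min (Ω.b (Ω.index x))
      (2 * (x : ℝ) - (Ω.a (Ω.index x) + Ω.b (Ω.index x)) / 2)),
    mem_carrier (i := Ω.index x)
      ⟨le_max_left _ _, max_le (Ω.a_lt_b _).le (min_le_left _ _)⟩⟩
  continuous_toFun := by
    have h1 : Continuous fun x : Ω => Ω.a (Ω.index x) :=
      (continuous_of_discreteTopology (f := Ω.a)).comp continuous_index
    have h2 : Continuous fun x : Ω => Ω.b (Ω.index x) :=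
      (continuous_of_discreteTopology (f := Ω.b)).comp continuous_index
    fun_prop

theorem index_stretch (x : Ω) : Ω.index (stretch x) = Ω.index x :=
  index_eq ⟨le_max_left _ _, max_le (Ω.a_lt_b _).le (min_le_left _ _)⟩

theorem stretch_left (i : Fin Ω.m) : stretch (left i) = left i := by
  apply Subtype.ext
  have := Ω.a_lt_b i
  simp only [stretch, ContinuousMap.coe_mk, index_left]
  simp only [left]
  rw [min_eq_right (by linarith), max_eq_left (by linarith)]

theorem stretch_right (i : Fin Ω.m) : stretch (right i) = right i := by
  apply Subtype.ext
  have := Ω.a_lt_b i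
  simp only [stretch, ContinuousMap.coe_mk, index_right]
  simp only [right]
  rw [min_eq_left (by linarith), max_eq_right (by linarith)]

theorem stretch_of_mem_boundary {x : Ω} (hx : x ∈ Ω.boundary) : stretch x = x := by
  rcases mem_boundary_iff.1 hx with h | h
  · rw [h, stretch_left]
  · rw [h, stretch_right]

/-- The middle halves of the intervals. -/
def middle : Set Ω := {x | (3 * Ω.a (Ω.index x) + Ω.b (Ω.index x)) / 4 ≤ (x : ℝ) ∧
  (x : ℝ) ≤ (Ω.a (Ω.index x) + 3 * Ω.b (Ω.index x)) / 4}

theorem isClosed_middle : IsClosed (middle (Ω := Ω)) := by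
  have h1 : Continuous fun x : Ω => Ω.a (Ω.index x) :=
    (continuous_of_discreteTopology (f := Ω.a)).comp continuous_index
  have h2 : Continuous fun x : Ω => Ω.b (Ω.index x) :=
    (continuous_of_discreteTopology (f := Ω.b)).comp continuous_index
  have h3 : Continuous fun x : Ω => (x : ℝ) := continuous_subtype_val
  exact (isClosed_le (((continuous_const.mul h1).add h2).div_const _) h3).inter
    (isClosed_le h3 ((h1.add (continuous_const.mul h2)).div_const _))

theorem notMem_middle_of_mem_boundary {x : Ω} (hx : x ∈ Ω.boundary) : x ∉ middle := by
  have hab := Ω.a_lt_b (Ω.index x)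
  rintro ⟨h1, h2⟩
  rcases mem_boundary_iff.1 hx with h | h
  · have : (x : ℝ) = Ω.a (Ω.index x) := congrArg Subtype.val h
    linarith
  · have : (x : ℝ) = Ω.b (Ω.index x) := congrArg Subtype.val h
    linarith

theorem stretch_mem_boundary {x : Ω} (hx : x ∉ middle) : stretch x ∈ Ω.boundary := by
  have hab := Ω.a_lt_b (Ω.index x)
  have h : (x : ℝ) < (3 * Ω.a (Ω.index x) + Ω.b (Ω.index x)) / 4 ∨
      (Ω.a (Ω.index x) + 3 * Ω.b (Ω.index x)) / 4 < (x : ℝ) := by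
    by_contra hc
    push Not at hc
    exact hx hc
  refine ⟨Ω.index x, h.imp (fun h => ?_) (fun h => ?_)⟩ <;>
    simp only [stretch, ContinuousMap.coe_mk]
  · rw [min_eq_right (by linarith), max_eq_left (by linarith)]
  · rw [min_eq_left (by linarith), max_eq_right (by linarith)]

/-- The position of a point relative to the `i`-th interval, normalized to `[0, 1]`, and `0` on
the other intervals. -/
def coordinate (i : Fin Ω.m) : C(Ω, ℝ) where
  toFun x := if Ω.index x = i then ((x : ℝ) - Ω.a i) / (Ω.b i - Ω.a i) else 0
  continuous_toFun := by
    refine Continuous.if (fun x hx => ?_) (by fun_prop) continuous_const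
    have : IsClopen {x : Ω | Ω.index x = i} :=
      (isClopen_discrete {i}).preimage continuous_index
    rw [this.frontier_eq] at hx
    exact hx.elim

theorem coordinate_base (i : Fin Ω.m) (x : Ω) : coordinate i (base x) = 0 := by
  by_cases h : Ω.index x = i
  · subst h; simp [coordinate, base, left]
  · simp [coordinate, base, index_left, h]

theorem coordinate_left (i j : Fin Ω.m) : coordinate i (left j) = 0 := by
  have := coordinate_base i (left j)
  rwa [show base (left j) = left j from congrArg left (index_left j)] at this

theorem coordinate_right (i j : Fin Ω.m) : coordinate i (right j) = if j = i then 1 else 0 := by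
  have hab := Ω.a_lt_b j
  by_cases h : j = i
  · subst h
    simp only [coordinate, ContinuousMap.coe_mk, index_right, if_true]
    exact div_self (sub_ne_zero.2 hab.ne')
  · simp [coordinate, index_right, h]

theorem coe_coordinate_boundary (i : Fin Ω.m) {x : Ω} (hx : x ∈ Ω.boundary) :
    (coordinate i x : AddCircle (1 : ℝ)) = 0 := by
  rcases mem_boundary_iff.1 hx with h | h
  · rw [h, coordinate_left]; rfl
  · rw [h, coordinate_right]
    split_ifs
    · exact AddCircle.coe_period 1
    · rfl

theorem lmapDomain_base_eq : Finsupp.lmapDomain ℝ ℝ (base (Ω := Ω)) =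
    Finsupp.lmapDomain ℝ ℝ (left (Ω := Ω)) ∘ₗ Finsupp.lmapDomain ℝ ℝ Ω.index :=
  Finsupp.lmapDomain_comp ℝ ℝ Ω.index left

theorem sub_lmapDomain_base_mem_S1 (v : Ω →₀ ℝ) :
    (LinearMap.id - Finsupp.lmapDomain ℝ ℝ base : Module.End ℝ (Ω →₀ ℝ)) v ∈ S1 Ω := by
  induction v using Finsupp.induction_linear with
  | zero => simp
  | add u w hu hw =>
    rw [map_add]
    exact Submodule.add_mem _ hu hw
  | single x r =>
    have : (LinearMap.id - Finsupp.lmapDomain ℝ ℝ base : Module.End ℝ (Ω →₀ ℝ))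
        (Finsupp.single x r) =
        r • (Finsupp.single x 1 - Finsupp.single (base x) 1 : Ω →₀ ℝ) := by
      simp [smul_sub]
    rw [this]
    exact Submodule.smul_mem _ _ (Submodule.subset_span
      ⟨_, _, mem_connectedComponent_iff.2 (index_base x), rfl⟩)

theorem mem_S1_iff {v : Ω →₀ ℝ} : v ∈ S1 Ω ↔ Finsupp.lmapDomain ℝ ℝ Ω.index v = 0 := by
  constructor
  · intro h
    induction h using Submodule.span_induction with
    | mem v hv =>
      obtain ⟨x, y, hxy, rfl⟩ := hv
      rw [map_sub]
      simp [mem_connectedComponent_iff.1 hxy]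
    | zero => exact map_zero _
    | add u w _ _ hu hw => rw [map_add, hu, hw, add_zero]
    | smul r u _ hu => rw [map_smul, hu, smul_zero]
  · intro h
    have := sub_lmapDomain_base_mem_S1 v
    rwa [LinearMap.sub_apply, lmapDomain_base_eq, LinearMap.comp_apply, h, map_zero,
      sub_zero] at this

theorem lmapDomain_base_of_mem_S1 {v : Ω →₀ ℝ} (hv : v ∈ S1 Ω) :
    Finsupp.lmapDomain ℝ ℝ base v = 0 := by
  rw [lmapDomain_base_eq, LinearMap.comp_apply, mem_S1_iff.1 hv, map_zero]

end IntervalUnion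

/-! ### One-chains of a graph obtained by gluing the ends of intervals -/

section Gluing

universe u

variable {Ω : IntervalUnion} {G : Type u} [TopologicalSpace G]

open IntervalUnion

/-- The space `G` is obtained from `Ω` by identifying some boundary points. -/
structure IsBoundaryGluing (π : C(Ω, G)) : Prop where
  surjective : Function.Surjective π
  eq_or_mem : ∀ x y, π x = π y → x = y ∨ (x ∈ Ω.boundary ∧ y ∈ Ω.boundary)
  isEmbedding : IsEmbedding ((Ω.boundary)ᶜ.domRestrict π)

/-- The segment from the left endpoint of its interval to `x`. -/
def edgePath (x : Ω) : C(unitInterval, Ω) :=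
  (homotopy base (ContinuousMap.id Ω) index_base).comp ⟨fun t => (x, t), by fun_prop⟩

/-- The linear map sending `x` to the class of the image of the segment from the left endpoint of
its interval to `x`. -/
def edgeClass (π : C(Ω, G)) : (Ω →₀ ℝ) →ₗ[ℝ] OneChains G :=
  Finsupp.lift _ ℝ Ω fun x => pathClass (π.comp (edgePath x))

theorem edgeClass_single (π : C(Ω, G)) (x : Ω) :
    edgeClass π (Finsupp.single x 1) = pathClass (π.comp (edgePath x)) := by
  simp [edgeClass]

theorem index_path_eq (δ : C(unitInterval, Ω)) (s t : unitInterval) :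
    Ω.index (δ s) = Ω.index (δ t) :=
  (isPreconnected_range (continuous_index.comp δ.continuous)).subsingleton ⟨s, rfl⟩ ⟨t, rfl⟩

/-- Paths in `Ω` are homotopic to segments. -/
theorem pathClass_comp (π : C(Ω, G)) (δ : C(unitInterval, Ω)) :
    pathClass (π.comp δ) =
      edgeClass π (Finsupp.single (δ 1) 1 - Finsupp.single (δ 0) 1) := by
  let K := homotopy base (ContinuousMap.id Ω) index_base
  have hK0 : ∀ x, K (x, 0) = base x := homotopy_zero base (ContinuousMap.id Ω) index_base
  have hK1 : ∀ x, K (x, 1) = x := homotopy_one base (ContinuousMap.id Ω) index_base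
  have h := pathClass_square (π.comp (K.comp ⟨fun z => (δ z.1, z.2), by fun_prop⟩))
  have h0 : (π.comp (K.comp ⟨fun z : unitInterval × unitInterval => (δ z.1, z.2),
      by fun_prop⟩)).comp ⟨fun s => (s, 0), by fun_prop⟩ = ContinuousMap.const _ (π (base (δ 0))) := by
    ext s
    simp only [ContinuousMap.comp_apply, ContinuousMap.coe_mk, ContinuousMap.const_apply, hK0]
    exact congrArg (fun i => π (left i)) (index_path_eq δ s 0)
  have h1 : (π.comp (K.comp ⟨fun z : unitInterval × unitInterval => (δ z.1, z.2),
      by fun_prop⟩)).comp ⟨fun s => (s, 1), by fun_prop⟩ = π.comp δ := by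
    ext s
    simp only [ContinuousMap.comp_apply, ContinuousMap.coe_mk, hK1]
  rw [h0, h1, pathClass_const, zero_add] at h
  rw [map_sub, edgeClass_single, edgeClass_single, eq_sub_iff_add_eq, add_comm]
  exact h.symm

theorem pathClass_comp_mem (π : C(Ω, G)) (δ : C(unitInterval, Ω)) :
    pathClass (π.comp δ) ∈ (S1 Ω).map (edgeClass π) := by
  rw [pathClass_comp]
  exact Submodule.mem_map_of_mem (Submodule.subset_span
    ⟨_, _, mem_connectedComponent_iff.2 (index_path_eq δ 0 1), rfl⟩)

theorem boundaryMap_edgeClass (π : C(Ω, G)) {v : Ω →₀ ℝ} (hv : v ∈ S1 Ω) :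
    boundaryMap G (edgeClass π v) = Finsupp.lmapDomain ℝ ℝ π v := by
  have key : boundaryMap G ∘ₗ edgeClass π =
      Finsupp.lmapDomain ℝ ℝ π - Finsupp.lmapDomain ℝ ℝ (π ∘ left) ∘ₗ
        Finsupp.lmapDomain ℝ ℝ Ω.index := by
    ext x : 2
    simp only [LinearMap.comp_apply, Finsupp.lsingle_apply, LinearMap.sub_apply]
    rw [edgeClass_single, boundaryMap_pathClass]
    have h1 : edgePath x 1 = x := homotopy_one base (ContinuousMap.id Ω) index_base x
    have h0 : edgePath x 0 = base x := homotopy_zero base (ContinuousMap.id Ω) index_base x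
    simp only [ContinuousMap.comp_apply, h0, h1, Finsupp.lmapDomain_apply,
      Finsupp.mapDomain_single]
    rfl
  have := LinearMap.congr_fun key v
  rw [LinearMap.sub_apply, LinearMap.comp_apply, LinearMap.comp_apply, mem_S1_iff.1 hv, map_zero,
    sub_zero] at this
  exact this

namespace IsBoundaryGluing

variable {π : C(Ω, G)}

theorem isQuotientMap_prod [T2Space G] (hπ : IsBoundaryGluing π) :
    IsQuotientMap (Prod.map π (id : unitInterval → unitInterval)) :=
  .of_surjective_continuous (hπ.surjective.prodMap Function.surjective_id)
    (π.continuous.prodMap continuous_id)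

/-- A continuous map on `Ω` which factors through the gluing set-theoretically does so
topologically. -/
theorem exists_factor [T2Space G] (hπ : IsBoundaryGluing π) {Z : Type*} [TopologicalSpace Z]
    (k : C(Ω, Z))
    (hk : ∀ x ∈ Ω.boundary, ∀ y ∈ Ω.boundary, π x = π y → k x = k y) :
    ∃ k' : C(G, Z), ∀ x, k' (π x) = k x := by
  have hq : IsQuotientMap π := .of_surjective_continuous hπ.surjective π.continuous
  let s := Function.surjInv hπ.surjective
  have hs : ∀ x, k (s (π x)) = k x := fun x => by
    have := Function.surjInv_eq hπ.surjective (π x)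
    rcases hπ.eq_or_mem _ _ this with h | ⟨h1, h2⟩
    · exact congrArg k h
    · exact hk _ h1 _ h2 this
  exact ⟨⟨k ∘ s, hq.continuous_iff.2 (k.continuous.congr fun x => (hs x).symm)⟩, hs⟩

theorem exists_homotopy [T2Space G] (hπ : IsBoundaryGluing π) (K : C(Ω × unitInterval, Ω))
    (hK : ∀ x ∈ Ω.boundary, ∀ t, K (x, t) = x) :
    ∃ H : C(G × unitInterval, G), ∀ x t, H (π x, t) = π (K (x, t)) := by
  let s := Function.surjInv hπ.surjective
  have hs : ∀ x t, π (K (s (π x), t)) = π (K (x, t)) := fun x t => by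
    have := Function.surjInv_eq hπ.surjective (π x)
    rcases hπ.eq_or_mem _ _ this with h | ⟨h1, h2⟩
    · exact congrArg (fun x => π (K (x, t))) h
    · rw [hK _ h1, hK _ h2]; exact this
  exact ⟨⟨fun z => π (K (s z.1, z.2)), hπ.isQuotientMap_prod.continuous_iff.2
    ((π.comp K).continuous.congr fun z => (hs z.1 z.2).symm)⟩, hs⟩

/-- Near the glued points, paths are homotopic to constant paths up to paths coming from `Ω`. -/
theorem pathClass_mem_of_notMem_middle [T2Space G] (hπ : IsBoundaryGluing π)
    (σ : C(unitInterval, G)) (hσ : ∀ t, σ t ∈ (π '' middle)ᶜ) :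
    pathClass σ ∈ (S1 Ω).map (edgeClass π) := by
  let K := homotopy (ContinuousMap.id Ω) stretch fun x => (index_stretch x).symm
  obtain ⟨H, hH⟩ := hπ.exists_homotopy K fun x hx t => by
    apply Subtype.ext
    simp only [K, homotopy, ContinuousMap.coe_mk, stretch_of_mem_boundary hx,
      ContinuousMap.id_apply]
    ring
  have hK0 : ∀ x, K (x, 0) = x :=
    homotopy_zero (ContinuousMap.id Ω) stretch fun x => (index_stretch x).symm
  have hK1 : ∀ x, K (x, 1) = stretch x :=
    homotopy_one (ContinuousMap.id Ω) stretch fun x => (index_stretch x).symm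
  let s := Function.surjInv hπ.surjective
  have hs : ∀ p, π (s p) = p := Function.surjInv_eq hπ.surjective
  have hH' : ∀ p t, H (p, t) = π (K (s p, t)) := fun p t => by rw [← hH, hs]
  have h := pathClass_square (H.comp ⟨fun z => (σ z.1, z.2), by fun_prop⟩)
  have h0 : (H.comp ⟨fun z : unitInterval × unitInterval => (σ z.1, z.2), by fun_prop⟩).comp
      ⟨fun s => (s, 0), by fun_prop⟩ = σ := by
    ext t
    simp only [ContinuousMap.comp_apply, ContinuousMap.coe_mk, hH', hK0]
    exact hs _
  have h1 : (H.comp ⟨fun z : unitInterval × unitInterval => (σ z.1, z.2), by fun_prop⟩).comp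
      ⟨fun s => (s, 1), by fun_prop⟩ = ContinuousMap.const _ (π (stretch (s (σ 0)))) := by
    have hv : ∀ t, H (σ t, 1) = π (stretch (s (σ t))) := fun t => by
      rw [hH', hK1]
    have hmem : ∀ t, H (σ t, 1) ∈ π '' Ω.boundary := fun t => by
      rw [hv]
      refine mem_image_of_mem _ (stretch_mem_boundary fun hm => hσ t ?_)
      exact ⟨_, hm, hs _⟩
    have hfin : (π '' Ω.boundary).Finite := finite_boundary.image _
    have hc : IsPreconnected (range fun t => H (σ t, 1)) := isPreconnected_range (by fun_prop)
    have hsub : (range fun t => H (σ t, 1)).Subsingleton := by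
      have hf : (range fun t => H (σ t, 1)).Finite := hfin.subset (range_subset_iff.2 hmem)
      exact (hc.isDiscrete_iff_subsingleton).1 hf.isDiscrete
    ext t
    simp only [ContinuousMap.comp_apply, ContinuousMap.coe_mk, ContinuousMap.const_apply]
    rw [← hv 0]
    exact hsub ⟨t, rfl⟩ ⟨0, rfl⟩
  have ht : ∀ r : unitInterval,
      pathClass ((H.comp ⟨fun z : unitInterval × unitInterval => (σ z.1, z.2), by fun_prop⟩).comp
        ⟨fun t => (r, t), by fun_prop⟩) ∈ (S1 Ω).map (edgeClass π) := fun r => by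
    have : (H.comp ⟨fun z : unitInterval × unitInterval => (σ z.1, z.2), by fun_prop⟩).comp
        ⟨fun t => (r, t), by fun_prop⟩ =
        π.comp (K.comp ⟨fun t => (s (σ r), t), by fun_prop⟩) := by
      ext t
      simp only [ContinuousMap.comp_apply, ContinuousMap.coe_mk, hH']
    rw [this]
    exact pathClass_comp_mem _ _
  rw [h0, h1, pathClass_const, add_zero] at h
  have := Submodule.sub_mem _ (ht 0) (ht 1)
  rwa [← h, add_sub_cancel_right] at this

/-- A path that avoids the glued points lifts to `Ω`. -/
theorem pathClass_mem_of_notMem_boundary (hπ : IsBoundaryGluing π) (σ : C(unitInterval, G))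
    (hσ : ∀ t, σ t ∈ (π '' Ω.boundary)ᶜ) : pathClass σ ∈ (S1 Ω).map (edgeClass π) := by
  let s := Function.surjInv hπ.surjective
  have hs : ∀ p, π (s p) = p := Function.surjInv_eq hπ.surjective
  let δ : unitInterval → ↥(Ω.boundary)ᶜ := fun t =>
    ⟨s (σ t), fun hm => hσ t ⟨_, hm, hs _⟩⟩
  have hδ : Continuous δ := hπ.isEmbedding.continuous_iff.2 (by
    refine σ.continuous.congr fun t => ?_
    exact (hs _).symm)
  have : σ = π.comp ⟨fun t => (δ t : Ω), by fun_prop⟩ := by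
    ext t
    exact (hs _).symm
  rw [this]
  exact pathClass_comp_mem _ _

/-- Edge classes exhaust the `1`-chains modulo boundaries: each path is cut into pieces that avoid
either the glued points or the middle halves of the edges. -/
theorem map_edgeClass_eq_top [T2Space G] (hπ : IsBoundaryGluing π) :
    (S1 Ω).map (edgeClass π) = ⊤ := by
  rw [eq_top_iff, ← span_range_pathClass, Submodule.span_le]
  rintro _ ⟨σ, rfl⟩
  refine pathClass_mem_of_local _ {(π '' middle)ᶜ, (π '' Ω.boundary)ᶜ} ?_ ?_ ?_ σ
  · rintro U (rfl | rfl)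
    · exact (isClosed_middle.isCompact.image π.continuous).isClosed.isOpen_compl
    · exact (finite_boundary.image _).isClosed.isOpen_compl
  · rw [sUnion_pair, ← compl_inter, compl_univ_iff, eq_empty_iff_forall_notMem]
    rintro p ⟨⟨x, hx, rfl⟩, ⟨y, hy, hxy⟩⟩
    rcases hπ.eq_or_mem _ _ hxy with rfl | ⟨-, h⟩
    · exact notMem_middle_of_mem_boundary hy hx
    · exact notMem_middle_of_mem_boundary h hx
  · rintro U (rfl | rfl) σ hσ
    · exact hπ.pathClass_mem_of_notMem_middle σ hσ
    · exact hπ.pathClass_mem_of_notMem_boundary σ hσ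

/-- The winding number along the `i`-th edge. -/
theorem exists_edge_winding [T2Space G] (hπ : IsBoundaryGluing π) (i : Fin Ω.m) :
    ∃ ω : OneChains G →ₗ[ℝ] ℝ, ∀ x, ω (edgeClass π (Finsupp.single x 1)) = coordinate i x := by
  obtain ⟨θ, hθ⟩ := hπ.exists_factor
    ((⟨fun r : ℝ => (r : AddCircle (1 : ℝ)), AddCircle.continuous_mk' 1⟩ :
      C(ℝ, AddCircle (1 : ℝ))).comp (coordinate i)) fun x hx y hy _ =>
        (coe_coordinate_boundary i hx).trans (coe_coordinate_boundary i hy).symm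
  obtain ⟨ω, hω⟩ := exists_winding θ
  refine ⟨ω, fun x => ?_⟩
  rw [edgeClass_single, hω _ ((coordinate i).comp (edgePath x)) fun t => (hθ _).symm]
  have h1 : edgePath x 1 = x := homotopy_one base (ContinuousMap.id Ω) index_base x
  have h0 : edgePath x 0 = base x := homotopy_zero base (ContinuousMap.id Ω) index_base x
  rw [ContinuousMap.comp_apply, ContinuousMap.comp_apply, h0, h1, coordinate_base, sub_zero]

/-- The kernel of `π` lives on the boundary, as `π` is injective elsewhere. -/
theorem apply_eq_zero_of_mem_ker (hπ : IsBoundaryGluing π) {v : Ω →₀ ℝ}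
    (hv : Finsupp.lmapDomain ℝ ℝ π v = 0) {x : Ω} (hx : x ∉ Ω.boundary) : v x = 0 := by
  have h := DFunLike.congr_fun hv (π x)
  rw [Finsupp.lmapDomain_apply, Finsupp.mapDomain, Finsupp.sum_apply, Finsupp.sum] at h
  rw [Finset.sum_eq_single x] at h
  · simpa using h
  · intro y _ hyx
    refine Finsupp.single_eq_of_ne' fun e => ?_
    rcases hπ.eq_or_mem _ _ e with rfl | ⟨-, h⟩
    · exact hyx rfl
    · exact hx h
  · intro hx
    rw [Finsupp.notMem_support_iff.1 hx, Finsupp.single_zero]; rfl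

/-- Edge classes are linearly independent. If `v` maps to `0`, its image under the boundary map
vanishes, so `v` is supported on the boundary; then the winding number along each edge reads off
the coefficient at the right endpoint of that edge. -/
theorem edgeClass_injOn [T2Space G] (hπ : IsBoundaryGluing π) {v : Ω →₀ ℝ} (hv : v ∈ S1 Ω)
    (h : edgeClass π v = 0) : v = 0 := by
  have hp : Finsupp.lmapDomain ℝ ℝ π v = 0 := by
    rw [← boundaryMap_edgeClass π hv, h, map_zero]
  have hsupp : ∀ x ∉ Ω.boundary, v x = 0 := fun x hx => hπ.apply_eq_zero_of_mem_ker hp hx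
  have hsum : v = ∑ i, (Finsupp.single (left i) (v (left i)) +
      Finsupp.single (right i) (v (right i))) := by
    ext x
    simp only [Finsupp.finsetSum_apply, Finsupp.add_apply, Finsupp.single_apply]
    by_cases hx : x ∈ Ω.boundary
    · rcases mem_boundary_iff.1 hx with e | e
      · rw [e]
        simp [left_injective.eq_iff, (left_ne_right _ _).symm]
      · rw [e]
        simp [right_injective.eq_iff, left_ne_right]
    · rw [hsupp x hx]
      refine (Finset.sum_eq_zero fun i _ => ?_).symm
      rw [if_neg fun e : left i = x => hx (e ▸ left_mem_boundary i),
        if_neg fun e : right i = x => hx (e ▸ right_mem_boundary i), add_zero]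
  have hr : ∀ i, v (right i) = 0 := by
    intro i
    obtain ⟨ω, hω⟩ := hπ.exists_edge_winding i
    have hl : ∀ x r, ω (edgeClass π (Finsupp.single x r)) = r * coordinate i x := fun x r => by
      rw [← hω, ← smul_eq_mul, ← map_smul, ← map_smul, Finsupp.smul_single_one]
    have h' : ω (edgeClass π v) = 0 := by rw [h, map_zero]
    rw [hsum] at h'
    simpa [hl, coordinate_left, coordinate_right] using h'
  have hl : ∀ i, v (left i) = 0 := by
    intro i
    have := mem_S1_iff.1 hv
    rw [hsum] at this
    have := DFunLike.congr_fun this i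
    simpa [index_left, hr, Finsupp.single_apply, Finsupp.mapDomain_finsetSum] using this
  rw [hsum]
  simp [hr, hl]

end IsBoundaryGluing

end Gluing

/-! ### The action of an induced map on one-chains -/

section Induced

universe u

variable {Ω : IntervalUnion} {G : Type u} [TopologicalSpace G]

open IntervalUnion

namespace PMMap

variable (F : PMMap Ω)

open Classical in
/-- The extension of `F` by a constant outside its domain, as a function on `ℝ`. -/
def extend (c : Ω) (t : ℝ) : Ω :=
  if h : ∃ p : ↥(F.Cᶜ), ((p : Ω) : ℝ) = t then F.toFun h.choose else c

theorem extend_coe (c : Ω) (p : ↥(F.Cᶜ)) : F.extend c ((p : Ω) : ℝ) = F.toFun p := by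
  have h : ∃ q : ↥(F.Cᶜ), ((q : Ω) : ℝ) = ((p : Ω) : ℝ) := ⟨p, rfl⟩
  rw [extend, dif_pos h]
  congr 1
  exact Subtype.ext (Subtype.ext h.choose_spec)

theorem tendsto_extend {c l : Ω} {L : Filter ℝ} {x y : Ω} (hxy : F.MonotoneOnIcc x y)
    (hL : Ioo (x : ℝ) y ∈ L)
    (h : Tendsto F.toFun (comap (fun t : ↥(F.Cᶜ) => ((t : Ω) : ℝ)) L) (𝓝 l)) :
    Tendsto (F.extend c) L (𝓝 l) := by
  rw [tendsto_def] at h ⊢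
  intro s hs
  obtain ⟨u, hu, hus⟩ := mem_comap.1 (h s hs)
  filter_upwards [hu, hL] with t ht ht'
  obtain ⟨p, rfl⟩ := hxy.exists_point F ht'
  rw [mem_preimage, extend_coe]
  exact hus ht

theorem continuousOn_extend {x y : Ω} (hxy : F.MonotoneOnIcc x y) (c : Ω) :
    ContinuousOn (F.extend c) (Ioo (x : ℝ) y) := by
  intro t ht
  refine ContinuousAt.continuousWithinAt ?_
  obtain ⟨p, rfl⟩ := hxy.exists_point F ht
  rw [ContinuousAt, extend_coe]
  refine F.tendsto_extend hxy (isOpen_Ioo.mem_nhds ht) ?_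
  have hc := F.continuousOn p p mem_connectedComponent
  refine hc.mono_left (le_inf ?_ (le_principal_iff.2 ?_))
  · rw [nhds_subtype_eq_comap, nhds_subtype_eq_comap, comap_comap]
    exact le_rfl
  · exact mem_of_superset (preimage_mem_comap (isOpen_Ioo.mem_nhds ht)) fun q hq =>
      F.mem_component isPreconnected_Ioo hxy.2 p q ht hq

/-- A monotone piece of `F` extends to a path between the one-sided limits. -/
theorem exists_image_path {x y : Ω} (hxy : F.MonotoneOnIcc x y) :
    ∃ δ δ' : C(unitInterval, Ω), δ 0 = x ∧ δ 1 = y ∧ δ' 0 = F.rightLim x ∧ δ' 1 = F.leftLim y ∧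
      ∀ t ∈ Ioo (0 : unitInterval) 1, ∃ p : ↥(F.Cᶜ), δ t = p ∧ δ' t = F.toFun p := by
  have hindex := mem_connectedComponent_iff.1 (hxy.mem_component F)
  let δ : C(unitInterval, Ω) :=
    (homotopy (ContinuousMap.const Unit x) (ContinuousMap.const Unit y) fun _ => hindex).comp
      ⟨fun t => ((), t), by fun_prop⟩
  have hδ : ∀ t, (δ t : ℝ) = (1 - (t : ℝ)) * x + t * y := fun t => rfl
  have hlt := hxy.1
  have hmem : ∀ t, (δ t : ℝ) ∈ Icc (x : ℝ) y := fun t => by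
    rw [hδ]
    have := t.2.1
    have := t.2.2
    constructor <;> nlinarith
  let g := F.extend x
  have h0 := F.tendsto_extend (c := x) hxy (Ioo_mem_nhdsGT hlt) (F.tendsto_rightLim hxy)
  have h1 := F.tendsto_extend (c := x) hxy (Ioo_mem_nhdsLT hlt) (F.tendsto_leftLim hxy)
  have hcont := continuousOn_Icc_extendFrom_Ioo (F.continuousOn_extend hxy x) h0 h1
  refine ⟨δ, ⟨fun t => extendFrom (Ioo (x : ℝ) y) (F.extend x) (δ t),
    hcont.comp_continuous (by fun_prop) hmem⟩, ?_, ?_, ?_, ?_, ?_⟩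
  · apply Subtype.ext; rw [hδ]; simp
  · apply Subtype.ext; rw [hδ]; simp
  · have : (δ 0 : ℝ) = x := by rw [hδ]; simp
    simp only [ContinuousMap.coe_mk, this]
    exact eq_lim_at_left_extendFrom_Ioo hlt h0
  · have : (δ 1 : ℝ) = y := by rw [hδ]; simp
    simp only [ContinuousMap.coe_mk, this]
    exact eq_lim_at_right_extendFrom_Ioo hlt h1
  · intro t ht
    have ht' : (δ t : ℝ) ∈ Ioo (x : ℝ) y := by
      have h1 : (0 : ℝ) < t := ht.1
      have h2 : (t : ℝ) < 1 := ht.2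
      rw [hδ]
      constructor <;> nlinarith
    obtain ⟨p, hp⟩ := hxy.exists_point F ht'
    refine ⟨p, Subtype.ext hp.symm, ?_⟩
    simp only [ContinuousMap.coe_mk]
    rw [extendFrom_eq (subset_closure ht') (F.continuousOn_extend hxy x _ ht'), ← hp, extend_coe]

end PMMap

namespace IsInducedBy

variable {f : C(G, G)} {F : PMMap Ω} {π : Ω → G}

theorem isBoundaryGluing (hF : IsInducedBy f F π) :
    IsBoundaryGluing (⟨π, hF.continuous⟩ : C(Ω, G)) where
  surjective p := by
    by_cases hp : p ∈ π '' Ω.boundary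
    · obtain ⟨x, -, hx⟩ := hp; exact ⟨x, hx⟩
    · obtain ⟨x, -, hx⟩ : p ∈ π '' (Ω.boundary)ᶜ := hF.image_interior ▸ hp
      exact ⟨x, hx⟩
  eq_or_mem := by
    have key : ∀ x y, π x = π y → x ∉ Ω.boundary → y ∉ Ω.boundary := fun x y h hx hy => by
      have : π x ∈ (π '' Ω.boundary)ᶜ := hF.image_interior ▸ mem_image_of_mem π hx
      exact this ⟨y, hy, h.symm⟩
    intro x y h
    by_cases hx : x ∈ Ω.boundary
    · by_cases hy : y ∈ Ω.boundary
      · exact Or.inr ⟨hx, hy⟩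
      · exact absurd hx (key y x h.symm hy)
    · have hy := key x y h hx
      have := hF.isEmbedding.injective (a₁ := ⟨x, hx⟩) (a₂ := ⟨y, hy⟩) h
      exact Or.inl (congrArg Subtype.val this)
  isEmbedding := hF.isEmbedding

variable [T2Space G]

/-- Under `S₁(Ω; ℝ) → OneChains G`, the chain map of `f` corresponds to `F_{#1}`: by density `f ∘ π`
carries a monotone piece of `F` to the image under `π` of the path from `F(x+)` to `F(y-)`. -/
theorem oneChainsMap_edgeClass (hF : IsInducedBy f F π) (v : S1 Ω) :
    oneChainsMap f (edgeClass ⟨π, hF.continuous⟩ v) =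
      edgeClass ⟨π, hF.continuous⟩ (F.sharp1 v) := by
  obtain ⟨v, hv⟩ := v
  have hge := F.S1_eq_span.ge
  have hv' := F.S1_eq_span.le hv
  induction hv' using Submodule.span_induction with
  | mem v hm =>
    obtain ⟨x, y, hxy, rfl⟩ := hm
    rw [F.isSharp1_sharp1 x y hxy _ rfl]
    obtain ⟨δ, δ', h0, h1, h0', h1', hδ⟩ := F.exists_image_path hxy
    rw [← h0', ← h1', ← pathClass_comp]
    simp only [← h0, ← h1]
    rw [← pathClass_comp, oneChainsMap_pathClass]
    congr 1
    have heq : EqOn (fun t => f (π (δ t))) (fun t => π (δ' t)) univ := by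
      have hIoo : EqOn (fun t => f (π (δ t))) (fun t => π (δ' t)) (Ioo (0 : unitInterval) 1) := by
        intro t ht
        obtain ⟨p, hp, hp'⟩ := hδ t ht
        simp only [hp, hp']
        exact (hF.comm p).symm
      refine hIoo.of_subset_closure ?_ ?_ (subset_univ _) ?_
      · exact (f.continuous.comp (hF.continuous.comp δ.continuous)).continuousOn
      · exact (hF.continuous.comp δ'.continuous).continuousOn
      · rw [closure_Ioo zero_ne_one]
        exact fun t _ => ⟨unitInterval.nonneg', unitInterval.le_one'⟩
    ext t
    exact heq (mem_univ t)
  | zero =>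
    have : (⟨0, hv⟩ : S1 Ω) = 0 := rfl
    rw [this, map_zero, Submodule.coe_zero, map_zero, map_zero]
  | add u w hu hw ihu ihw =>
    have : (⟨u + w, hv⟩ : S1 Ω) = ⟨u, hge hu⟩ + ⟨w, hge hw⟩ := rfl
    rw [this, map_add, Submodule.coe_add, Submodule.coe_add, map_add, map_add, map_add, ihu, ihw]
  | smul r u hu ihu =>
    have : (⟨r • u, hv⟩ : S1 Ω) = r • ⟨u, hge hu⟩ := rfl
    rw [this, map_smul, Submodule.coe_smul, Submodule.coe_smul, map_smul, map_smul, map_smul, ihu]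

/-- The isomorphism from `S₁(Ω; ℝ)` to the `1`-chains of `G` modulo boundaries. -/
def chainsEquiv (hF : IsInducedBy f F π) : S1 Ω ≃ₗ[ℝ] OneChains G :=
  LinearEquiv.ofBijective (edgeClass ⟨π, hF.continuous⟩ ∘ₗ (S1 Ω).subtype) (by
    constructor
    · refine (injective_iff_map_eq_zero _).2 fun v hv => ?_
      exact Subtype.ext (hF.isBoundaryGluing.edgeClass_injOn v.2 hv)
    · refine LinearMap.range_eq_top.1 ?_
      rw [LinearMap.range_comp, Submodule.range_subtype]
      exact hF.isBoundaryGluing.map_edgeClass_eq_top)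

theorem boundaryMap_chainsEquiv (hF : IsInducedBy f F π) (v : S1 Ω) :
    boundaryMap G (hF.chainsEquiv v) = Finsupp.lmapDomain ℝ ℝ π v :=
  boundaryMap_edgeClass _ v.2

theorem chainsEquiv_sharp1 (hF : IsInducedBy f F π) (v : S1 Ω) :
    hF.chainsEquiv (F.sharp1 v) = oneChainsMap f (hF.chainsEquiv v) :=
  (hF.oneChainsMap_edgeClass v).symm

/-- The embedding of `H₁(G; ℝ)` into `S₀(Ω; ℝ)`. -/
def homologyOneToChains (hF : IsInducedBy f F π) : realHomology G 1 →ₗ[ℝ] (Ω →₀ ℝ) :=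
  (S1 Ω).subtype ∘ₗ hF.chainsEquiv.symm.toLinearMap ∘ₗ homologyOneInclusion G

theorem homologyOneToChains_injective (hF : IsInducedBy f F π) :
    Function.Injective hF.homologyOneToChains :=
  (S1 Ω).injective_subtype.comp
    (hF.chainsEquiv.symm.injective.comp (homologyOneInclusion_injective G))

/-- `H₁(G) ≅ S₁(Ω) ∩ ker π`. -/
theorem range_homologyOneToChains (hF : IsInducedBy f F π) :
    LinearMap.range hF.homologyOneToChains =
      S1 Ω ⊓ LinearMap.ker (Finsupp.lmapDomain ℝ ℝ π) := by
  ext v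
  constructor
  · rintro ⟨h, rfl⟩
    have hmem : homologyOneInclusion G h ∈ LinearMap.ker (boundaryMap G) :=
      range_homologyOneInclusion G ▸ LinearMap.mem_range_self _ h
    refine ⟨Subtype.coe_prop _, ?_⟩
    have := hF.boundaryMap_chainsEquiv (hF.chainsEquiv.symm (homologyOneInclusion G h))
    rw [LinearEquiv.apply_symm_apply, LinearMap.mem_ker.1 hmem] at this
    exact this.symm
  · rintro ⟨hv, hk⟩
    have hmem : hF.chainsEquiv ⟨v, hv⟩ ∈ LinearMap.range (homologyOneInclusion G) := by
      rw [range_homologyOneInclusion, LinearMap.mem_ker, boundaryMap_chainsEquiv]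
      exact hk
    obtain ⟨h, hh⟩ := hmem
    refine ⟨h, ?_⟩
    simp only [homologyOneToChains, LinearMap.comp_apply, hh, LinearEquiv.coe_coe,
      LinearEquiv.symm_apply_apply, Submodule.subtype_apply]

theorem homologyOneToChains_map (hF : IsInducedBy f F π) (α : Module.End ℝ (Ω →₀ ℝ))
    (hα : ∀ v : S1 Ω, α v = F.sharp1 v) (h : realHomology G 1) :
    hF.homologyOneToChains (realHomologyMap f 1 h) = α (hF.homologyOneToChains h) := by
  simp only [homologyOneToChains, LinearMap.comp_apply, LinearEquiv.coe_coe,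
    Submodule.subtype_apply]
  rw [hα, homologyOneInclusion_natural]
  congr 1
  rw [LinearEquiv.symm_apply_eq, chainsEquiv_sharp1, LinearEquiv.apply_symm_apply]

/-- The projection of `S₀(Ω; ℝ)` onto `H₀(G; ℝ)`. -/
def chainsToHomologyZero (G : Type u) [TopologicalSpace G] (π : Ω → G) :
    (Ω →₀ ℝ) →ₗ[ℝ] realHomology G 0 :=
  homologyZeroProjection G ∘ₗ Finsupp.lmapDomain ℝ ℝ π

omit [T2Space G] in
theorem lmapDomain_surjective (hF : IsInducedBy f F π) :
    Function.Surjective (Finsupp.lmapDomain ℝ ℝ π) :=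
  Finsupp.mapDomain_surjective hF.isBoundaryGluing.surjective

omit [T2Space G] in
theorem chainsToHomologyZero_surjective (hF : IsInducedBy f F π) :
    Function.Surjective (chainsToHomologyZero G π) :=
  (homologyZeroProjection_surjective G).comp hF.lmapDomain_surjective

/-- `H₀(G) ≅ S₀(Ω) / (S₁(Ω) + ker π)`. -/
theorem ker_chainsToHomologyZero (hF : IsInducedBy f F π) :
    LinearMap.ker (chainsToHomologyZero G π) =
      S1 Ω ⊔ LinearMap.ker (Finsupp.lmapDomain ℝ ℝ π) := by
  have hr : LinearMap.range (boundaryMap G) = (S1 Ω).map (Finsupp.lmapDomain ℝ ℝ π) := by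
    ext w
    constructor
    · rintro ⟨c, rfl⟩
      obtain ⟨v, rfl⟩ := hF.chainsEquiv.surjective c
      exact ⟨v, v.2, (hF.boundaryMap_chainsEquiv v).symm⟩
    · rintro ⟨v, hv, rfl⟩
      exact ⟨_, hF.boundaryMap_chainsEquiv ⟨v, hv⟩⟩
  rw [chainsToHomologyZero, LinearMap.ker_comp, ker_homologyZeroProjection, hr,
    Submodule.comap_map_eq]

omit [T2Space G] in
theorem chainsToHomologyZero_map (α : Module.End ℝ (Ω →₀ ℝ))
    (hα : ∀ v, Finsupp.lmapDomain ℝ ℝ π (α v) =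
      Finsupp.lmapDomain ℝ ℝ f (Finsupp.lmapDomain ℝ ℝ π v)) (v : Ω →₀ ℝ) :
    realHomologyMap f 0 (chainsToHomologyZero G π v) = chainsToHomologyZero G π (α v) := by
  simp only [chainsToHomologyZero, LinearMap.comp_apply]
  rw [homologyZeroProjection_natural, hα]

end IsInducedBy

end Induced

/-! ### Traces and exact sequences -/

section Traces

/-- Additivity of the trace in short exact sequences. -/
theorem trace_eq_add_of_exact {A B C : Type*} [AddCommGroup A] [Module ℝ A] [AddCommGroup B]
    [Module ℝ B] [AddCommGroup C] [Module ℝ C] [FiniteDimensional ℝ B]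
    {i : A →ₗ[ℝ] B} {q : B →ₗ[ℝ] C} (hi : Function.Injective i) (hq : Function.Surjective q)
    (hiq : LinearMap.range i = LinearMap.ker q) {a : Module.End ℝ A} {b : Module.End ℝ B}
    {c : Module.End ℝ C} (hia : i ∘ₗ a = b ∘ₗ i) (hqb : q ∘ₗ b = c ∘ₗ q) :
    LinearMap.trace ℝ B b = LinearMap.trace ℝ A a + LinearMap.trace ℝ C c := by
  have : FiniteDimensional ℝ A := FiniteDimensional.of_injective i hi
  have : FiniteDimensional ℝ C := Module.Finite.of_surjective q hq
  obtain ⟨t, ht⟩ := q.exists_rightInverse_of_surjective (LinearMap.range_eq_top.2 hq)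
  let e := LinearEquiv.ofInjective i hi
  have hqt : ∀ c, q (t c) = c := LinearMap.congr_fun ht
  have hmem : ∀ x, x - t (q x) ∈ LinearMap.range i := fun x => by
    rw [hiq, LinearMap.mem_ker, map_sub, hqt, sub_self]
  let r : B →ₗ[ℝ] A := e.symm.toLinearMap ∘ₗ
    (LinearMap.id - t ∘ₗ q).codRestrict (LinearMap.range i) hmem
  have hir : ∀ x, i (r x) = x - t (q x) := fun x =>
    congrArg Subtype.val (e.apply_symm_apply ⟨x - t (q x), hmem x⟩)
  have hri : ∀ x, r (i x) = x := fun x => hi <| by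
    have : q (i x) = 0 := by
      rw [← LinearMap.mem_ker, ← hiq]; exact LinearMap.mem_range_self i x
    rw [hir, this, map_zero, sub_zero]
  have hb : b = (i ∘ₗ a) ∘ₗ r + (b ∘ₗ t) ∘ₗ q := by
    ext x
    rw [hia]
    simp only [LinearMap.add_apply, LinearMap.comp_apply, hir, map_sub]
    abel
  have h1 : r ∘ₗ (i ∘ₗ a) = a := by
    ext x; exact hri _
  have h2 : q ∘ₗ (b ∘ₗ t) = c := by
    rw [← LinearMap.comp_assoc, hqb, LinearMap.comp_assoc, ht, LinearMap.comp_id]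
  conv_lhs => rw [hb]
  rw [map_add, LinearMap.trace_comp_comm', LinearMap.trace_comp_comm' q (b ∘ₗ t), h1, h2]

theorem comp_pow_eq {A B : Type*} [AddCommGroup A] [Module ℝ A] [AddCommGroup B] [Module ℝ B]
    {i : A →ₗ[ℝ] B} {a : Module.End ℝ A} {b : Module.End ℝ B} (h : i ∘ₗ a = b ∘ₗ i) (n : ℕ) :
    i ∘ₗ (a ^ n) = (b ^ n) ∘ₗ i :=
  (Module.End.commute_pow_left_of_commute h.symm n).symm

/-- The alternating sum of the traces of the powers of an endomorphism of a four-term exact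
sequence vanishes. -/
theorem trace_pow_sub_trace_pow_of_exact {H₁ A B H₀ : Type*} [AddCommGroup H₁] [Module ℝ H₁]
    [AddCommGroup A] [Module ℝ A] [AddCommGroup B] [Module ℝ B] [AddCommGroup H₀] [Module ℝ H₀]
    [FiniteDimensional ℝ A] [FiniteDimensional ℝ B]
    {i : H₁ →ₗ[ℝ] A} {j : A →ₗ[ℝ] B} {q : B →ₗ[ℝ] H₀}
    (hi : Function.Injective i) (hq : Function.Surjective q)
    (hij : LinearMap.range i = LinearMap.ker j) (hjq : LinearMap.range j = LinearMap.ker q)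
    {h₁ : Module.End ℝ H₁} {a : Module.End ℝ A} {b : Module.End ℝ B} {h₀ : Module.End ℝ H₀}
    (hia : i ∘ₗ h₁ = a ∘ₗ i) (hja : j ∘ₗ a = b ∘ₗ j) (hqb : q ∘ₗ b = h₀ ∘ₗ q) (n : ℕ) :
    LinearMap.trace ℝ H₀ (h₀ ^ n) - LinearMap.trace ℝ H₁ (h₁ ^ n) =
      LinearMap.trace ℝ B (b ^ n) - LinearMap.trace ℝ A (a ^ n) := by
  have hR : ∀ x ∈ LinearMap.range j, b x ∈ LinearMap.range j := by
    rintro _ ⟨x, rfl⟩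
    exact ⟨a x, LinearMap.congr_fun hja x⟩
  have e1 := trace_eq_add_of_exact (i := i) (q := j.rangeRestrict) (c := b.restrict hR ^ n) hi
    j.surjective_rangeRestrict (by rw [hij, LinearMap.ker_rangeRestrict])
    (comp_pow_eq hia n) (comp_pow_eq (LinearMap.ext fun x =>
      Subtype.ext (LinearMap.congr_fun hja x)) n)
  have e2 := trace_eq_add_of_exact (i := (LinearMap.range j).subtype) (q := q)
    (a := b.restrict hR ^ n) (Submodule.injective_subtype _) hq
    (by rw [Submodule.range_subtype, hjq])
    (comp_pow_eq (i := (LinearMap.range j).subtype) (a := b.restrict hR) (b := b)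
      (LinearMap.ext fun _ => rfl) n) (comp_pow_eq hqb n)
  linarith

theorem finiteDimensional_range_add {A B : Type*} [AddCommGroup A] [Module ℝ A] [AddCommGroup B]
    [Module ℝ B] (φ ψ : A →ₗ[ℝ] B) [FiniteDimensional ℝ (LinearMap.range φ)]
    [FiniteDimensional ℝ (LinearMap.range ψ)] :
    FiniteDimensional ℝ (LinearMap.range (φ + ψ)) := by
  refine Submodule.finiteDimensional_of_le (S₂ := LinearMap.range φ ⊔ LinearMap.range ψ) ?_
  rintro _ ⟨x, rfl⟩
  exact Submodule.add_mem_sup (LinearMap.mem_range_self φ x) (LinearMap.mem_range_self ψ x)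

theorem finiteDimensional_range_pow_sub_pow {V : Type*} [AddCommGroup V] [Module ℝ V]
    (A B : Module.End ℝ V) [FiniteDimensional ℝ (LinearMap.range (A - B))] (n : ℕ) :
    FiniteDimensional ℝ (LinearMap.range (A ^ n - B ^ n)) := by
  induction n with
  | zero =>
    rw [pow_zero, pow_zero, sub_self, LinearMap.range_zero]
    infer_instance
  | succ n ih =>
    have h : A ^ (n + 1) - B ^ (n + 1) = A ^ n * (A - B) + (A ^ n - B ^ n) * B := by
      rw [pow_succ, pow_succ]
      noncomm_ring
    have h1 : FiniteDimensional ℝ (LinearMap.range (A ^ n * (A - B))) := by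
      rw [Module.End.mul_eq_comp, LinearMap.range_comp]
      infer_instance
    have h2 : FiniteDimensional ℝ (LinearMap.range ((A ^ n - B ^ n) * B)) :=
      Submodule.finiteDimensional_of_le (LinearMap.range_comp_le_range B (A ^ n - B ^ n))
    rw [h]
    exact finiteDimensional_range_add _ _

/-- The trace of an endomorphism of finite rank of a space of formal combinations is the sum of
its diagonal entries. -/
theorem finiteRankTrace_eq_sum {X : Type*} (T : Module.End ℝ (X →₀ ℝ))
    [FiniteDimensional ℝ (LinearMap.range T)] :
    ∃ s : Finset X, (∀ x ∉ s, T (Finsupp.single x 1) x = 0) ∧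
      finiteRankTrace T = ∑ x ∈ s, T (Finsupp.single x 1) x := by
  classical
  have hfg : (LinearMap.range T).FG := Module.Finite.iff_fg.1 inferInstance
  obtain ⟨S, hS⟩ := hfg
  let s : Finset X := S.biUnion Finsupp.support
  have hle : LinearMap.range T ≤ Finsupp.supported ℝ ℝ (s : Set X) := by
    rw [← hS, Submodule.span_le]
    intro v hv x hx
    exact Finset.mem_coe.2 (Finset.mem_biUnion.2 ⟨v, hv, hx⟩)
  let e := Finsupp.supportedEquivFinsupp (M := ℝ) (R := ℝ) (s : Set X)
  have : FiniteDimensional ℝ (Finsupp.supported ℝ ℝ (s : Set X)) :=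
    Module.Finite.equiv e.symm
  refine ⟨s, fun x hx => ?_, ?_⟩
  · have := hle (LinearMap.mem_range_self T (Finsupp.single x 1))
    rw [Finsupp.mem_supported'] at this
    exact this x hx
  · rw [finiteRankTrace_eq T _ hle, LinearMap.trace_eq_matrix_trace ℝ (Module.Basis.ofRepr e),
      Matrix.trace, ← Finset.sum_coe_sort s]
    refine Finset.sum_congr rfl fun x _ => ?_
    rw [Matrix.diag_apply, LinearMap.toMatrix_apply]
    have he : ∀ v y, e v y = (v : X →₀ ℝ) y := fun _ _ => rfl
    have hx : e.symm (Finsupp.single x 1) =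
        ⟨Finsupp.single (x : X) 1, Finsupp.single_mem_supported ℝ 1 x.2⟩ := by
      rw [LinearEquiv.symm_apply_eq]
      ext y
      rw [he, Finsupp.single_apply, Finsupp.single_apply]
      simp only [Subtype.ext_iff]
    change e (T.restrict _ (e.symm (Finsupp.single x 1))) x = _
    rw [hx, he]
    rfl

end Traces

/-! ### Trace formula -/

section TraceFormula

universe u

variable {Ω : IntervalUnion} {G : Type u} [TopologicalSpace G]

open IntervalUnion

theorem S1_eq_ker (Ω : IntervalUnion) :
    S1 Ω = LinearMap.ker (Finsupp.lmapDomain ℝ ℝ Ω.index) :=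
  Submodule.ext fun _ => mem_S1_iff

/-- The quotient of `S₀(Ω; ℝ)` by `S₁(Ω; ℝ)` has the components of `Ω` as a basis. -/
def quotientEquiv (Ω : IntervalUnion) : ((Ω →₀ ℝ) ⧸ S1 Ω) ≃ₗ[ℝ] (Fin Ω.m →₀ ℝ) :=
  (Submodule.quotEquivOfEq _ _ (S1_eq_ker Ω)).trans
    (LinearMap.quotKerEquivOfSurjective _
      (Finsupp.mapDomain_surjective fun i => ⟨left i, index_left i⟩))

theorem quotientEquiv_mk (v : Ω →₀ ℝ) :
    quotientEquiv Ω (Submodule.Quotient.mk v) = Finsupp.lmapDomain ℝ ℝ Ω.index v := rfl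

instance : FiniteDimensional ℝ ((Ω →₀ ℝ) ⧸ S1 Ω) := Module.Finite.equiv (quotientEquiv Ω).symm

instance (V : Type*) [AddCommGroup V] [Module ℝ V] :
    FiniteDimensional ℝ (V ⧸ (⊤ : Submodule ℝ V)) := by
  have : Subsingleton (V ⧸ (⊤ : Submodule ℝ V)) := Submodule.Quotient.subsingleton_iff.2 rfl
  infer_instance

namespace PMMap

variable (F : PMMap Ω)

theorem sharp0_single_of_notMem {x : Ω} (hx : x ∉ F.C) :
    F.sharp0 (Finsupp.single x 1) = Finsupp.single (F.toFun ⟨x, hx⟩) 1 := by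
  simp [sharp0, hx]

theorem sharp0_single_of_mem {x : Ω} (hx : x ∈ F.C) : F.sharp0 (Finsupp.single x 1) = 0 := by
  simp [sharp0, hx]

end PMMap

namespace IsInducedBy

variable {f : C(G, G)} {F : PMMap Ω} {π : Ω → G}

/-- A set-theoretic section of `π`. -/
def lift (hF : IsInducedBy f F π) : G → Ω := Function.surjInv hF.isBoundaryGluing.surjective

theorem π_lift (hF : IsInducedBy f F π) (p : G) : π (hF.lift p) = p :=
  Function.surjInv_eq hF.isBoundaryGluing.surjective p

theorem eq_of_notMem_boundary (hF : IsInducedBy f F π) {x y : Ω} (hx : x ∉ Ω.boundary)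
    (h : π x = π y) : x = y :=
  (hF.isBoundaryGluing.eq_or_mem x y h).resolve_right fun h' => hx h'.1

theorem notMem_image (hF : IsInducedBy f F π) {x : Ω} (hx : x ∉ F.C) : π x ∉ π '' F.C := by
  rintro ⟨c, hc, h⟩
  have := hF.eq_of_notMem_boundary (fun hb => hx (F.boundary_subset hb)) h.symm
  exact hx (this ▸ hc)

/-- The map `f`, transported to `Ω` by means of the section of `π`. -/
def transport (hF : IsInducedBy f F π) : Module.End ℝ (Ω →₀ ℝ) :=
  Finsupp.lmapDomain ℝ ℝ fun x => hF.lift (f (π x))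

theorem lmapDomain_transport (hF : IsInducedBy f F π) (v : Ω →₀ ℝ) :
    Finsupp.lmapDomain ℝ ℝ π (hF.transport v) =
      Finsupp.lmapDomain ℝ ℝ f (Finsupp.lmapDomain ℝ ℝ π v) := by
  rw [transport, ← LinearMap.comp_apply, ← LinearMap.comp_apply, ← Finsupp.lmapDomain_comp,
    ← Finsupp.lmapDomain_comp]
  congr 2
  ext x
  exact hF.π_lift _

theorem transport_of_mem_ker (hF : IsInducedBy f F π) {v : Ω →₀ ℝ}
    (hv : v ∈ LinearMap.ker (Finsupp.lmapDomain ℝ ℝ π)) : hF.transport v = 0 := by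
  have : (fun x => hF.lift (f (π x))) = (hF.lift ∘ f) ∘ π := rfl
  rw [transport, this, Finsupp.lmapDomain_comp, LinearMap.comp_apply, LinearMap.mem_ker.1 hv,
    map_zero]

/-- Powers of the transported map follow the orbits of `f`. -/
theorem transport_pow_single (hF : IsInducedBy f F π) (n : ℕ) (x : Ω) :
    (hF.transport ^ (n + 1)) (Finsupp.single x 1) =
      Finsupp.single (hF.lift (f^[n + 1] (π x))) 1 := by
  induction n with
  | zero => simp [transport]
  | succ n ih =>
    rw [pow_succ', Module.End.mul_apply, ih, transport, Finsupp.lmapDomain_apply,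
      Finsupp.mapDomain_single, hF.π_lift, ← Function.iterate_succ_apply' f]

/-- Powers of `F_{#0}` follow an orbit of `F` until it hits `C`. -/
theorem sharp0_pow_single (hF : IsInducedBy f F π) (n : ℕ) (x : Ω) :
    ((F.sharp0 ^ n) (Finsupp.single x 1) = 0 ∧ ∃ k < n, f^[k] (π x) ∈ π '' F.C) ∨
    ∃ y, (F.sharp0 ^ n) (Finsupp.single x 1) = Finsupp.single y 1 ∧ π y = f^[n] (π x) ∧
      ∀ k < n, f^[k] (π x) ∉ π '' F.C := by
  induction n with
  | zero => exact Or.inr ⟨x, by simp, rfl, fun k hk => absurd hk (Nat.not_lt_zero k)⟩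
  | succ n ih =>
    rw [pow_succ', Module.End.mul_apply]
    rcases ih with ⟨h0, k, hk, hkC⟩ | ⟨y, hy, hπ, hC⟩
    · exact Or.inl ⟨by rw [h0, map_zero], k, hk.trans n.lt_succ_self, hkC⟩
    · rw [hy]
      by_cases hyC : y ∈ F.C
      · exact Or.inl ⟨F.sharp0_single_of_mem hyC, n, n.lt_succ_self, hπ ▸ mem_image_of_mem π hyC⟩
      · refine Or.inr ⟨_, F.sharp0_single_of_notMem hyC, ?_, fun k hk => ?_⟩
        · rw [Function.iterate_succ_apply', ← hπ]
          exact hF.comm ⟨y, hyC⟩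
        · rcases Nat.lt_succ_iff_lt_or_eq.1 hk with h | rfl
          · exact hC k h
          · exact hπ ▸ hF.notMem_image hyC

open Classical in
/-- Away from `C` the maps `F_{#0}` and `transport` follow the same orbit, so that only periodic
points whose orbit meets `π(C)` contribute to the diagonal of the difference of their powers. -/
theorem diagonal_entry (hF : IsInducedBy f F π) (n : ℕ) (x : Ω) :
    (hF.transport ^ (n + 1) - F.sharp0 ^ (n + 1)) (Finsupp.single x 1) x =
      if hF.lift (f^[n + 1] (π x)) = x ∧ ∃ k < n + 1, f^[k] (π x) ∈ π '' F.C then 1 else 0 := by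
  rw [LinearMap.sub_apply, Finsupp.sub_apply, hF.transport_pow_single, Finsupp.single_apply]
  have hb : π x ∉ π '' F.C → x ∉ Ω.boundary := fun h hx => h ⟨x, F.boundary_subset hx, rfl⟩
  rcases hF.sharp0_pow_single (n + 1) x with ⟨h0, hk⟩ | ⟨y, hy, hπ, hC⟩
  · simp only [h0, hk, and_true, Finsupp.zero_apply, sub_zero]
  · have hx := hb (hC 0 n.succ_pos)
    have hno : ¬ ∃ k < n + 1, f^[k] (π x) ∈ π '' F.C := fun ⟨k, hk, h⟩ => hC k hk h
    have hiff : hF.lift (f^[n + 1] (π x)) = x ↔ y = x := by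
      constructor
      · intro h
        refine (hF.eq_of_notMem_boundary hx ?_).symm
        rw [hπ, ← hF.π_lift (f^[n + 1] (π x)), h]
      · rintro rfl
        refine (hF.eq_of_notMem_boundary hx ?_).symm
        rw [hF.π_lift, ← hπ]
    rw [hy, Finsupp.single_apply]
    simp only [hno, and_false, if_false, hiff, sub_self]

/-- A periodic point has an orbit meeting `S` exactly if the orbit meets `S` within one period. -/
theorem mem_periodicOrbitsMeeting_iff {X : Type*} {f : X → X} {S : Set X} {n : ℕ} {p : X}
    (hp : f^[n + 1] p = p) :
    p ∈ periodicOrbitsMeeting f S ↔ ∃ k < n + 1, f^[k] p ∈ S := by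
  constructor
  · rintro ⟨o, ⟨x, ⟨N, hN, hx⟩, rfl, ⟨_, ⟨l, rfl⟩, hl⟩⟩, ⟨j, rfl⟩⟩
    have hback : f^[l] x = f^[l + (j * N - j)] (f^[j] x) := by
      rw [← Function.iterate_add_apply, add_assoc,
        Nat.sub_add_cancel (Nat.le_mul_of_pos_right j hN),
        Function.iterate_add_apply]
      congr 1
      exact ((hx.const_mul j).eq).symm
    refine ⟨(l + (j * N - j)) % (n + 1), Nat.mod_lt _ n.succ_pos, ?_⟩
    have : Function.IsPeriodicPt f (n + 1) (f^[j] x) := hp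
    rw [this.iterate_mod_apply]
    simp only at hl
    rwa [hback] at hl
  · rintro ⟨k, -, hk⟩
    exact ⟨_, ⟨p, ⟨n + 1, n.succ_pos, hp⟩, rfl, ⟨_, ⟨k, rfl⟩, hk⟩⟩, ⟨0, rfl⟩⟩

theorem finite_periodicOrbitsMeeting {X : Type*} {f : X → X} {S : Set X} (hS : S.Finite) :
    (periodicOrbitsMeeting f S).Finite := by
  have hfin : ∀ c ∈ Function.periodicPts f, (range fun n => f^[n] c).Finite := by
    rintro c ⟨N, hN, hc⟩
    refine ((finite_Iio N).image fun n => f^[n] c).subset ?_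
    rintro _ ⟨n, rfl⟩
    exact ⟨n % N, Nat.mod_lt _ hN, hc.iterate_mod_apply n⟩
  have := (hS.inter_of_left (Function.periodicPts f)).biUnion fun c hc => hfin c hc.2
  refine this.subset ?_
  rintro _ ⟨o, ⟨x, ⟨N, hN, hx⟩, rfl, ⟨_, ⟨l, rfl⟩, hl⟩⟩, ⟨j, rfl⟩⟩
  refine mem_biUnion (x := f^[l] x) ⟨hl, N, hN, hx.apply_iterate l⟩ ⟨j + (l * N - l), ?_⟩
  simp only
  rw [← Function.iterate_add_apply, add_assoc, Nat.sub_add_cancel (Nat.le_mul_of_pos_right l hN),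
    Function.iterate_add_apply]
  congr 1
  exact (hx.const_mul l).eq

theorem finiteDimensional_ker (hF : IsInducedBy f F π) :
    FiniteDimensional ℝ (LinearMap.ker (Finsupp.lmapDomain ℝ ℝ π)) := by
  have hle : LinearMap.ker (Finsupp.lmapDomain ℝ ℝ π) ≤ Finsupp.supported ℝ ℝ Ω.boundary := by
    intro v hv
    rw [Finsupp.mem_supported']
    exact fun x hx => hF.isBoundaryGluing.apply_eq_zero_of_mem_ker hv hx
  have := (finite_boundary (Ω := Ω)).to_subtype
  have : FiniteDimensional ℝ (Finsupp.supported ℝ ℝ Ω.boundary) :=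
    Module.Finite.equiv (Finsupp.supportedEquivFinsupp (M := ℝ) (R := ℝ) Ω.boundary).symm
  exact Submodule.finiteDimensional_of_le hle

theorem finiteDimensional_range_transport_sub (hF : IsInducedBy f F π) :
    FiniteDimensional ℝ (LinearMap.range (hF.transport - F.sharp0)) := by
  have := hF.finiteDimensional_ker
  let W := Submodule.span ℝ ((fun x => hF.transport (Finsupp.single x 1)) '' F.C)
  have : FiniteDimensional ℝ W := FiniteDimensional.span_of_finite ℝ (F.finite_C.image _)
  refine Submodule.finiteDimensional_of_le
    (S₂ := LinearMap.ker (Finsupp.lmapDomain ℝ ℝ π) ⊔ W) ?_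
  rintro _ ⟨v, rfl⟩
  induction v using Finsupp.induction_linear with
  | zero => rw [map_zero]; exact Submodule.zero_mem _
  | add u w hu hw => rw [map_add]; exact Submodule.add_mem _ hu hw
  | single x r =>
    rw [← Finsupp.smul_single_one, map_smul]
    refine Submodule.smul_mem _ _ ?_
    rw [LinearMap.sub_apply]
    by_cases hx : x ∈ F.C
    · rw [F.sharp0_single_of_mem hx, sub_zero]
      exact Submodule.mem_sup_right (Submodule.subset_span ⟨x, hx, rfl⟩)
    · refine Submodule.mem_sup_left ?_
      rw [LinearMap.mem_ker, map_sub, hF.lmapDomain_transport, F.sharp0_single_of_notMem hx]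
      simp only [Finsupp.lmapDomain_apply, Finsupp.mapDomain_single]
      rw [hF.comm ⟨x, hx⟩, sub_self]

/-- An extension of `F_{#1}` to `S₀(Ω; ℝ)` which covers `f`. -/
def extension (hF : IsInducedBy f F π) : Module.End ℝ (Ω →₀ ℝ) :=
  (S1 Ω).subtype ∘ₗ F.sharp1 ∘ₗ
      (LinearMap.id - Finsupp.lmapDomain ℝ ℝ base).codRestrict (S1 Ω) sub_lmapDomain_base_mem_S1 +
    hF.transport ∘ₗ Finsupp.lmapDomain ℝ ℝ base

theorem extension_coe (hF : IsInducedBy f F π) (v : S1 Ω) :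
    hF.extension v = F.sharp1 v := by
  have h0 := lmapDomain_base_of_mem_S1 v.2
  have h1 : (LinearMap.id - Finsupp.lmapDomain ℝ ℝ base).codRestrict (S1 Ω)
      sub_lmapDomain_base_mem_S1 (v : Ω →₀ ℝ) = v := by
    apply Subtype.ext
    simp only [LinearMap.codRestrict_apply, LinearMap.sub_apply, h0, LinearMap.id_apply, sub_zero]
  simp only [extension, LinearMap.add_apply, LinearMap.comp_apply, h1, h0, map_zero, add_zero,
    Submodule.subtype_apply]

/-- The extension covers `f`: on `S₁` because `F_{#1}` is the action of `f` on `1`-chains, and on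
the left endpoints by the choice of `transport`. -/
theorem lmapDomain_extension [T2Space G] (hF : IsInducedBy f F π) (v : Ω →₀ ℝ) :
    Finsupp.lmapDomain ℝ ℝ π (hF.extension v) =
      Finsupp.lmapDomain ℝ ℝ f (Finsupp.lmapDomain ℝ ℝ π v) := by
  have key : ∀ u : S1 Ω, Finsupp.lmapDomain ℝ ℝ π (F.sharp1 u : Ω →₀ ℝ) =
      Finsupp.lmapDomain ℝ ℝ f (Finsupp.lmapDomain ℝ ℝ π u) := fun u => by
    rw [← hF.boundaryMap_chainsEquiv, hF.chainsEquiv_sharp1, boundaryMap_natural,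
      hF.boundaryMap_chainsEquiv]
  simp only [extension, LinearMap.add_apply, LinearMap.comp_apply, map_add,
    Submodule.subtype_apply]
  rw [key, lmapDomain_transport, ← map_add, ← map_add]
  simp

end IsInducedBy

end TraceFormula

section TraceIdentity

universe u

variable {Ω : IntervalUnion} {G : Type u} [TopologicalSpace G]

open IntervalUnion

namespace IsInducedBy

variable {f : C(G, G)} {F : PMMap Ω} {π : Ω → G} [T2Space G]

theorem extension_mem_ker (hF : IsInducedBy f F π) :
    ∀ v ∈ LinearMap.ker (Finsupp.lmapDomain ℝ ℝ π),
      hF.extension v ∈ LinearMap.ker (Finsupp.lmapDomain ℝ ℝ π) := fun v hv => by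
  rw [LinearMap.mem_ker, hF.lmapDomain_extension, LinearMap.mem_ker.1 hv, map_zero]

/-- The action on the kernel of `π`. -/
def kernelMap (hF : IsInducedBy f F π) :
    Module.End ℝ (LinearMap.ker (Finsupp.lmapDomain ℝ ℝ π)) :=
  hF.extension.restrict hF.extension_mem_ker

omit [T2Space G] in
theorem S1_le_comap_extension (hF : IsInducedBy f F π) : S1 Ω ≤ (S1 Ω).comap hF.extension :=
  fun v hv => by
    have := hF.extension_coe ⟨v, hv⟩
    simp only at this
    rw [Submodule.mem_comap, this]
    exact (F.sharp1 ⟨v, hv⟩).2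

/-- The action on the components of `Ω`. -/
def quotientMap (hF : IsInducedBy f F π) : Module.End ℝ ((Ω →₀ ℝ) ⧸ S1 Ω) :=
  (S1 Ω).mapQ (S1 Ω) hF.extension hF.S1_le_comap_extension

theorem finite_homologyOne (hF : IsInducedBy f F π) : Module.Finite ℝ (realHomology G 1) := by
  have := hF.finiteDimensional_ker
  have hmem : ∀ h, hF.homologyOneToChains h ∈ LinearMap.ker (Finsupp.lmapDomain ℝ ℝ π) := fun h =>
    (hF.range_homologyOneToChains.le ⟨h, rfl⟩).2
  let i : realHomology G 1 →ₗ[ℝ] LinearMap.ker (Finsupp.lmapDomain ℝ ℝ π) :=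
    hF.homologyOneToChains.codRestrict _ hmem
  refine FiniteDimensional.of_injective (V₂ := LinearMap.ker (Finsupp.lmapDomain ℝ ℝ π)) i
    fun x y h => ?_
  have h' : hF.homologyOneToChains x = hF.homologyOneToChains y :=
    congrArg (LinearMap.ker (Finsupp.lmapDomain ℝ ℝ π)).subtype h
  exact hF.homologyOneToChains_injective h'

theorem finite_homologyZero (hF : IsInducedBy f F π) : Module.Finite ℝ (realHomology G 0) := by
  have hle : S1 Ω ≤ LinearMap.ker (chainsToHomologyZero G π) :=
    le_sup_left.trans hF.ker_chainsToHomologyZero.ge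
  refine Module.Finite.of_surjective ((S1 Ω).liftQ (chainsToHomologyZero G π) hle) ?_
  intro h
  obtain ⟨v, rfl⟩ := hF.chainsToHomologyZero_surjective h
  exact ⟨Submodule.Quotient.mk v, rfl⟩

/-- The Lefschetz numbers of the iterates of `f`, computed from the exact sequence
`0 → H₁(G) → ker π → S₀(Ω) / S₁(Ω) → H₀(G) → 0`. -/
theorem lefschetz_eq (hF : IsInducedBy f F π) (n : ℕ) :
    LinearMap.trace ℝ (realHomology G 0) (realHomologyMap f 0 ^ n) -
        LinearMap.trace ℝ (realHomology G 1) (realHomologyMap f 1 ^ n) =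
      LinearMap.trace ℝ _ (hF.quotientMap ^ n) - LinearMap.trace ℝ _ (hF.kernelMap ^ n) := by
  have := hF.finiteDimensional_ker
  have hmem : ∀ h, hF.homologyOneToChains h ∈ LinearMap.ker (Finsupp.lmapDomain ℝ ℝ π) := fun h =>
    (hF.range_homologyOneToChains.le ⟨h, rfl⟩).2
  have hle : S1 Ω ≤ LinearMap.ker (chainsToHomologyZero G π) :=
    le_sup_left.trans hF.ker_chainsToHomologyZero.ge
  let i : realHomology G 1 →ₗ[ℝ] LinearMap.ker (Finsupp.lmapDomain ℝ ℝ π) :=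
    hF.homologyOneToChains.codRestrict _ hmem
  let j : LinearMap.ker (Finsupp.lmapDomain ℝ ℝ π) →ₗ[ℝ] ((Ω →₀ ℝ) ⧸ S1 Ω) :=
    (S1 Ω).mkQ ∘ₗ (LinearMap.ker (Finsupp.lmapDomain ℝ ℝ π)).subtype
  let q : ((Ω →₀ ℝ) ⧸ S1 Ω) →ₗ[ℝ] realHomology G 0 := (S1 Ω).liftQ (chainsToHomologyZero G π) hle
  have hq : Function.Surjective q := fun h => by
    obtain ⟨v, rfl⟩ := hF.chainsToHomologyZero_surjective h
    exact ⟨Submodule.Quotient.mk v, rfl⟩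
  have hi : Function.Injective i := fun x y h => by
    have h' : hF.homologyOneToChains x = hF.homologyOneToChains y :=
      congrArg (LinearMap.ker (Finsupp.lmapDomain ℝ ℝ π)).subtype h
    exact hF.homologyOneToChains_injective h'
  have hj : j ∘ₗ hF.kernelMap = hF.quotientMap ∘ₗ j := by
    ext k
    rfl
  have hi' : i ∘ₗ realHomologyMap f 1 = hF.kernelMap ∘ₗ i := by
    refine LinearMap.ext fun h => Subtype.ext ?_
    exact hF.homologyOneToChains_map _ hF.extension_coe h
  have hq' : q ∘ₗ hF.quotientMap = realHomologyMap f 0 ∘ₗ q := by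
    refine Submodule.linearMap_qext _ (LinearMap.ext fun v => ?_)
    exact (chainsToHomologyZero_map _ hF.lmapDomain_extension v).symm
  refine trace_pow_sub_trace_pow_of_exact (H₁ := realHomology G 1) (H₀ := realHomology G 0)
    (A := LinearMap.ker (Finsupp.lmapDomain ℝ ℝ π)) (B := (Ω →₀ ℝ) ⧸ S1 Ω) (i := i)
    (j := j) (q := q) hi hq ?_ ?_ hi' hj hq' n
  · ext ⟨v, hv⟩
    have h1 : (⟨v, hv⟩ : LinearMap.ker (Finsupp.lmapDomain ℝ ℝ π)) ∈ LinearMap.ker j ↔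
        v ∈ S1 Ω := Submodule.Quotient.mk_eq_zero (S1 Ω)
    have h2 : (⟨v, hv⟩ : LinearMap.ker (Finsupp.lmapDomain ℝ ℝ π)) ∈ LinearMap.range i ↔
        v ∈ LinearMap.range hF.homologyOneToChains := by
      constructor
      · rintro ⟨h, hh⟩; exact ⟨h, congrArg Subtype.val hh⟩
      · rintro ⟨h, hh⟩; exact ⟨h, Subtype.ext hh⟩
    rw [h1, h2, hF.range_homologyOneToChains]
    exact ⟨fun h => h.1, fun h => ⟨h, hv⟩⟩
  · ext x
    obtain ⟨v, rfl⟩ := Submodule.Quotient.mk_surjective _ x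
    have h1 : Submodule.Quotient.mk v ∈ LinearMap.ker q ↔
        v ∈ LinearMap.ker (chainsToHomologyZero G π) := Iff.rfl
    rw [h1, hF.ker_chainsToHomologyZero, Submodule.mem_sup]
    constructor
    · rintro ⟨⟨k, hk⟩, h⟩
      have hs : v - k ∈ S1 Ω := (Submodule.Quotient.eq _).1 h.symm
      exact ⟨v - k, hs, k, hk, sub_add_cancel _ _⟩
    · rintro ⟨u, hu, k, hk, rfl⟩
      refine ⟨⟨k, hk⟩, ((Submodule.Quotient.eq _).2 ?_).symm⟩
      rwa [Submodule.subtype_apply, add_sub_cancel_right]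

theorem finiteDimensional_range_extension_sub (hF : IsInducedBy f F π) :
    FiniteDimensional ℝ (LinearMap.range (hF.extension - hF.transport)) := by
  have := hF.finiteDimensional_ker
  refine Submodule.finiteDimensional_of_le
    (S₂ := LinearMap.ker (Finsupp.lmapDomain ℝ ℝ π)) ?_
  rintro _ ⟨v, rfl⟩
  rw [LinearMap.mem_ker, LinearMap.sub_apply, map_sub, hF.lmapDomain_extension,
    hF.lmapDomain_transport, sub_self]

/-- The powers of `extension` and `transport` both cover the powers of `f`, so that their difference
maps to `ker π`; there `transport` is zero. -/
theorem finiteRankTrace_extension_sub (hF : IsInducedBy f F π) (n : ℕ) :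
    finiteRankTrace (hF.extension ^ (n + 1) - hF.transport ^ (n + 1)) =
      LinearMap.trace ℝ _ (hF.kernelMap ^ (n + 1)) := by
  have := hF.finiteDimensional_ker
  have hp : ∀ α : Module.End ℝ (Ω →₀ ℝ), (∀ v, Finsupp.lmapDomain ℝ ℝ π (α v) =
      Finsupp.lmapDomain ℝ ℝ f (Finsupp.lmapDomain ℝ ℝ π v)) → ∀ v,
      Finsupp.lmapDomain ℝ ℝ π ((α ^ (n + 1)) v) =
      (Finsupp.lmapDomain ℝ ℝ f ^ (n + 1)) (Finsupp.lmapDomain ℝ ℝ π v) := fun α hα v =>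
    LinearMap.congr_fun (comp_pow_eq (i := Finsupp.lmapDomain ℝ ℝ π) (a := α)
      (b := Finsupp.lmapDomain ℝ ℝ f) (LinearMap.ext hα) (n + 1)) v
  have hle : LinearMap.range (hF.extension ^ (n + 1) - hF.transport ^ (n + 1)) ≤
      LinearMap.ker (Finsupp.lmapDomain ℝ ℝ π) := by
    rintro _ ⟨v, rfl⟩
    rw [LinearMap.mem_ker, LinearMap.sub_apply, map_sub, hp _ hF.lmapDomain_extension,
      hp _ hF.lmapDomain_transport, sub_self]
  rw [finiteRankTrace_eq _ _ hle]
  congr 1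
  ext1 v
  apply Subtype.ext
  have h1 : ((hF.kernelMap ^ (n + 1)) v : Ω →₀ ℝ) = (hF.extension ^ (n + 1)) v :=
    LinearMap.congr_fun (comp_pow_eq (i := (LinearMap.ker (Finsupp.lmapDomain ℝ ℝ π)).subtype)
      (a := hF.kernelMap) (b := hF.extension) (by ext; rfl) (n + 1)) v
  rw [h1, LinearMap.coe_restrict_apply, LinearMap.sub_apply, pow_succ hF.transport,
    Module.End.mul_apply, hF.transport_of_mem_ker v.2, map_zero, sub_zero]

omit [T2Space G] in
/-- The section `lift` identifies the diagonal entries equal to `1` with the points of `P` fixed by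
`f^[n + 1]`. -/
theorem finiteRankTrace_transport_sub (hF : IsInducedBy f F π) (n : ℕ) :
    finiteRankTrace (hF.transport ^ (n + 1) - F.sharp0 ^ (n + 1)) =
      (periodicOrbitsMeeting f (π '' F.C) ∩ Function.fixedPoints (f^[n + 1])).ncard := by
  classical
  have := hF.finiteDimensional_range_transport_sub
  have := finiteDimensional_range_pow_sub_pow hF.transport F.sharp0 (n + 1)
  obtain ⟨s, hs, ht⟩ := finiteRankTrace_eq_sum (hF.transport ^ (n + 1) - F.sharp0 ^ (n + 1))
  simp only [hF.diagonal_entry] at hs ht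
  have himage : hF.lift '' (periodicOrbitsMeeting f (π '' F.C) ∩
      Function.fixedPoints (f^[n + 1])) = ((s.filter fun x =>
        hF.lift (f^[n + 1] (π x)) = x ∧ ∃ k < n + 1, f^[k] (π x) ∈ π '' F.C : Finset Ω) :
        Set Ω) := by
    ext x
    rw [Finset.mem_coe, Finset.mem_filter]
    constructor
    · rintro ⟨p, ⟨hp, hfix⟩, rfl⟩
      have hfix' : f^[n + 1] p = p := hfix
      have hk := (mem_periodicOrbitsMeeting_iff hfix').1 hp
      have hcond : hF.lift (f^[n + 1] (π (hF.lift p))) = hF.lift p ∧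
          ∃ k < n + 1, f^[k] (π (hF.lift p)) ∈ π '' F.C := by
        rw [hF.π_lift, hfix']
        exact ⟨rfl, hk⟩
      refine ⟨?_, hcond⟩
      by_contra hns
      have := hs _ hns
      rw [if_pos hcond] at this
      exact one_ne_zero this
    · rintro ⟨-, hx, hk⟩
      have hfix : f^[n + 1] (π x) = π x := by
        conv_rhs => rw [← hx, hF.π_lift]
      refine ⟨π x, ⟨(mem_periodicOrbitsMeeting_iff hfix).2 hk, hfix⟩, ?_⟩
      rw [hfix] at hx
      exact hx
  have hinj : Function.Injective hF.lift := Function.injective_surjInv _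
  rw [ht, ← ncard_image_of_injective _ hinj, himage, Finset.sum_ite, Finset.sum_const_zero,
    add_zero, Finset.sum_const, nsmul_eq_mul, mul_one, ncard_coe_finset]

/-- Powers of the pair `(F_{#0}, F_{#1})`, extended by powers of the extension of `F_{#1}`. -/
def pairExtension (hF : IsInducedBy f F π) (n : ℕ) :
    PairExtension (F.sharp0Top ^ n) (F.sharp1 ^ n) where
  ext₀ := F.sharp0 ^ n
  ext₁ := hF.extension ^ n
  extends₀ v := (LinearMap.congr_fun (comp_pow_eq (i := (⊤ : Submodule ℝ (Ω →₀ ℝ)).subtype)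
      (a := F.sharp0Top) (b := F.sharp0) (by ext1; rfl) n) v).symm
  extends₁ v := (LinearMap.congr_fun (comp_pow_eq (i := (S1 Ω).subtype)
      (a := F.sharp1) (b := hF.extension)
      (LinearMap.ext fun v => (hF.extension_coe v).symm) n) v).symm
  finite_rank := by
    have := hF.finiteDimensional_range_transport_sub
    have := hF.finiteDimensional_range_extension_sub
    have h := finiteDimensional_range_add (hF.extension - hF.transport) (hF.transport - F.sharp0)
    have e : hF.extension - hF.transport + (hF.transport - F.sharp0) = hF.extension - F.sharp0 := by
      abel
    rw [e] at h
    exact finiteDimensional_range_pow_sub_pow _ _ n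

theorem pairFiniteRank (hF : IsInducedBy f F π) (n : ℕ) :
    PairFiniteRank (F.sharp0Top ^ n) (F.sharp1 ^ n) :=
  ⟨inferInstance, inferInstance, ⟨hF.pairExtension n⟩⟩

/-- The trace of the pair counts, up to sign, the Lefschetz number without the contribution of
the periodic orbits through `π(C)`. -/
theorem neg_pairTrace_add_ncard (hF : IsInducedBy f F π) (n : ℕ) :
    -pairTrace (F.sharp0Top ^ (n + 1)) (F.sharp1 ^ (n + 1)) +
      (periodicOrbitsMeeting f (π '' F.C) ∩ Function.fixedPoints (f^[n + 1])).ncard =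
      LinearMap.trace ℝ _ (hF.quotientMap ^ (n + 1)) -
        LinearMap.trace ℝ _ (hF.kernelMap ^ (n + 1)) := by
  have := hF.finiteDimensional_range_transport_sub
  have := hF.finiteDimensional_range_extension_sub
  have i1 := finiteDimensional_range_pow_sub_pow hF.transport F.sharp0 (n + 1)
  have i2 := finiteDimensional_range_pow_sub_pow hF.extension hF.transport (n + 1)
  have hadd := finiteRankTrace_add (hF.extension ^ (n + 1) - hF.transport ^ (n + 1))
    (hF.transport ^ (n + 1) - F.sharp0 ^ (n + 1))
  have e : hF.extension ^ (n + 1) - hF.transport ^ (n + 1) +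
      (hF.transport ^ (n + 1) - F.sharp0 ^ (n + 1)) =
      hF.extension ^ (n + 1) - F.sharp0 ^ (n + 1) := by
    abel
  rw [e, hF.finiteRankTrace_extension_sub, hF.finiteRankTrace_transport_sub] at hadd
  have hsub : Subsingleton ((Ω →₀ ℝ) ⧸ (⊤ : Submodule ℝ (Ω →₀ ℝ))) :=
    Submodule.Quotient.subsingleton_iff.2 rfl
  have h0 : ∀ T : Module.End ℝ ((Ω →₀ ℝ) ⧸ (⊤ : Submodule ℝ (Ω →₀ ℝ))),
      LinearMap.trace ℝ _ T = 0 := fun T => by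
    rw [Subsingleton.elim T 0, map_zero]
  have hQ : (S1 Ω).mapQ (S1 Ω) (hF.extension ^ (n + 1)) (hF.pairExtension (n + 1)).le_comap₁ =
      hF.quotientMap ^ (n + 1) := Submodule.mapQ_pow _ _ _ _
  rw [pairTrace_eq (hF.pairExtension (n + 1)), PairExtension.trace, h0]
  simp only [pairExtension]
  rw [hadd, hQ]
  ring

end IsInducedBy

end TraceIdentity

/-! ### Exponential power series and integrality -/

section ExpSeries

open PowerSeries

theorem hasSubst_expSeries (a : ℕ → ℝ) :
    HasSubst (PowerSeries.mk fun n => if n = 0 then 0 else a n / n : PowerSeries ℝ) :=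
  HasSubst.of_constantCoeff_zero' (by
    rw [← coeff_zero_eq_constantCoeff_apply, coeff_mk, if_pos rfl])

theorem constantCoeff_expSeries (a : ℕ → ℝ) : constantCoeff (expSeries a) = 1 := by
  have h0 : constantCoeff (PowerSeries.mk fun n => if n = 0 then 0 else a n / n : PowerSeries ℝ) =
      0 := by rw [← coeff_zero_eq_constantCoeff_apply, coeff_mk, if_pos rfl]
  have h1 : exp ℝ = C 1 + (exp ℝ - C 1) := by ring
  have h2 : constantCoeff (subst (PowerSeries.mk fun n => if n = 0 then 0 else a n / n :
      PowerSeries ℝ) (exp ℝ - C 1)) = 0 := constantCoeff_subst_eq_zero h0 _ (by simp)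
  rw [expSeries, h1, subst_add (hasSubst_expSeries a), map_add, h2]
  rw [map_one, ← coe_substAlgHom (hasSubst_expSeries a), map_one, map_one, add_zero]

/-- The logarithmic derivative of `expSeries a`. -/
theorem derivative_expSeries (a : ℕ → ℝ) :
    derivative ℝ (expSeries a) = (PowerSeries.mk fun n => a (n + 1)) * expSeries a := by
  rw [expSeries, derivative_subst (hasSubst_expSeries a), derivative_exp, mul_comm]
  congr 1
  ext n
  rw [coeff_derivative, coeff_mk, coeff_mk, if_neg n.succ_ne_zero]
  have : (n : ℝ) + 1 ≠ 0 := by positivity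
  push_cast
  field_simp

/-- A power series is determined by its constant coefficient and its logarithmic derivative. -/
theorem eq_of_derivative_eq_mul {u v g : PowerSeries ℝ} (h : constantCoeff u = constantCoeff v)
    (hu : derivative ℝ u = g * u) (hv : derivative ℝ v = g * v) : u = v := by
  ext n
  induction n using Nat.strong_induction_on with
  | _ n ih =>
    cases n with
    | zero => rwa [coeff_zero_eq_constantCoeff_apply, coeff_zero_eq_constantCoeff_apply]
    | succ n =>
      have h1 := congrArg (coeff n) hu
      have h2 := congrArg (coeff n) hv
      rw [coeff_derivative, coeff_mul] at h1 h2
      have h3 : coeff (n + 1) u * ((n : ℝ) + 1) = coeff (n + 1) v * (n + 1) := by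
        rw [h1, h2]
        refine Finset.sum_congr rfl fun p hp => ?_
        rw [ih p.2 (by have := Finset.HasAntidiagonal.mem_antidiagonal.1 hp; omega)]
      exact mul_right_cancel₀ (by positivity) h3

theorem eq_expSeries {u : PowerSeries ℝ} {a : ℕ → ℝ} (h : constantCoeff u = 1)
    (hu : derivative ℝ u = (PowerSeries.mk fun n => a (n + 1)) * u) : u = expSeries a :=
  eq_of_derivative_eq_mul (h.trans (constantCoeff_expSeries a).symm) hu (derivative_expSeries a)

theorem expSeries_congr {a b : ℕ → ℝ} (h : ∀ n, a (n + 1) = b (n + 1)) :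
    expSeries a = expSeries b :=
  eq_expSeries (constantCoeff_expSeries a) (by rw [derivative_expSeries]; simp only [h])

theorem expSeries_add (a b : ℕ → ℝ) :
    expSeries (fun n => a n + b n) = expSeries a * expSeries b := by
  refine (eq_expSeries ?_ ?_).symm
  · rw [map_mul, constantCoeff_expSeries, constantCoeff_expSeries, one_mul]
  · have : (PowerSeries.mk fun n => a (n + 1) + b (n + 1) : PowerSeries ℝ) =
        PowerSeries.mk (fun n => a (n + 1)) + PowerSeries.mk fun n => b (n + 1) := by
      ext n; simp
    rw [Derivation.leibniz, derivative_expSeries, derivative_expSeries, this, smul_eq_mul,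
      smul_eq_mul]
    ring

variable {ι : Type*} [Fintype ι] [DecidableEq ι] {R : Type*} [CommRing R]

/-- The resolventSeries of `M`: the matrix `∑ Mⁿ Xⁿ` of power series. -/
def resolventSeries (M : Matrix ι ι R) : Matrix ι ι (PowerSeries R) :=
  fun i j => PowerSeries.mk fun n => (M ^ n) i j

/-- The geometric series. -/
theorem one_sub_smul_mul_resolventSeries (M : Matrix ι ι R) :
    (1 - (X : PowerSeries R) • M.map (C (R := R))) * resolventSeries M = 1 := by
  ext i j n
  rw [sub_mul, one_mul, Matrix.sub_apply, smul_mul_assoc, Matrix.smul_apply, smul_eq_mul,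
    Matrix.mul_apply, map_sub]
  cases n with
  | zero =>
    by_cases h : i = j <;> simp [resolventSeries, Matrix.one_apply, h]
  | succ n =>
    have h1 : coeff (n + 1) ((1 : Matrix ι ι (PowerSeries R)) i j) = 0 := by
      rw [Matrix.one_apply]
      split_ifs
      · rw [coeff_one, if_neg n.succ_ne_zero]
      · rw [map_zero]
    rw [coeff_succ_X_mul, map_sum, h1, sub_eq_zero, resolventSeries, coeff_mk, pow_succ',
      Matrix.mul_apply]
    refine Finset.sum_congr rfl fun k _ => ?_
    rw [Matrix.map_apply, coeff_C_mul, resolventSeries, coeff_mk]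

/-- The determinant of a first order perturbation of the identity. -/
theorem det_one_add_smul_of_sq_eq_zero (N : Matrix ι ι R) {r : R} (hr : r ^ 2 = 0) :
    (1 + r • N).det = 1 + N.trace * r := by
  rw [Matrix.det_one_add_smul, hr, mul_zero, add_zero]

/-- The logarithmic derivative of `det (1 - X M)`. -/
theorem derivative_charpolyRev (M : Matrix ι ι R) :
    derivative R (M.charpolyRev : PowerSeries R) =
      -(PowerSeries.mk fun n => (M ^ (n + 1)).trace) * M.charpolyRev := by
  -- Evaluate `det (1 - x M)` at `x = X + ε` over the dual numbers: Taylor's formula gives the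
  -- derivative as coefficient of `ε`, and factoring out `1 - X M` leaves `1 + ε N` with
  -- `N = -(1 - X M)⁻¹ M`.
  let A := PowerSeries R
  let D := DualNumber A
  let S : Matrix ι ι A := resolventSeries M
  let N : Matrix ι ι A := -(S * M.map (C (R := R)))
  let φ : A →ₐ[R] D := TrivSqZeroExt.inlAlgHom R A A
  have hφC : ∀ r, φ (C r) = algebraMap R D r := fun r => rfl
  have heval : ∀ x : D, Polynomial.aeval x M.charpolyRev =
      (1 - x • M.map (algebraMap R D)).det := fun x => by
    rw [Matrix.charpolyRev, AlgHom.map_det]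
    congr 1
    rw [map_sub, map_one]
    congr 1
    ext1 i j
    simp only [AlgHom.mapMatrix_apply, Matrix.map_apply, Matrix.smul_apply, smul_eq_mul, map_mul,
      Polynomial.aeval_X, Polynomial.aeval_C]
  have hcoe : ∀ p : Polynomial R, Polynomial.aeval (X : A) p = (p : A) := fun p => by
    induction p using Polynomial.induction_on' with
    | add p q hp hq => rw [map_add, hp, hq, Polynomial.coe_add]
    | monomial n r =>
      rw [Polynomial.aeval_monomial, Polynomial.coe_monomial, ← Algebra.smul_def, X_pow_eq,
        ← map_smul, smul_eq_mul, mul_one]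
  have hcoe' : Polynomial.aeval (X : A) (Polynomial.derivative M.charpolyRev) =
      derivative R (M.charpolyRev : A) := by
    rw [hcoe, derivative_coe]
  have hmat : 1 - (φ X + DualNumber.eps) • M.map (algebraMap R D) =
      (1 - φ X • M.map (algebraMap R D)) * (1 + (DualNumber.eps : D) • N.map φ) := by
    have hM : (M.map (C (R := R))).map φ = M.map (algebraMap R D) := by
      ext1 i j
      exact hφC _
    have h : (1 - φ X • M.map (algebraMap R D)) * S.map φ = 1 := by
      have h := congrArg φ.mapMatrix (one_sub_smul_mul_resolventSeries M)
      rw [map_mul, map_sub, map_one] at h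
      rw [← h, ← hM]
      congr 2
      ext1 i j
      exact (map_mul φ _ _).symm
    have hN : N.map φ = -(S.map φ * M.map (algebraMap R D)) := by
      rw [← hM]
      exact (map_neg φ.mapMatrix _).trans (congrArg _ (map_mul φ.mapMatrix _ _))
    rw [mul_add, mul_one, Matrix.mul_smul, hN, mul_neg, ← mul_assoc, h, one_mul, add_smul,
      smul_neg]
    abel
  have htr : N.trace = -(PowerSeries.mk fun n => (M ^ (n + 1)).trace) := by
    rw [Matrix.trace_neg]
    congr 1
    ext n
    rw [coeff_mk, Matrix.trace, map_sum, pow_succ, Matrix.trace]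
    refine Finset.sum_congr rfl fun i _ => ?_
    rw [Matrix.diag_apply, Matrix.diag_apply, Matrix.mul_apply, Matrix.mul_apply, map_sum]
    refine Finset.sum_congr rfl fun k _ => ?_
    rw [Matrix.map_apply, coeff_mul_C]
    simp only [S, resolventSeries, coeff_mk]
  have key : Polynomial.aeval (φ X + DualNumber.eps) M.charpolyRev =
      φ (M.charpolyRev : A) * (1 + φ N.trace * DualNumber.eps) := by
    rw [heval, hmat, Matrix.det_mul, ← heval, Polynomial.aeval_algHom_apply, hcoe,
      det_one_add_smul_of_sq_eq_zero _ (DualNumber.eps_pow_two)]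
    congr 3
    simp [Matrix.trace, map_sum]
  rw [Polynomial.aeval_add_of_sq_eq_zero _ _ _ DualNumber.eps_pow_two,
    Polynomial.aeval_algHom_apply, Polynomial.aeval_algHom_apply, hcoe, hcoe'] at key
  have key' : (TrivSqZeroExt.inl (M.charpolyRev : A) : D) +
      TrivSqZeroExt.inl (derivative R (M.charpolyRev : A)) * DualNumber.eps =
      TrivSqZeroExt.inl (M.charpolyRev : A) * (1 + TrivSqZeroExt.inl N.trace * DualNumber.eps) :=
    key
  have := congrArg TrivSqZeroExt.snd key'
  rw [← htr]
  simpa [mul_comm] using this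

theorem expSeries_mul_expSeries_neg (a : ℕ → ℝ) :
    expSeries a * expSeries (fun n => -a n) = 1 := by
  rw [← expSeries_add]
  refine (eq_expSeries (map_one _) ?_).symm
  have : (PowerSeries.mk fun n => a (n + 1) + -a (n + 1) : PowerSeries ℝ) = 0 := by
    ext n; simp
  rw [this, zero_mul, derivative_one]

/-- For an integer matrix `M`, the power series `exp ∑ tr(Mⁿ) Xⁿ / n` is `1 / det (1 - X M)`; it
has integer coefficients and constant coefficient `1`. -/
theorem exists_unit_map_eq_expSeries_matrix (M : Matrix ι ι ℤ) :
    ∃ u : (PowerSeries ℤ)ˣ, PowerSeries.map (Int.castRingHom ℝ) u =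
      expSeries fun n => ((M ^ n).trace : ℝ) := by
  have hc : constantCoeff (M.charpolyRev : PowerSeries ℤ) = 1 := by
    rw [Polynomial.constantCoeff_coe, Polynomial.coeff_zero_eq_eval_zero,
      Matrix.eval_charpolyRev]
  obtain ⟨u, hu⟩ := isUnit_iff_constantCoeff.2 (hc ▸ isUnit_one)
  have hmap : PowerSeries.map (Int.castRingHom ℝ) u =
      expSeries fun n => -((M ^ n).trace : ℝ) := by
    refine eq_expSeries ?_ ?_
    · rw [hu, ← coeff_zero_eq_constantCoeff_apply, coeff_map, coeff_zero_eq_constantCoeff_apply,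
        hc, map_one]
    · have h := congrArg (PowerSeries.map (Int.castRingHom ℝ)) (derivative_charpolyRev M)
      rw [← hu, map_mul] at h
      refine Eq.trans ?_ (h.trans ?_)
      · ext n
        simp [coeff_derivative]
      · congr 1
        ext n
        simp
  refine ⟨u⁻¹, ?_⟩
  have h1 := expSeries_mul_expSeries_neg fun n => ((M ^ n).trace : ℝ)
  have h2 : PowerSeries.map (Int.castRingHom ℝ) ((u⁻¹ : (PowerSeries ℤ)ˣ) : PowerSeries ℤ) *
      PowerSeries.map (Int.castRingHom ℝ) u = 1 := by
    rw [← map_mul, Units.inv_mul, map_one]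
  rw [← hmap] at h1
  exact (eq_comm.1 (left_inv_eq_right_inv h2 (by rwa [mul_comm] at h1))).symm

/-- The series `exp ∑ tr(Tⁿ) Xⁿ / n` has integer coefficients if `T` has an integer matrix. -/
theorem exists_unit_map_eq_expSeries_trace {V : Type*} [AddCommMonoid V] [Module ℝ V]
    (b : Module.Basis ι ℝ V) {T : Module.End ℝ V}
    (hT : ∀ i j, ∃ k : ℤ, b.repr (T (b j)) i = k) :
    ∃ u : (PowerSeries ℤ)ˣ, PowerSeries.map (Int.castRingHom ℝ) u =
      expSeries fun n => LinearMap.trace ℝ V (T ^ n) := by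
  choose M hM using hT
  obtain ⟨u, hu⟩ := exists_unit_map_eq_expSeries_matrix (Matrix.of M)
  refine ⟨u, hu.trans (congrArg expSeries (funext fun n => ?_))⟩
  have h1 : LinearMap.toMatrix b b T = (Matrix.of M).map (Int.castRingHom ℝ) := by
    ext i j
    rw [LinearMap.toMatrix_apply, hM]
    rfl
  have h2 : (Matrix.of M).map (Int.castRingHom ℝ) ^ n =
      (Matrix.of M ^ n).map (Int.castRingHom ℝ) :=
    (map_pow (Int.castRingHom ℝ).mapMatrix (Matrix.of M) n).symm
  rw [LinearMap.trace_eq_matrix_trace ℝ b, ← LinearMap.toMatrix_pow, h1, h2, Matrix.trace,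
    Matrix.trace, Int.cast_sum]
  rfl

/-- The zeta function of a self-map of a finite set has integer coefficients. -/
theorem exists_unit_map_eq_expSeries_card (σ : ι → ι) :
    ∃ u : (PowerSeries ℤ)ˣ, PowerSeries.map (Int.castRingHom ℝ) u =
      expSeries fun n => ((Function.fixedPoints (σ^[n])).ncard : ℝ) := by
  let M : Matrix ι ι ℤ := Matrix.of fun i j => if σ j = i then 1 else 0
  have hM : ∀ n i j, (M ^ n) i j = if σ^[n] j = i then 1 else 0 := fun n => by
    induction n with
    | zero => intro i j; simp [Matrix.one_apply, eq_comm]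
    | succ n ih =>
      intro i j
      rw [pow_succ, Matrix.mul_apply, Finset.sum_eq_single (σ j)]
      · simp [M, ih]
        rfl
      · intro k _ hk
        simp [M, hk.symm]
      · simp
  obtain ⟨u, hu⟩ := exists_unit_map_eq_expSeries_matrix M
  refine ⟨u, hu.trans (congrArg expSeries (funext fun n => ?_))⟩
  have : Function.fixedPoints (σ^[n]) = ((Finset.univ.filter fun i => σ^[n] i = i : Finset ι) :
      Set ι) := by
    ext i
    simp [Function.mem_fixedPoints, Function.IsFixedPt]
  rw [this, ncard_coe_finset, Matrix.trace]
  simp [hM]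

end ExpSeries

/-! ### Integrality of the induced maps -/

section Integrality

universe u

variable {Ω : IntervalUnion}

open IntervalUnion

/-- The formal combinations with integer coefficients. -/
def integralCombinations (X : Type*) : AddSubgroup (X →₀ ℝ) where
  carrier := {v | ∀ x, ∃ k : ℤ, v x = k}
  zero_mem' _ := ⟨0, by simp⟩
  add_mem' hu hv x := by
    obtain ⟨k, hk⟩ := hu x
    obtain ⟨l, hl⟩ := hv x
    exact ⟨k + l, by rw [Finsupp.add_apply, hk, hl, Int.cast_add]⟩
  neg_mem' hv x := by
    obtain ⟨k, hk⟩ := hv x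
    exact ⟨-k, by rw [Finsupp.neg_apply, hk, Int.cast_neg]⟩

theorem single_mem_integral {X : Type*} (x : X) : Finsupp.single x 1 ∈ integralCombinations X :=
    fun y => by
  classical
  rw [Finsupp.single_apply]
  split_ifs
  · exact ⟨1, by simp⟩
  · exact ⟨0, by simp⟩

namespace PMMap

variable (F : PMMap Ω)

/-- Near a given point, `F` is monotone on the closed intervals ending at that point. -/
theorem eventually_monotoneOnIcc (x : Ω) :
    ∀ᶠ y in 𝓝 x, y = x ∨ F.MonotoneOnIcc x y ∨ F.MonotoneOnIcc y x := by
  have h1 : Ω.index ⁻¹' {Ω.index x} ∈ 𝓝 x :=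
    ((isOpen_discrete _).preimage continuous_index).mem_nhds rfl
  have h2 : (F.C \ {x})ᶜ ∈ 𝓝 x :=
    (F.finite_C.subset sdiff_subset).isClosed.isOpen_compl.mem_nhds fun h => h.2 rfl
  obtain ⟨ε, hε, hball⟩ := Metric.mem_nhds_iff.1 (inter_mem h1 h2)
  filter_upwards [Metric.ball_mem_nhds x hε] with y hy
  have hidx : Ω.index y = Ω.index x := (hball hy).1
  have hC : ∀ t : Ω, |(t : ℝ) - x| < ε → t ≠ x → t ∉ F.C := fun t ht hne htC =>
    (hball (show t ∈ Metric.ball x ε from ht)).2 ⟨htC, hne⟩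
  have hy' : |(y : ℝ) - x| < ε := hy
  rw [abs_lt] at hy'
  rcases lt_trichotomy (x : ℝ) y with h | h | h
  · refine Or.inr (Or.inl ⟨h, fun t ht => ?_⟩)
    have hmem := Icc_subset (mem_connectedComponent_iff.2 hidx.symm) (Ioo_subset_Icc_self ht)
    refine ⟨hmem, hC ⟨t, hmem⟩ ?_ fun e => ht.1.ne' (congrArg Subtype.val e)⟩
    rw [abs_lt]
    constructor <;> simp only <;> linarith [ht.1, ht.2]
  · exact Or.inl (Subtype.ext h.symm)
  · refine Or.inr (Or.inr ⟨h, fun t ht => ?_⟩)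
    have hmem := Icc_subset (mem_connectedComponent_iff.2 hidx) (Ioo_subset_Icc_self ht)
    refine ⟨hmem, hC ⟨t, hmem⟩ ?_ fun e => ht.2.ne (congrArg Subtype.val e)⟩
    rw [abs_lt]
    constructor <;> simp only <;> linarith [ht.1, ht.2]

/-- By connectedness the integrality of `F_{#1}(y - x)` reduces to the case where `F` is monotone on
`[x, y]`, in which it holds by definition. -/
theorem sharp1_mem_integral {x y : Ω} (hxy : y ∈ connectedComponent x) (v : S1 Ω)
    (hv : (v : Ω →₀ ℝ) = Finsupp.single y 1 - Finsupp.single x 1) :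
    (F.sharp1 v : Ω →₀ ℝ) ∈ integralCombinations Ω := by
  let P : Ω → Ω → Prop := fun x y => ∃ w : S1 Ω,
    (w : Ω →₀ ℝ) = Finsupp.single y 1 - Finsupp.single x 1 ∧
      (F.sharp1 w : Ω →₀ ℝ) ∈ integralCombinations Ω
  have hsymm : ∀ x y, P x y → P y x := fun x y ⟨w, hw, h⟩ =>
    ⟨-w, by rw [Submodule.coe_neg, hw, neg_sub], by
      rw [map_neg F.sharp1 w]; exact neg_mem h⟩
  have hmono : ∀ x y, F.MonotoneOnIcc x y → P x y := fun x y h =>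
    ⟨⟨_, Submodule.subset_span ⟨x, y, h.mem_component F, rfl⟩⟩, rfl, by
      rw [F.isSharp1_sharp1 x y h _ rfl]
      exact sub_mem (single_mem_integral _) (single_mem_integral _)⟩
  obtain ⟨w, hw, h⟩ : P x y := by
    refine isPreconnected_connectedComponent.induction₂ P (fun z _ => ?_) ?_
      (fun x y _ _ => hsymm x y) mem_connectedComponent hxy
    · refine ((F.eventually_monotoneOnIcc z).filter_mono nhdsWithin_le_nhds).mono fun y hy => ?_
      rcases hy with rfl | h | h
      · exact ⟨0, by simp, by rw [map_zero]; exact zero_mem _⟩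
      · exact hmono _ _ h
      · exact hsymm _ _ (hmono _ _ h)
    · rintro x y z - - - ⟨w, hw, h⟩ ⟨w', hw', h'⟩
      refine ⟨w' + w, by rw [Submodule.coe_add, hw, hw']; abel, ?_⟩
      rw [map_add F.sharp1 w' w]
      exact add_mem h' h
  rwa [show v = w from Subtype.ext (hv.trans hw.symm)]

end PMMap

variable {G : Type u} [TopologicalSpace G]

namespace IsInducedBy

variable {f : C(G, G)} {F : PMMap Ω} {π : Ω → G}

theorem transport_single (hF : IsInducedBy f F π) (x : Ω) :
    hF.transport (Finsupp.single x 1) = Finsupp.single (hF.lift (f (π x))) 1 := by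
  simpa using hF.transport_pow_single 0 x

theorem extension_single_mem_integral (hF : IsInducedBy f F π) (x : Ω) :
    hF.extension (Finsupp.single x 1) ∈ integralCombinations Ω := by
  have hx : x ∈ connectedComponent (base x) :=
    mem_connectedComponent_iff.2 (index_base x)
  rw [extension, LinearMap.add_apply]
  refine add_mem (F.sharp1_mem_integral hx _ ?_) ?_
  · simp
  · have : Finsupp.lmapDomain ℝ ℝ base (Finsupp.single x (1 : ℝ)) = Finsupp.single (base x) 1 :=
      Finsupp.mapDomain_single
    rw [LinearMap.comp_apply, this, hF.transport_single]
    exact single_mem_integral _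

/-- On left endpoints the extension is `transport`, with no contribution of `F_{#1}`. -/
theorem extension_single_left (hF : IsInducedBy f F π) (i : Fin Ω.m) :
    hF.extension (Finsupp.single (left i) 1) = Finsupp.single (hF.lift (f (π (left i)))) 1 := by
  have hb : base (left i) = left i := congrArg left (index_left i)
  have h : Finsupp.lmapDomain ℝ ℝ base (Finsupp.single (left i) (1 : ℝ)) =
      Finsupp.single (left i) 1 := by
    rw [Finsupp.lmapDomain_apply, Finsupp.mapDomain_single, hb]
  have h0 : (LinearMap.id - Finsupp.lmapDomain ℝ ℝ base).codRestrict (S1 Ω)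
      sub_lmapDomain_base_mem_S1 (Finsupp.single (left i) (1 : ℝ)) = 0 := by
    apply Subtype.ext
    rw [LinearMap.codRestrict_apply, LinearMap.sub_apply, h, LinearMap.id_apply, sub_self]
    rfl
  rw [extension, LinearMap.add_apply, LinearMap.comp_apply, LinearMap.comp_apply, h0, map_zero,
    map_zero, zero_add, LinearMap.comp_apply, h, hF.transport_single]

/-- The points of the boundary which are not chosen as representatives of the fibres of `π`. -/
def excess (hF : IsInducedBy f F π) : Set Ω := {x ∈ Ω.boundary | hF.lift (π x) ≠ x}

theorem finite_excess (hF : IsInducedBy f F π) : hF.excess.Finite :=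
  finite_boundary.subset (sep_subset _ _)

theorem lift_π_notMem_excess (hF : IsInducedBy f F π) (x : Ω) : hF.lift (π x) ∉ hF.excess :=
  fun h => h.2 (by rw [hF.π_lift])

/-- An element of the kernel of `π` is determined by its values on the excess points. -/
theorem eq_zero_of_forall_excess (hF : IsInducedBy f F π) {v : Ω →₀ ℝ}
    (hv : v ∈ LinearMap.ker (Finsupp.lmapDomain ℝ ℝ π)) (h : ∀ x ∈ hF.excess, v x = 0) :
    v = 0 := by
  have h0 : Finsupp.mapDomain (fun x => hF.lift (π x)) v = 0 := by
    have h1 : Finsupp.mapDomain (hF.lift ∘ π) v =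
        Finsupp.mapDomain hF.lift (Finsupp.mapDomain π v) := Finsupp.mapDomain_comp
    have h2 : Finsupp.mapDomain π v = 0 := hv
    rw [h2, Finsupp.mapDomain_zero] at h1
    exact h1
  rw [← h0, Finsupp.mapDomain]
  conv_lhs => rw [← Finsupp.sum_single v]
  refine Finset.sum_congr rfl fun x hx => ?_
  by_cases hb : hF.lift (π x) = x
  · simp only [hb]
  · refine absurd ?_ (Finsupp.mem_support_iff.1 hx)
    by_cases hxb : x ∈ Ω.boundary
    · exact h x ⟨hxb, hb⟩
    · exact hF.isBoundaryGluing.apply_eq_zero_of_mem_ker hv hxb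

/-- The difference of a point and the representative of its fibre. -/
def fibreDifference (hF : IsInducedBy f F π) (x : Ω) :
    LinearMap.ker (Finsupp.lmapDomain ℝ ℝ π) :=
  ⟨Finsupp.single x 1 - Finsupp.single (hF.lift (π x)) 1, by
    rw [LinearMap.mem_ker, map_sub, Finsupp.lmapDomain_apply, Finsupp.lmapDomain_apply,
      Finsupp.mapDomain_single, Finsupp.mapDomain_single, hF.π_lift, sub_self]⟩

open Classical in
theorem fibreDifference_apply (hF : IsInducedBy f F π) (x : Ω) (y : hF.excess) :
    (hF.fibreDifference x : Ω →₀ ℝ) y = if x = y then 1 else 0 := by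
  have h : hF.lift (π x) ≠ y := fun h => hF.lift_π_notMem_excess x (h ▸ y.2)
  rw [fibreDifference, Finsupp.sub_apply, Finsupp.single_apply, Finsupp.single_apply, if_neg h,
    sub_zero]

/-- The values on the excess points as coordinates on the kernel of `π`. -/
def kernelEquiv (hF : IsInducedBy f F π) :
    LinearMap.ker (Finsupp.lmapDomain ℝ ℝ π) ≃ₗ[ℝ] (hF.excess → ℝ) :=
  LinearEquiv.ofBijective
    ((LinearMap.pi fun x : hF.excess => Finsupp.lapply (x : Ω)) ∘ₗ Submodule.subtype _) <| by
    classical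
    have := hF.finite_excess.fintype
    constructor
    · refine (injective_iff_map_eq_zero _).2 fun v hv => ?_
      exact Subtype.ext (hF.eq_zero_of_forall_excess v.2 fun x hx => congrFun hv ⟨x, hx⟩)
    · intro c
      refine ⟨∑ x : hF.excess, c x • hF.fibreDifference x, funext fun y => ?_⟩
      rw [map_sum, Finset.sum_apply, Finset.sum_eq_single y]
      · simp [hF.fibreDifference_apply]
      · intro x _ hx
        simp [hF.fibreDifference_apply, Subtype.coe_inj, hx]
      · simp

theorem kernelEquiv_apply (hF : IsInducedBy f F π) (v : LinearMap.ker (Finsupp.lmapDomain ℝ ℝ π))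
    (x : hF.excess) : hF.kernelEquiv v x = (v : Ω →₀ ℝ) x := rfl

/-- On `S₀ / S₁` the extension sends each component of `Ω` to a component. -/
theorem exists_unit_map_eq_expSeries_quotientMap (hF : IsInducedBy f F π) :
    ∃ u : (PowerSeries ℤ)ˣ, PowerSeries.map (Int.castRingHom ℝ) u =
      expSeries fun n => LinearMap.trace ℝ _ (hF.quotientMap ^ n) := by
  refine exists_unit_map_eq_expSeries_trace (Module.Basis.ofRepr (quotientEquiv Ω)) fun i j => ?_
  have hj : (quotientEquiv Ω).symm (Finsupp.single j 1) =
      Submodule.Quotient.mk (Finsupp.single (left j) 1) := by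
    rw [LinearEquiv.symm_apply_eq, quotientEquiv_mk, Finsupp.lmapDomain_apply,
      Finsupp.mapDomain_single, index_left]
  change ∃ k : ℤ, quotientEquiv Ω (hF.quotientMap ((quotientEquiv Ω).symm (Finsupp.single j 1))) i
    = k
  have h : hF.quotientMap (Submodule.Quotient.mk (Finsupp.single (left j) 1)) =
      Submodule.Quotient.mk (hF.extension (Finsupp.single (left j) 1)) := rfl
  rw [hj, h, hF.extension_single_left, quotientEquiv_mk, Finsupp.lmapDomain_apply,
    Finsupp.mapDomain_single]
  exact single_mem_integral _ i

/-- The differences of an excess point and the representative of its fibre form a basis of `ker π`,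
and the coordinates in this basis are values on the excess points. -/
theorem exists_unit_map_eq_expSeries_kernelMap [T2Space G] (hF : IsInducedBy f F π) :
    ∃ u : (PowerSeries ℤ)ˣ, PowerSeries.map (Int.castRingHom ℝ) u =
      expSeries fun n => LinearMap.trace ℝ _ (hF.kernelMap ^ n) := by
  classical
  have := hF.finite_excess.fintype
  refine exists_unit_map_eq_expSeries_trace (Module.Basis.ofEquivFun hF.kernelEquiv) fun i j => ?_
  have hj : Module.Basis.ofEquivFun hF.kernelEquiv j = hF.fibreDifference j := by
    rw [Module.Basis.coe_ofEquivFun, LinearEquiv.symm_apply_eq]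
    ext y
    rw [kernelEquiv_apply, hF.fibreDifference_apply, Pi.single_apply]
    simp only [Subtype.coe_inj, eq_comm]
  rw [hj, Module.Basis.ofEquivFun_repr_apply, kernelEquiv_apply]
  have h : (hF.kernelMap (hF.fibreDifference j) : Ω →₀ ℝ) =
      hF.extension (Finsupp.single (j : Ω) 1) -
        hF.extension (Finsupp.single (hF.lift (π j)) 1) := map_sub hF.extension _ _
  rw [h]
  exact sub_mem (hF.extension_single_mem_integral _) (hF.extension_single_mem_integral _) _

end IsInducedBy

/-- The zeta function of the periodic orbits that meet a finite set. -/
theorem exists_unit_map_eq_expSeries_ncard {X : Type*} (f : X → X) {S : Set X} (hS : S.Finite) :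
    ∃ u : (PowerSeries ℤ)ˣ, PowerSeries.map (Int.castRingHom ℝ) u = expSeries fun n =>
      ((periodicOrbitsMeeting f S ∩ Function.fixedPoints (f^[n])).ncard : ℝ) := by
  classical
  have := (IsInducedBy.finite_periodicOrbitsMeeting (f := f) hS).fintype
  have hmaps : MapsTo f (periodicOrbitsMeeting f S) (periodicOrbitsMeeting f S) := by
    rintro _ ⟨o, ⟨x, hx, rfl, ho⟩, ⟨j, rfl⟩⟩
    exact ⟨_, ⟨x, hx, rfl, ho⟩, ⟨j + 1, Function.iterate_succ_apply' f j x⟩⟩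
  obtain ⟨u, hu⟩ := exists_unit_map_eq_expSeries_card (hmaps.restrict f _ _)
  refine ⟨u, hu.trans (congrArg expSeries (funext fun n => ?_))⟩
  congr 1
  rw [← ncard_image_of_injective _ Subtype.val_injective]
  congr 1
  ext x
  constructor
  · rintro ⟨y, hy, rfl⟩
    refine ⟨y.2, ?_⟩
    have := congrArg Subtype.val (hy : _ = _)
    rwa [hmaps.iterate_restrict] at this
  · rintro ⟨hx, hfix⟩
    refine ⟨⟨x, hx⟩, ?_, rfl⟩
    apply Subtype.ext
    rw [hmaps.iterate_restrict]
    exact hfix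

end Integrality

end

theorem theoreml2 {G : Type*} [TopologicalSpace G] (hG : IsGraph G)
    (f : C(G, G)) (hf : IsPMG f)
    (Ω : IntervalUnion) (F : PMMap Ω) (π : Ω → G) (hF : IsInducedBy f F π) :
    -- the traces and cardinalities that occur are genuine
    Module.Finite ℝ (realHomology G 0) ∧ Module.Finite ℝ (realHomology G 1) ∧
    (∀ n : ℕ, 1 ≤ n → PairFiniteRank (F.sharp0Top ^ n) (F.sharp1 ^ n)) ∧
    (periodicOrbitsMeeting f (π '' F.C)).Finite ∧
    -- the identity in `ℤ⟦X⟧`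
    ∃ ζ L E : PowerSeries ℤ,
      PowerSeries.map (Int.castRingHom ℝ) ζ = lefschetzZeta f ∧
      PowerSeries.map (Int.castRingHom ℝ) L = F.homologicalDeterminant ∧
      PowerSeries.map (Int.castRingHom ℝ) E = expSeries (fun n =>
        ((periodicOrbitsMeeting f (π '' F.C) ∩ Function.fixedPoints (f^[n])).ncard : ℝ)) ∧
      ζ = L * E := by
  have := hG.t2
  have hfin := F.finite_C.image π
  refine ⟨hF.finite_homologyZero, hF.finite_homologyOne, fun n _ => hF.pairFiniteRank n,
    IsInducedBy.finite_periodicOrbitsMeeting hfin, ?_⟩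
  obtain ⟨q, hq⟩ := hF.exists_unit_map_eq_expSeries_quotientMap
  obtain ⟨k, hk⟩ := hF.exists_unit_map_eq_expSeries_kernelMap
  obtain ⟨e, he⟩ := exists_unit_map_eq_expSeries_ncard f hfin
  -- `ζ` is the quotient of the series of the two terms of the Lefschetz number
  have hζ : PowerSeries.map (Int.castRingHom ℝ) ((q * k⁻¹ : (PowerSeries ℤ)ˣ) : PowerSeries ℤ) =
      lefschetzZeta f := by
    have h : lefschetzZeta f * PowerSeries.map (Int.castRingHom ℝ) k =
        PowerSeries.map (Int.castRingHom ℝ) q := by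
      rw [lefschetzZeta, hk, hq, ← expSeries_add]
      refine expSeries_congr fun n => ?_
      rw [hF.lefschetz_eq, sub_add_cancel]
    rw [Units.val_mul, map_mul, ← h, mul_assoc, ← map_mul, Units.mul_inv, map_one, mul_one]
  have hL : F.homologicalDeterminant * PowerSeries.map (Int.castRingHom ℝ) e =
      lefschetzZeta f := by
    rw [PMMap.homologicalDeterminant, pairDeterminant, he, lefschetzZeta, ← expSeries_add]
    refine expSeries_congr fun n => ?_
    rw [hF.lefschetz_eq, hF.neg_pairTrace_add_ncard]
  refine ⟨_, ((q * k⁻¹ * e⁻¹ : (PowerSeries ℤ)ˣ) : PowerSeries ℤ), e, hζ, ?_, he, ?_⟩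
  · rw [Units.val_mul, map_mul, hζ, ← hL, mul_assoc, ← map_mul, Units.mul_inv, map_one, mul_one]
  · rw [← Units.val_mul, inv_mul_cancel_right]
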